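/- **Setting.** Let $G$ be a locally compact (Hausdorff) group with left Haar measure $dt$ and modular function $\Delta$, normalized by $\Delta(t)\int_G f(st)\,ds=\int_G f(s)\,ds$. A $G$-algebra $(A,\alpha)$ is a C*-algebra $A$ with a strongly continuous action $\alpha:G\to\mathrm{Aut}(A)$. For $\xi,\eta\in A$ put $\langle\!\langle \xi,\eta\rangle\!\rangle(t)=\Delta(t)^{-1/2}\xi^*\alpha_t(\eta)$. The action $\alpha$ is *Rieffel proper with respect to* a linear subspace $\mathcal R\subseteq A$ if $\mathcal R$ is dense in $A$ and for all $\xi,\eta\in\mathcal R$ the functions $t\mapsto \Delta(t)^{-1/2}\xi^*\alpha_t(\eta)$ and $t\mapsto\xi^*\alpha_t(\eta)$ lie in $L^1(G,A)$. The reduced crossed product $A\rtimes_{\alpha,r}G$ is the norm closure in $\mathcal L(L^2(G,A))$ (the adjointable operators on the Hilbert $A$-module $L^2(G,A)$, the completion of $C_c(G,A)$ with respect to $\langle f,g\rangle=\int_G f(t)^*g(t)\,dt$) of the operators $\lambda_\varphi$, $\varphi\in C_c(G,A)$, where $(\lambda_\varphi g)(t)=\int_G\alpha_{t^{-1}}(\varphi(s))\,g(s^{-1}t)\,ds$.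 We identify $\varphi$ with $\lambda_\varphi$, also for continuous $\varphi\in L^1(G,A)$. For $\xi\in A$ and $\varphi\in C_c(G,A)$ put $\xi*\varphi=\int_G\Delta(t)^{-1/2}\alpha_t(\xi\varphi(t^{-1}))\,dt\in A$. If $\alpha$ is Rieffel proper with respect to $\mathcal R$, then $\mathcal F(\mathcal R)$ denotes the Hilbert $A\rtimes_{\alpha,r}G$-module obtained by completing $\tilde{\mathcal R}=\mathrm{span}\{\xi*\varphi:\xi\in\mathcal R,\ \varphi\in C_c(G,A)\}$ with respect to the $A\rtimes_{\alpha,r}G$-valued inner product $\langle\!\langle x,y\rangle\!\rangle$; it is realized by identifying $x\in\tilde{\mathcal R}$ with the operator $|x\rangle\!\rangle:L^2(G,A)\to A$, $f\mapsto\int_G\Delta(t)^{-1/2}\alpha_{t^{-1}}(x)f(t)\,dt$, as a closed subspace of the bounded operators $L^2(G,A)\to A$, with inner product $(S,T)\mapsto S^*T$ and right action $T\cdot c=T\circ c$. We say that $A$ is *saturated* with respect to $\mathcal R$ if $\{\langle\!\langle x,y\rangle\!\rangle:x,y\in\tilde{\mathcal R}\}$ spans a dense subspace of $A\rtimes_{\alpha,r}G$.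 **Corollary.** Let $(A,\alpha)$ and $(B,\beta)$ be $G$-algebras, let $\alpha$ be Rieffel proper with respect to the dense subspace $\mathcal R_A\subseteq A$, and let $\Phi:A\to\mathcal M(B)$ be a nondegenerate $G$-equivariant $*$-homomorphism. Put $\mathcal R_B:=\mathrm{span}\,\Phi(\mathcal R_A)B\subseteq B$. Then: 1. $\beta$ is Rieffel proper with respect to $\mathcal R_B$ (in particular, $\mathcal R_B$ is dense in $B$). 2. There is a unique $*$-homomorphism $\Phi\rtimes_rG:A\rtimes_{\alpha,r}G\to\mathcal M(B\rtimes_{\beta,r}G)$ such that $(\Phi\rtimes_rG)(\varphi)\,\psi$ is the function $t\mapsto\int_G\Phi(\varphi(s))\,\beta_s(\psi(s^{-1}t))\,ds$ for all $\varphi\in C_c(G,A)$, $\psi\in C_c(G,B)$; it is nondegenerate. The Hilbert modules $\mathcal F(\mathcal R_A)$ and $\mathcal F(\mathcal R_B)$ are well defined, and there is an isomorphism of Hilbert $B\rtimes_{\beta,r}G$-modules $$\mathcal F(\mathcal R_A)\otimes_{\Phi\rtimes_rG}\big(B\rtimes_{\beta,r}G\big)\;\cong\;\mathcal F(\mathcal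 R_B),$$ where the left side is the interior tensor product along $\Phi\rtimes_rG$. The isomorphism is the canonical one: it maps $x\otimes g$ to $\int_G\Delta(t)^{-1/2}\beta_t\big(\Phi(x)g(t^{-1})\big)\,dt$ for every $x\in A$ with $|x\rangle\!\rangle\in\mathcal F(\mathcal R_A)$ (so for all $x\in\tilde{\mathcal R}_A$) and every $g\in C_c(G,B)$. 3. If $A$ is saturated with respect to $\mathcal R_A$, then $B$ is saturated with respect to $\mathcal R_B$. -/

import Mathlib

open MeasureTheory UniformSpace
open scoped CompactlySupported MultiplierAlgebra TensorProduct

namespace RieffelProper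

universe u v w

/-- `a` is a positive element of the C*-algebra `A`, i.e. `a = b* b` for some `b`. -/
def IsPos {A : Type*} [NonUnitalCStarAlgebra A] (a : A) : Prop := ∃ b : A, a = star b * b

theorem isPos_iff {A : Type*} [NonUnitalCStarAlgebra A] [PartialOrder A] [StarOrderedRing A]
    (a : A) : IsPos a ↔ 0 ≤ a :=
  CStarAlgebra.nonneg_iff_eq_star_mul_self.symm

theorem isClosed_isPos (A : Type*) [NonUnitalCStarAlgebra A] : IsClosed {a : A | IsPos a} := by
  let _ := CStarAlgebra.spectralOrder A
  let _ := CStarAlgebra.spectralOrderedRing A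
  simp only [isPos_iff]
  exact CStarAlgebra.isClosed_nonneg

/-- A right pre-Hilbert module over the C*-algebra `A`, with a positive semidefinite `A`-valued
inner product which is linear in the second variable.  The right action `x · a` is `act a x`. -/
class PreHilbertModule (A : Type u) (V : Type v) [NonUnitalCStarAlgebra A] [AddCommGroup V]
    [Module ℂ V] where
  /-- the inner product `⟨x, y⟩` -/
  ip : V → V → A
  /-- the right action `x · a = act a x` -/
  act : A → V →ₗ[ℂ] V
  ip_add_right : ∀ x y z, ip x (y + z) = ip x y + ip x z
  ip_smul_right : ∀ (c : ℂ) x y, ip x (c • y) = c • ip x y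
  star_ip : ∀ x y, star (ip x y) = ip y x
  ip_self_pos : ∀ x, IsPos (ip x x)
  ip_act : ∀ a x y, ip x (act a y) = ip x y * a

/-- A (right) Hilbert module over the C*-algebra `A`: the inner product is definite, the norm is
`‖x‖ = ‖⟨x, x⟩‖ ^ (1/2)`, and the module is complete. (Mathlib's `CStarModule` is the left-handed
version of this notion.) The module laws of the action follow from `⟨x, y · a⟩ = ⟨x, y⟩ a` and
definiteness, which is a consequence of the formula for the norm. -/
class HilbertModule (A : Type u) (E : Type v) [NonUnitalCStarAlgebra A] [NormedAddCommGroup E]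
    [NormedSpace ℂ E] extends PreHilbertModule A E where
  norm_sq_eq : ∀ x : E, ‖x‖ ^ 2 = ‖ip x x‖
  complete : CompleteSpace E

namespace PreHilbertModule

section basic

variable {A : Type u} {V : Type v} [NonUnitalCStarAlgebra A] [AddCommGroup V] [Module ℂ V]
  (S : PreHilbertModule A V)

theorem ip_add_left (x y z : V) : S.ip (x + y) z = S.ip x z + S.ip y z := by
  rw [← S.star_ip, S.ip_add_right, star_add, S.star_ip, S.star_ip]

theorem ip_smul_left (c : ℂ) (x y : V) : S.ip (c • x) y = star c • S.ip x y := by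
  rw [← S.star_ip, S.ip_smul_right, star_smul, S.star_ip]

theorem ip_act_left (a : A) (x y : V) : S.ip (S.act a x) y = star a * S.ip x y := by
  rw [← S.star_ip, S.ip_act, star_mul, S.star_ip]

/-- the inner product as a sesquilinear map -/
def ipₛₗ : V →ₗ⋆[ℂ] V →ₗ[ℂ] A where
  toFun x :=
    { toFun := fun y => S.ip x y
      map_add' := fun y z => S.ip_add_right x y z
      map_smul' := fun c y => S.ip_smul_right c x y }
  map_add' x y := by ext z; exact S.ip_add_left x y z
  map_smul' c x := by ext z; exact S.ip_smul_left c x z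

/-- The Cauchy-Schwarz inequality. -/
theorem norm_ip_sq_le (x y : V) : ‖S.ip x y‖ ^ 2 ≤ ‖S.ip x x‖ * ‖S.ip y y‖ := by
  let _ := CStarAlgebra.spectralOrder A
  let _ := CStarAlgebra.spectralOrderedRing A
  have key : ∀ t : ℝ, ‖S.ip x x‖ < t → ‖S.ip x y‖ ^ 2 ≤ t * ‖S.ip y y‖ := by
    intro t ht
    have ht0 : 0 < t := (norm_nonneg _).trans_lt ht
    set a := S.ip x y with ha
    have h0 : 0 ≤ S.ip (S.act a x - (t : ℂ) • y) (S.act a x - (t : ℂ) • y) :=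
      (isPos_iff _).1 (S.ip_self_pos _)
    have h1 : S.ip (S.act a x - (t : ℂ) • y) (S.act a x - (t : ℂ) • y)
        = star a * S.ip x x * a - (2 * t : ℝ) • (star a * a) + (t ^ 2 : ℝ) • S.ip y y := by
      have e : S.act a x - (t : ℂ) • y = S.act a x + (-(t : ℂ)) • y := by
        rw [neg_smul, sub_eq_add_neg]
      rw [e]
      simp only [S.ip_add_left, S.ip_add_right, S.ip_smul_left, S.ip_smul_right, S.ip_act,
        S.ip_act_left]
      rw [← ha, ← S.star_ip x y, ← ha]
      simp only [star_neg, RCLike.star_def, Complex.conj_ofReal, ← Complex.coe_smul]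
      push_cast
      module
    rw [h1] at h0
    have h2 : star a * S.ip x x * a ≤ ‖S.ip x x‖ • (star a * a) :=
      CStarAlgebra.star_left_conjugate_le_norm_smul (S.star_ip x x)
    have h3 : ‖S.ip x x‖ • (star a * a) ≤ t • (star a * a) :=
      smul_le_smul_of_nonneg_right ht.le (star_mul_self_nonneg a)
    have h4 : star a * a ≤ t • S.ip y y := by
      have h5 : (0 : A) ≤ t • (t • S.ip y y - star a * a) := by
        refine h0.trans ?_
        refine (add_le_add_left (sub_le_sub_right (h2.trans h3) _) _).trans (le_of_eq ?_)
        module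
      have h6 := smul_nonneg (inv_nonneg.2 ht0.le) h5
      rw [smul_smul, inv_mul_cancel₀ ht0.ne', one_smul] at h6
      exact sub_nonneg.1 h6
    have h7 := CStarAlgebra.norm_le_norm_of_nonneg_of_le (star_mul_self_nonneg a) h4
    rw [CStarRing.norm_star_mul_self, norm_smul, Real.norm_of_nonneg ht0.le] at h7
    rw [sq]; exact h7
  refine le_of_forall_pos_lt_add ?_ |> fun h => h
  intro ε hε
  have hy : 0 < ‖S.ip y y‖ + 1 := by positivity
  have := key (‖S.ip x x‖ + ε / (2 * (‖S.ip y y‖ + 1))) (by linarith [show 0 < ε / (2 * (‖S.ip y y‖ + 1)) by positivity])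
  refine this.trans_lt ?_
  rw [add_mul]
  have : ε / (2 * (‖S.ip y y‖ + 1)) * ‖S.ip y y‖ < ε := by
    rw [div_mul_eq_mul_div, div_lt_iff₀ (by positivity)]
    nlinarith [norm_nonneg (S.ip y y)]
  linarith

theorem norm_ip_le (x y : V) : ‖S.ip x y‖ ≤ √‖S.ip x x‖ * √‖S.ip y y‖ := by
  rw [← Real.sqrt_mul (norm_nonneg _)]
  exact Real.le_sqrt_of_sq_le (S.norm_ip_sq_le x y)

end basic

section completion

variable {A : Type u} {V : Type v} [NonUnitalCStarAlgebra A] [SeminormedAddCommGroup V]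
  [NormedSpace ℂ V] (S : PreHilbertModule A V)

/-- the inner product on the completion: the continuous extension of that of `V` -/
noncomputable def completedIp (x y : Completion V) : A :=
  (Completion.isDenseInducing_coe.prodMap Completion.isDenseInducing_coe).extend
    (fun p : V × V => S.ip p.1 p.2) (x, y)

theorem continuous_ip (hS : ∀ x : V, ‖x‖ ^ 2 = ‖S.ip x x‖) : Continuous fun p : V × V => S.ip p.1 p.2 := by
  have hn : ∀ x : V, √‖S.ip x x‖ = ‖x‖ := fun x => by
    rw [← hS, Real.sqrt_sq (norm_nonneg _)]
  let f : V →L⋆[ℂ] V →L[ℂ] A := LinearMap.mkContinuous₂ S.ipₛₗ 1 fun x y => by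
    rw [one_mul, ← hn, ← hn]; exact S.norm_ip_le x y
  have : Continuous fun p : V × V => f p.1 p.2 := by fun_prop
  exact this

theorem continuous_completedIp (hS : ∀ x : V, ‖x‖ ^ 2 = ‖S.ip x x‖)
    {X : Type*} [TopologicalSpace X] {f g : X → Completion V}
    (hf : Continuous f) (hg : Continuous g) : Continuous fun x => S.completedIp (f x) (g x) := by
  let ip' : V →+ V →+ A :=
    { toFun := fun x => (S.ipₛₗ x).toAddMonoidHom
      map_zero' := by ext x; simp
      map_add' := fun x y => by ext z; simp }
  have h : Continuous fun p : V × V => ip' p.1 p.2 := S.continuous_ip hS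
  have h2 : Continuous fun p : Completion V × Completion V => S.completedIp p.1 p.2 :=
    (Completion.isDenseInducing_toCompl V).extend_Z_bilin (Completion.isDenseInducing_toCompl V) h
  exact h2.comp (hf.prodMk hg)

theorem completedIp_coe (hS : ∀ x : V, ‖x‖ ^ 2 = ‖S.ip x x‖) (x y : V) :
    S.completedIp (x : Completion V) (y : Completion V)
    = S.ip x y :=
  (Completion.isDenseInducing_coe.prodMap Completion.isDenseInducing_coe).extend_eq
    (S.continuous_ip hS) (x, y)

theorem norm_act_le (hS : ∀ x : V, ‖x‖ ^ 2 = ‖S.ip x x‖) (a : A) (x : V) : ‖S.act a x‖ ≤ ‖a‖ * ‖x‖ := by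
  rw [← abs_of_nonneg (norm_nonneg (S.act a x)), ← abs_of_nonneg (a := ‖a‖ * ‖x‖)
    (by positivity), ← sq_le_sq, hS, mul_pow, hS, S.ip_act, S.ip_act_left]
  calc _ ≤ ‖star a‖ * ‖S.ip x x‖ * ‖a‖ :=
        (norm_mul_le _ _).trans (mul_le_mul_of_nonneg_right (norm_mul_le _ _) (norm_nonneg _))
    _ = _ := by rw [norm_star]; ring

/-- the action by `a` on the completion: the continuous extension of that on `V` -/
noncomputable def completedAct (hS : ∀ x : V, ‖x‖ ^ 2 = ‖S.ip x x‖) (a : A) :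
    Completion V →L[ℂ] Completion V :=
  ((Completion.toComplL (𝕜 := ℂ) (E := V)).comp
    (LinearMap.mkContinuous (S.act a) ‖a‖ (S.norm_act_le hS a))).extend
    (Completion.toComplL (𝕜 := ℂ) (E := V))

theorem completedAct_coe (hS : ∀ x : V, ‖x‖ ^ 2 = ‖S.ip x x‖) (a : A) (x : V) :
    S.completedAct hS a (x : Completion V) = (S.act a x : Completion V) :=
  ContinuousLinearMap.extend_eq (e := Completion.toComplL (𝕜 := ℂ) (E := V)) _
    Completion.denseRange_coe (Completion.isUniformInducing_coe V) x

theorem completedIp_add_right (hS : ∀ x : V, ‖x‖ ^ 2 = ‖S.ip x x‖)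
    (x y z : Completion V) :
    S.completedIp x (y + z) = S.completedIp x y + S.completedIp x z := by
  induction x, y, z using Completion.induction_on₃ with
  | hp =>
    refine isClosed_eq ?_ (Continuous.add ?_ ?_) <;>
      exact S.continuous_completedIp hS (by fun_prop) (by fun_prop)
  | ih x y z =>
    rw [← Completion.coe_add, S.completedIp_coe hS, S.completedIp_coe hS, S.completedIp_coe hS,
      S.ip_add_right]

theorem completedIp_smul_right (hS : ∀ x : V, ‖x‖ ^ 2 = ‖S.ip x x‖)
    (c : ℂ) (x y : Completion V) : S.completedIp x (c • y) = c • S.completedIp x y := by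
  induction x, y using Completion.induction_on₂ with
  | hp =>
    have h1 : Continuous fun p : Completion V × Completion V => S.completedIp p.1 (c • p.2) :=
      S.continuous_completedIp hS continuous_fst (continuous_snd.const_smul c)
    have h2 : Continuous fun p : Completion V × Completion V => S.completedIp p.1 p.2 :=
      S.continuous_completedIp hS continuous_fst continuous_snd
    exact isClosed_eq h1 (h2.const_smul c)
  | ih x y =>
    rw [← Completion.coe_smul, S.completedIp_coe hS, S.completedIp_coe hS, S.ip_smul_right]

theorem star_completedIp (hS : ∀ x : V, ‖x‖ ^ 2 = ‖S.ip x x‖)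
    (x y : Completion V) : star (S.completedIp x y) = S.completedIp y x := by
  induction x, y using Completion.induction_on₂ with
  | hp =>
    have h1 : Continuous fun p : Completion V × Completion V => S.completedIp p.1 p.2 :=
      S.continuous_completedIp hS continuous_fst continuous_snd
    have h2 : Continuous fun p : Completion V × Completion V => S.completedIp p.2 p.1 :=
      S.continuous_completedIp hS continuous_snd continuous_fst
    exact isClosed_eq (continuous_star.comp h1) h2
  | ih x y => rw [S.completedIp_coe hS, S.completedIp_coe hS, S.star_ip]

theorem completedIp_self_pos (hS : ∀ x : V, ‖x‖ ^ 2 = ‖S.ip x x‖)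
    (x : Completion V) : IsPos (S.completedIp x x) := by
  induction x using Completion.induction_on with
  | hp =>
    have h : Continuous fun x : Completion V => S.completedIp x x :=
      S.continuous_completedIp hS continuous_id continuous_id
    exact (isClosed_isPos A).preimage h
  | ih x => rw [S.completedIp_coe hS]; exact S.ip_self_pos x

theorem completedIp_act (hS : ∀ x : V, ‖x‖ ^ 2 = ‖S.ip x x‖)
    (a : A) (x y : Completion V) :
    S.completedIp x (S.completedAct hS a y) = S.completedIp x y * a := by
  induction x, y using Completion.induction_on₂ with
  | hp =>
    refine isClosed_eq ?_ (Continuous.mul ?_ continuous_const)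
    · exact S.continuous_completedIp hS continuous_fst
        ((S.completedAct hS a).continuous.comp continuous_snd)
    · exact S.continuous_completedIp hS continuous_fst continuous_snd
  | ih x y => rw [S.completedAct_coe hS, S.completedIp_coe hS, S.completedIp_coe hS, S.ip_act]

theorem norm_sq_completed (hS : ∀ x : V, ‖x‖ ^ 2 = ‖S.ip x x‖)
    (x : Completion V) : ‖x‖ ^ 2 = ‖S.completedIp x x‖ := by
  induction x using Completion.induction_on with
  | hp =>
    have h : Continuous fun x : Completion V => S.completedIp x x :=
      S.continuous_completedIp hS continuous_id continuous_id
    exact isClosed_eq (by fun_prop) h.norm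
  | ih x => rw [S.completedIp_coe hS, Completion.norm_coe, hS]

/-- The completion of a pre-Hilbert module is a Hilbert module. -/
@[reducible]
noncomputable def completedModule (hS : ∀ x : V, ‖x‖ ^ 2 = ‖S.ip x x‖) :
    HilbertModule A (Completion V) where
  ip := S.completedIp
  act a := (S.completedAct hS a).toLinearMap
  ip_add_right := S.completedIp_add_right hS
  ip_smul_right := S.completedIp_smul_right hS
  star_ip := S.star_completedIp hS
  ip_self_pos := S.completedIp_self_pos hS
  ip_act := S.completedIp_act hS
  norm_sq_eq := S.norm_sq_completed hS
  complete := inferInstance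

end completion

section space

variable {A : Type u} {V : Type v} [NonUnitalCStarAlgebra A] [AddCommGroup V] [Module ℂ V]

/-- A copy of `V`, carrying the seminorm `‖x‖ = ‖⟨x, x⟩‖ ^ (1/2)`. -/
def Space (_ : PreHilbertModule A V) : Type v := V

variable (S : PreHilbertModule A V)

instance : AddCommGroup S.Space := inferInstanceAs (AddCommGroup V)
instance : Module ℂ S.Space := inferInstanceAs (Module ℂ V)

/-- the pre-Hilbert module structure of the copy of `V` -/
@[reducible]
def onSpace : PreHilbertModule A S.Space := S

/-- the seminorm `‖x‖ = ‖⟨x, x⟩‖ ^ (1/2)` -/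
noncomputable def seminorm : AddGroupSeminorm S.Space where
  toFun x := √‖S.onSpace.ip x x‖
  map_zero' := by
    have : S.onSpace.ip 0 0 = 0 := by simpa using S.onSpace.ip_smul_right 0 0 0
    simp [this]
  add_le' x y := by
    refine (Real.sqrt_le_left (by positivity)).2 ?_
    have hx := Real.sq_sqrt (norm_nonneg (S.onSpace.ip x x))
    have hy := Real.sq_sqrt (norm_nonneg (S.onSpace.ip y y))
    calc ‖S.onSpace.ip (x + y) (x + y)‖
        = ‖(S.onSpace.ip x x + S.onSpace.ip y x) + (S.onSpace.ip x y + S.onSpace.ip y y)‖ := by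
          rw [S.onSpace.ip_add_right, S.onSpace.ip_add_left, S.onSpace.ip_add_left]
      _ ≤ (‖S.onSpace.ip x x‖ + ‖S.onSpace.ip y x‖)
            + (‖S.onSpace.ip x y‖ + ‖S.onSpace.ip y y‖) :=
          (norm_add_le _ _).trans (add_le_add (norm_add_le _ _) (norm_add_le _ _))
      _ ≤ _ := by nlinarith [S.onSpace.norm_ip_le x y, S.onSpace.norm_ip_le y x]
  neg' x := by
    have h1 := S.onSpace.ip_smul_right (-1) (-x) x
    have h2 := S.onSpace.ip_smul_left (-1) x x
    simp only [neg_smul, one_smul, star_neg, star_one] at h1 h2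
    rw [h1, h2, neg_neg]

noncomputable instance : SeminormedAddCommGroup S.Space :=
  AddGroupSeminorm.toSeminormedAddCommGroup (E := S.Space) S.seminorm

theorem norm_def (x : S.Space) : ‖x‖ = √‖S.onSpace.ip x x‖ := rfl

theorem norm_sq (x : S.Space) : ‖x‖ ^ 2 = ‖S.onSpace.ip x x‖ := Real.sq_sqrt (norm_nonneg _)

noncomputable instance : NormedSpace ℂ S.Space where
  norm_smul_le c x := by
    refine le_of_eq ?_
    rw [S.norm_def, S.onSpace.ip_smul_right, S.onSpace.ip_smul_left, norm_smul, norm_smul,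
      norm_star, ← mul_assoc, Real.sqrt_mul (by positivity), Real.sqrt_mul_self (norm_nonneg _),
      S.norm_def]

/-- The (Hausdorff) completion of a pre-Hilbert module. -/
abbrev Completed : Type v := Completion S.Space

noncomputable instance : HilbertModule A S.Completed := S.onSpace.completedModule S.norm_sq

/-- the canonical map into the completion -/
noncomputable def toCompleted : V →ₗ[ℂ] S.Completed :=
  (Completion.toComplL (𝕜 := ℂ) (E := S.Space)).toLinearMap

theorem ip_toCompleted (x y : V) :
    HilbertModule.toPreHilbertModule.ip (S.toCompleted x) (S.toCompleted y) = S.ip x y :=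
  S.onSpace.completedIp_coe S.norm_sq x y

end space

end PreHilbertModule

section adjointable

variable {A : Type u} {E : Type v} [NonUnitalCStarAlgebra A] [NormedAddCommGroup E]
  [NormedSpace ℂ E] [HilbertModule A E]

namespace HilbertModule

variable (A) in
/-- the inner product `⟨x, y⟩` of a Hilbert `A`-module -/
def innerProd (x y : E) : A := PreHilbertModule.ip x y

variable (A) in
/-- the right action `x · a` on a Hilbert `A`-module -/
def rsmul (x : E) (a : A) : E := PreHilbertModule.act a x

theorem star_innerProd (x y : E) : star (innerProd A x y) = innerProd A y x :=
  PreHilbertModule.star_ip x y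

theorem innerProd_add_right (x y z : E) :
    innerProd A x (y + z) = innerProd A x y + innerProd A x z :=
  PreHilbertModule.ip_add_right x y z

theorem innerProd_add_left (x y z : E) :
    innerProd A (x + y) z = innerProd A x z + innerProd A y z :=
  PreHilbertModule.ip_add_left _ x y z

theorem innerProd_smul_right (c : ℂ) (x y : E) : innerProd A x (c • y) = c • innerProd A x y :=
  PreHilbertModule.ip_smul_right c x y

theorem innerProd_smul_left (c : ℂ) (x y : E) :
    innerProd A (c • x) y = star c • innerProd A x y :=
  PreHilbertModule.ip_smul_left _ c x y

theorem innerProd_rsmul (a : A) (x y : E) : innerProd A x (rsmul A y a) = innerProd A x y * a :=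
  PreHilbertModule.ip_act a x y

theorem innerProd_self_pos (x : E) : IsPos (innerProd A x x) := PreHilbertModule.ip_self_pos x

variable (A) in
theorem norm_sq_eq_innerProd (x : E) : ‖x‖ ^ 2 = ‖innerProd A x x‖ := norm_sq_eq x

theorem norm_innerProd_le (x y : E) : ‖innerProd A x y‖ ≤ ‖x‖ * ‖y‖ := by
  have := (HilbertModule.toPreHilbertModule (A := A) (E := E)).norm_ip_le x y
  rw [← norm_sq_eq, ← norm_sq_eq, Real.sqrt_sq (norm_nonneg _),
    Real.sqrt_sq (norm_nonneg _)] at this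
  exact this

variable (A) in
theorem ext_innerProd {y z : E} (h : ∀ x, innerProd A x y = innerProd A x z) : y = z := by
  have h0 : innerProd A (y - z) (y - z) = 0 := by
    have := ((HilbertModule.toPreHilbertModule (A := A) (E := E)).ipₛₗ (y - z)).map_sub y z
    exact this.trans (sub_eq_zero.2 (h _))
  have := norm_sq_eq_innerProd A (y - z)
  rw [h0, norm_zero] at this
  exact sub_eq_zero.1 (norm_eq_zero.1 (by simpa using this))

variable (A) in
theorem continuous_innerProd_right (x : E) : Continuous fun y : E => innerProd A x y :=
  (((HilbertModule.toPreHilbertModule (A := A) (E := E)).ipₛₗ x).mkContinuous ‖x‖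
    fun y => norm_innerProd_le x y).continuous

variable (A) in
theorem continuous_innerProd_left (y : E) : Continuous fun x : E => innerProd A x y := by
  have : (fun x : E => innerProd A x y) = fun x => star (innerProd A y x) := by
    funext x; exact (PreHilbertModule.star_ip y x).symm
  rw [this]
  exact continuous_star.comp (continuous_innerProd_right A y)

end HilbertModule

open HilbertModule

variable (A E) in
/-- The algebra `L(E)` of adjointable operators on a Hilbert `A`-module `E`. -/
def Adjointable : Subalgebra ℂ (E →L[ℂ] E) where
  carrier := {T | ∃ S : E →L[ℂ] E, ∀ x y, innerProd A (T x) y = innerProd A x (S y)}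
  mul_mem' := by
    rintro T T' ⟨S, h⟩ ⟨S', h'⟩
    exact ⟨S' * S, fun x y => by
      change innerProd A (T (T' x)) y = innerProd A x (S' (S y))
      rw [h, h']⟩
  add_mem' := by
    rintro T T' ⟨S, h⟩ ⟨S', h'⟩
    exact ⟨S + S', fun x y => by
      change innerProd A (T x + T' x) y = innerProd A x (S y + S' y)
      rw [innerProd_add_left, innerProd_add_right, h, h']⟩
  algebraMap_mem' c := ⟨star c • 1, fun x y => by
    simp [Algebra.algebraMap_eq_smul_one, innerProd_smul_left, innerProd_smul_right]⟩

namespace Adjointable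

/-- the adjoint of an adjointable operator -/
noncomputable instance : Star (Adjointable A E) where
  star T := ⟨T.2.choose, T.1, fun x y => by
    have h : innerProd A (T.1 y) x = innerProd A y (T.2.choose x) := T.2.choose_spec y x
    rw [← star_innerProd, h.symm, star_innerProd]⟩

theorem inner_left (T : Adjointable A E) (x y : E) :
    innerProd A (T.1 x) y = innerProd A x ((star T).1 y) :=
  T.2.choose_spec x y

theorem eq_star {T S : Adjointable A E}
    (h : ∀ x y, innerProd A (T.1 x) y = innerProd A x (S.1 y)) : S = star T :=
  Subtype.ext (ContinuousLinearMap.ext fun y => ext_innerProd A fun x => by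
    rw [← h, inner_left])

noncomputable instance : StarRing (Adjointable A E) where
  star_involutive T := (eq_star fun x y => by
    rw [← star_innerProd, ← inner_left, star_innerProd]).symm
  star_mul T S := (eq_star fun x y => by
    change innerProd A (T.1 (S.1 x)) y = innerProd A x ((star S).1 ((star T).1 y))
    rw [inner_left, inner_left]).symm
  star_add T S := (eq_star fun x y => by
    change innerProd A (T.1 x + S.1 x) y = innerProd A x ((star T).1 y + (star S).1 y)
    rw [innerProd_add_left, innerProd_add_right]
    exact congrArg₂ (· + ·) (inner_left T x y) (inner_left S x y)).symm

instance : StarModule ℂ (Adjointable A E) where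
  star_smul c T := (eq_star fun x y => by
    change innerProd A (c • T.1 x) y = innerProd A x (star c • (star T).1 y)
    rw [innerProd_smul_left, innerProd_smul_right]
    exact congrArg _ (inner_left T x y)).symm

theorem norm_mul_self_le (T : Adjointable A E) : ‖T‖ * ‖T‖ ≤ ‖star T * T‖ := by
  have h : ∀ x, ‖T.1 x‖ ≤ √‖star T * T‖ * ‖x‖ := fun x => by
    refine (Real.le_sqrt_of_sq_le (y := ‖star T * T‖ * ‖x‖ ^ 2) ?_).trans_eq ?_
    swap
    · rw [Real.sqrt_mul (norm_nonneg (star T * T)), Real.sqrt_sq (norm_nonneg _)]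
    rw [norm_sq_eq_innerProd A]
    have e : innerProd A (T.1 x) (T.1 x) = innerProd A x ((star T * T).1 x) := inner_left T x (T.1 x)
    rw [e]
    refine (norm_innerProd_le _ _).trans ?_
    rw [sq, mul_left_comm]
    exact mul_le_mul_of_nonneg_left ((star T * T).1.le_opNorm x) (norm_nonneg _)
  have h2 : ‖T‖ ≤ √‖star T * T‖ := T.1.opNorm_le_bound (Real.sqrt_nonneg _) h
  calc ‖T‖ * ‖T‖ ≤ √‖star T * T‖ * √‖star T * T‖ := by gcongr
    _ = _ := Real.mul_self_sqrt (norm_nonneg _)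

instance : CStarRing (Adjointable A E) where
  norm_mul_self_le := norm_mul_self_le

instance : CompleteSpace (Adjointable A E) := by
  have : CompleteSpace E := complete A
  refine Metric.complete_of_cauchySeq_tendsto fun u hu => ?_
  have c1 : CauchySeq fun n => (u n).1 := (uniformContinuous_subtype_val.comp_cauchySeq hu)
  have hs : UniformContinuous (star : Adjointable A E → Adjointable A E) :=
    (starₗᵢ ℂ : Adjointable A E ≃ₗᵢ⋆[ℂ] Adjointable A E).isometry.uniformContinuous
  have c2 : CauchySeq fun n => (star (u n)).1 :=
    uniformContinuous_subtype_val.comp_cauchySeq (hs.comp_cauchySeq hu)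
  obtain ⟨T, hT⟩ := cauchySeq_tendsto_of_complete c1
  obtain ⟨S, hS⟩ := cauchySeq_tendsto_of_complete c2
  have ev : ∀ {w : ℕ → E →L[ℂ] E} {W : E →L[ℂ] E}, Filter.Tendsto w Filter.atTop (nhds W) →
      ∀ x, Filter.Tendsto (fun n => w n x) Filter.atTop (nhds (W x)) := fun h x =>
    ((ContinuousLinearMap.apply ℂ E x).continuous.tendsto _).comp h
  refine ⟨⟨T, S, fun x y => ?_⟩, tendsto_subtype_rng.2 hT⟩
  have h1 := ((continuous_innerProd_left A y).tendsto _).comp (ev hT x)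
  have h2 := ((continuous_innerProd_right A x).tendsto _).comp (ev hS y)
  refine tendsto_nhds_unique h1 (h2.congr fun n => ?_)
  exact (inner_left (u n) x y).symm

/-- The adjointable operators form a C*-algebra. -/
noncomputable instance : CStarAlgebra (Adjointable A E) where

end Adjointable

end adjointable

section operators

open HilbertModule

variable {A : Type u} {E : Type v} [NonUnitalCStarAlgebra A] [NormedAddCommGroup E]
  [NormedSpace ℂ E] [HilbertModule A E] (C : NonUnitalStarSubalgebra ℂ (Adjointable A E))

/-- A concrete right Hilbert module over a C*-subalgebra `C ⊆ L(E)`: a closed subspace `X` of the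
bounded operators `E → A` with `X C ⊆ X` and `X* X ⊆ C`. The latter says that, for `S, T ∈ X`,
there is `P ∈ C` with `⟨x, P y⟩ = (S x)* (T y)`, that is, `P = S* T`. -/
structure OperatorModule where
  /-- the underlying space of operators -/
  carrier : Submodule ℂ (E →L[ℂ] A)
  isClosed : IsClosed (carrier : Set (E →L[ℂ] A))
  comp_mem : ∀ T ∈ carrier, ∀ c ∈ C, T.comp (c : E →L[ℂ] E) ∈ carrier
  exists_ip : ∀ S ∈ carrier, ∀ T ∈ carrier, ∃ P ∈ C, ∀ x y, innerProd A x (P.1 y) = star (S x) * T y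

variable {C}

theorem adjointable_ext {P Q : Adjointable A E}
    (h : ∀ x y, innerProd A x (P.1 y) = innerProd A x (Q.1 y)) : P = Q :=
  Subtype.ext (ContinuousLinearMap.ext fun y => ext_innerProd A fun x => h x y)

theorem exists_negPart {D : Type*} [NonUnitalCStarAlgebra D] (P : D) (hsa : IsSelfAdjoint P) :
    ∃ N R : D, star N = N ∧ N * P * N = -(star R * R) ∧ (R = 0 → IsPos P) := by
  let _ := CStarAlgebra.spectralOrder D
  let _ := CStarAlgebra.spectralOrderedRing D
  have hN0 : 0 ≤ P⁻ := CFC.negPart_nonneg P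
  have hN : star P⁻ = P⁻ := hN0.isSelfAdjoint
  obtain ⟨M, hM⟩ := (isPos_iff _).2 hN0
  refine ⟨P⁻, M * P⁻, hN, ?_, fun h => ?_⟩
  · have e2 : P * P⁻ = -(P⁻ * P⁻) := by
      nth_rewrite 1 [← CFC.posPart_sub_negPart P hsa]
      rw [sub_mul, CFC.posPart_mul_negPart, zero_sub]
    rw [mul_assoc, e2, star_mul, hN, mul_assoc, ← mul_assoc (star M), ← hM, mul_neg]
  · have h7 : P⁻ * P⁻ = 0 := by
      nth_rewrite 1 [hM]
      rw [mul_assoc, h, mul_zero]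
    rw [isPos_iff, ← CFC.negPart_eq_zero_iff P hsa, ← CStarRing.star_mul_self_eq_zero_iff, hN, h7]

/-- A self-adjoint `P ∈ C ⊆ L(E)` with `⟨x, P x⟩ ≥ 0` for all `x` is positive in `C`. -/
theorem isPos_of_innerProd [hC : IsClosed (C : Set (Adjointable A E))] (P : C)
    (hP : ∀ x : E, IsPos (innerProd A x (P.1.1 x))) (hsa : IsSelfAdjoint P) : IsPos P := by
  let _ := CStarAlgebra.spectralOrder A
  let _ := CStarAlgebra.spectralOrderedRing A
  obtain ⟨N, R, hN, e1, hpos⟩ := exists_negPart P hsa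
  have e2 : ∀ x : E, N.1.1 (P.1.1 (N.1.1 x)) = -((star R.1).1 (R.1.1 x)) := fun x =>
    congrArg (fun Q : C => Q.1.1 x) e1
  refine hpos (Subtype.ext (Subtype.ext (ContinuousLinearMap.ext fun x => ?_)))
  have h1 : innerProd A (N.1.1 x) (P.1.1 (N.1.1 x)) = -innerProd A (R.1.1 x) (R.1.1 x) := by
    rw [Adjointable.inner_left N.1, show star N.1 = N.1 from congrArg Subtype.val hN, e2,
      Adjointable.inner_left R.1, ← neg_one_smul ℂ, innerProd_smul_right, neg_one_smul]
  have h4 := (isPos_iff _).1 (hP (N.1.1 x))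
  rw [h1] at h4
  have h5 := (isPos_iff _).1 (innerProd_self_pos (A := A) (R.1.1 x))
  have h6 := norm_sq_eq_innerProd A (R.1.1 x)
  rw [le_antisymm (neg_nonneg.1 h4) h5, norm_zero] at h6
  exact norm_eq_zero.1 (by simpa using h6)

namespace OperatorModule

variable (X : OperatorModule C)

/-- the inner product `S* T` -/
noncomputable def ip (S T : X.carrier) : C :=
  ⟨(X.exists_ip S.1 S.2 T.1 T.2).choose, (X.exists_ip S.1 S.2 T.1 T.2).choose_spec.1⟩

theorem innerProd_ip (S T : X.carrier) (x y : E) :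
    innerProd A x ((X.ip S T).1.1 y) = star (S.1 x) * T.1 y :=
  (X.exists_ip S.1 S.2 T.1 T.2).choose_spec.2 x y

theorem ip_eq {S T : X.carrier} {P : C}
    (h : ∀ x y, innerProd A x (P.1.1 y) = star (S.1 x) * T.1 y) : X.ip S T = P :=
  Subtype.ext (adjointable_ext fun x y => by rw [h, innerProd_ip])

theorem star_ip (S T : X.carrier) : star (X.ip S T) = X.ip T S :=
  (X.ip_eq fun x y => by
    have := Adjointable.inner_left (X.ip S T).1 x y
    change innerProd A x ((star (X.ip S T).1).1 y) = _
    rw [← this, ← star_innerProd, innerProd_ip, star_mul, star_star]).symm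

/-- A concrete Hilbert module is a Hilbert module, with inner product `⟨S, T⟩ = S* T` and right
action `T · c = T ∘ c`. -/
noncomputable instance [hC : IsClosed (C : Set (Adjointable A E))] :
    HilbertModule C X.carrier where
  ip := X.ip
  act c :=
    { toFun := fun T => ⟨T.1.comp c.1.1, X.comp_mem T.1 T.2 c.1 c.2⟩
      map_add' := fun S T => by ext; rfl
      map_smul' := fun z T => by ext; rfl }
  ip_add_right S T T' := X.ip_eq fun x y => by
    change innerProd A x ((X.ip S T).1.1 y + (X.ip S T').1.1 y) = star (S.1 x) * (T.1 y + T'.1 y)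
    rw [innerProd_add_right, innerProd_ip, innerProd_ip, mul_add]
  ip_smul_right z S T := X.ip_eq fun x y => by
    change innerProd A x (z • (X.ip S T).1.1 y) = star (S.1 x) * (z • T.1 y)
    rw [innerProd_smul_right, innerProd_ip, mul_smul_comm]
  star_ip := X.star_ip
  ip_self_pos T := isPos_of_innerProd _ (fun x => ⟨T.1 x, X.innerProd_ip T T x x⟩) (X.star_ip T T)
  ip_act c S T := X.ip_eq fun x y => X.innerProd_ip S T x (c.1.1 y)
  norm_sq_eq T := by
    refine le_antisymm ?_ ?_
    · have h : ‖T.1‖ ≤ √‖X.ip T T‖ := by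
        refine T.1.opNorm_le_bound (Real.sqrt_nonneg _) fun x => ?_
        refine (Real.le_sqrt_of_sq_le (y := ‖X.ip T T‖ * ‖x‖ ^ 2) ?_).trans_eq ?_
        · rw [sq, ← CStarRing.norm_star_mul_self, ← innerProd_ip]
          refine (norm_innerProd_le _ _).trans ?_
          rw [sq, mul_left_comm]
          exact mul_le_mul_of_nonneg_left ((X.ip T T).1.1.le_opNorm x) (norm_nonneg _)
        · rw [Real.sqrt_mul (norm_nonneg (X.ip T T)), Real.sqrt_sq (norm_nonneg _)]
      calc ‖T‖ ^ 2 ≤ √‖X.ip T T‖ ^ 2 := by gcongr; exact h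
        _ = _ := Real.sq_sqrt (norm_nonneg _)
    · refine (X.ip T T).1.1.opNorm_le_bound (by positivity) fun y => ?_
      by_contra! hlt
      set z := (X.ip T T).1.1 y with hz
      have h1 : ‖z‖ ^ 2 ≤ ‖T‖ ^ 2 * ‖y‖ * ‖z‖ := by
        rw [norm_sq_eq_innerProd A z]
        nth_rewrite 2 [hz]
        rw [innerProd_ip]
        calc ‖star (T.1 z) * T.1 y‖ ≤ ‖T.1 z‖ * ‖T.1 y‖ := by
              rw [← norm_star (T.1 z)]; exact norm_mul_le _ _
          _ ≤ (‖T‖ * ‖z‖) * (‖T‖ * ‖y‖) := by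
              gcongr
              · exact T.1.le_opNorm z
              · exact T.1.le_opNorm y
          _ = _ := by ring
      have h2 : 0 < ‖z‖ := lt_of_le_of_lt (by positivity) hlt
      nlinarith
  complete := X.isClosed.completeSpace_coe

end OperatorModule

end operators

section tensor

open HilbertModule

variable {C : Type u} {X : Type v} {D : Type w} [NonUnitalCStarAlgebra C]
  [NormedAddCommGroup X] [NormedSpace ℂ X] [HilbertModule C X] [NonUnitalCStarAlgebra D]

theorem innerProd_sum_right {ι : Type*} (s : Finset ι) (x : X) (y : ι → X) :
    innerProd C x (∑ i ∈ s, y i) = ∑ i ∈ s, innerProd C x (y i) :=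
  map_sum ((HilbertModule.toPreHilbertModule (A := C) (E := X)).ipₛₗ x) y s

theorem innerProd_sum_left {ι : Type*} (s : Finset ι) (x : X) (y : ι → X) :
    innerProd C (∑ i ∈ s, y i) x = ∑ i ∈ s, innerProd C (y i) x := by
  rw [← star_innerProd, innerProd_sum_right, star_sum]
  simp only [star_innerProd]

/-- The Gram matrix of a finite family of vectors is positive. -/
theorem exists_gram {ι : Type} [Fintype ι] (x : ι → X) :
    ∃ S : ι → ι → C, ∀ i j, innerProd C (x i) (x j) = ∑ k, star (S k i) * S k j := by
  classical
  let _ := CStarAlgebra.spectralOrder C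
  let _ := CStarAlgebra.spectralOrderedRing C
  let P : CStarMatrix ι ι C := CStarMatrix.ofMatrix fun i j => innerProd C (x i) (x j)
  have hP : IsSelfAdjoint P := by
    ext i j
    exact star_innerProd (x j) (x i)
  obtain ⟨N, R, hN, e, hpos⟩ := exists_negPart P hP
  have hN' : ∀ i j, star (N i j) = N j i := fun i j => congrFun (congrFun hN j) i
  have hR : R = 0 := by
    have h1 : ∀ j, innerProd C (∑ i, rsmul C (x i) (N i j)) (∑ i, rsmul C (x i) (N i j))
        = -∑ k, star (R k j) * R k j := fun j => by
      have h2 : (N * P * N) j j = -(star R * R) j j := by rw [e]; rfl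
      have h3 : (star R * R) j j = ∑ k, star (R k j) * R k j := by
        rw [CStarMatrix.mul_apply]; rfl
      rw [← h3, ← h2, CStarMatrix.mul_apply, innerProd_sum_right]
      refine Finset.sum_congr rfl fun k _ => ?_
      rw [innerProd_rsmul, innerProd_sum_left, CStarMatrix.mul_apply]
      congr 1
      refine Finset.sum_congr rfl fun i _ => ?_
      rw [← star_innerProd, innerProd_rsmul, star_mul, star_innerProd, hN']
      rfl
    ext k j
    have h4 : ∑ k, star (R k j) * R k j = 0 :=
      le_antisymm (neg_nonneg.1 (by rw [← h1]; exact (isPos_iff _).1 (innerProd_self_pos _)))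
        (Finset.sum_nonneg fun k _ => star_mul_self_nonneg _)
    have h5 := (Finset.sum_eq_zero_iff_of_nonneg fun k _ => star_mul_self_nonneg (R k j)).1 h4 k
      (Finset.mem_univ k)
    exact CStarRing.star_mul_self_eq_zero_iff _ |>.1 h5
  obtain ⟨S, hS⟩ := hpos hR
  refine ⟨S, fun i j => ?_⟩
  have h6 : P i j = (star S * S) i j := by rw [← hS]
  rw [CStarMatrix.mul_apply] at h6
  exact h6

theorem multiplier_central (m : 𝓜(ℂ, D)) (b c : D) :
    star ((star m).fst b) * c = star b * m.fst c := by
  rw [DoubleCentralizer.star_fst, star_star, m.central]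

theorem multiplier_mul (m : 𝓜(ℂ, D)) (b c : D) : m.fst (b * c) = m.fst b * c := by
  have h : ∀ z : D, z * m.fst (b * c) = z * (m.fst b * c) := fun z => by
    rw [← m.central, ← mul_assoc, m.central, mul_assoc]
  have h1 := h (star (m.fst (b * c) - m.fst b * c))
  rw [← sub_eq_zero, ← mul_sub, CStarRing.star_mul_self_eq_zero_iff] at h1
  exact sub_eq_zero.1 h1

/-- the linear map `m ↦ b* Ψ(m) c` -/
noncomputable def tensorMid (Ψ : C →⋆ₙₐ[ℂ] 𝓜(ℂ, D)) (b c : D) : C →ₗ[ℂ] D where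
  toFun m := star b * (Ψ m).fst c
  map_add' m m' := by simp [mul_add]
  map_smul' z m := by simp [mul_smul_comm]

variable (X) (Ψ : C →⋆ₙₐ[ℂ] 𝓜(ℂ, D))

/-- `⟨x ⊗ b, y ⊗ c⟩ = b* Ψ(⟨x, y⟩) c` -/
noncomputable def tensorForm : X ⊗[ℂ] D →ₗ⋆[ℂ] X ⊗[ℂ] D →ₗ[ℂ] D :=
  TensorProduct.lift <| LinearMap.mk₂'ₛₗ (starRingEnd ℂ) (starRingEnd ℂ)
    (fun (x : X) (b : D) => TensorProduct.lift <| LinearMap.mk₂ ℂ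
      (fun (y : X) (c : D) => star b * (Ψ (innerProd C x y)).fst c)
      (fun y y' c => by simp [innerProd_add_right, mul_add])
      (fun z y c => by simp [innerProd_smul_right, mul_smul_comm])
      (fun y c c' => by simp [mul_add])
      (fun z y c => by simp [mul_smul_comm]))
    (fun x x' b => by ext y c; simp [innerProd_add_left, mul_add])
    (fun z x b => by ext y c; simp [innerProd_smul_left, mul_smul_comm])
    (fun x b b' => by ext y c; simp [add_mul])
    (fun z x b => by ext y c; simp [smul_mul_assoc])

theorem tensorForm_tmul (x y : X) (b c : D) :
    tensorForm X Ψ (x ⊗ₜ b) (y ⊗ₜ c) = star b * (Ψ (innerProd C x y)).fst c := rfl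

theorem star_tensorForm (v w : X ⊗[ℂ] D) : star (tensorForm X Ψ v w) = tensorForm X Ψ w v := by
  induction v using TensorProduct.induction_on with
  | zero => simp
  | add v v' h h' => rw [map_add, LinearMap.add_apply, star_add, h, h', map_add]
  | tmul x b =>
    induction w using TensorProduct.induction_on with
    | zero => simp
    | add v v' h h' => rw [map_add, star_add, h, h', map_add, LinearMap.add_apply]
    | tmul y c =>
      rw [tensorForm_tmul, tensorForm_tmul, ← star_innerProd y x, map_star, star_mul, star_star,
        multiplier_central]

theorem tensorForm_self_pos (v : X ⊗[ℂ] D) : IsPos (tensorForm X Ψ v v) := by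
  let _ := CStarAlgebra.spectralOrder D
  let _ := CStarAlgebra.spectralOrderedRing D
  obtain ⟨n, x, b, rfl⟩ : ∃ (n : ℕ) (x : Fin n → X) (b : Fin n → D), v = ∑ i, x i ⊗ₜ[ℂ] b i :=
    TensorProduct.exists_sum_tmul_eq v
  obtain ⟨S, hS⟩ := exists_gram (C := C) x
  have h : tensorForm X Ψ (∑ i, x i ⊗ₜ[ℂ] b i) (∑ i, x i ⊗ₜ[ℂ] b i)
      = ∑ k, star (∑ i, (Ψ (S k i)).fst (b i)) * (∑ j, (Ψ (S k j)).fst (b j)) := by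
    have h1 : ∀ i j, star (b i) * (Ψ (innerProd C (x i) (x j))).fst (b j)
        = ∑ k, star ((Ψ (S k i)).fst (b i)) * (Ψ (S k j)).fst (b j) := fun i j => by
      have hadd : ∀ m : C, star (b i) * (Ψ m).fst (b j)
          = tensorMid Ψ (b i) (b j) m := fun m => rfl
      rw [hadd, hS, map_sum]
      refine Finset.sum_congr rfl fun k _ => ?_
      rw [← hadd, map_mul, map_star, DoubleCentralizer.mul_fst, mul_apply_eq_comp,
        ← multiplier_central, star_star]
    simp only [map_sum, LinearMap.sum_apply, tensorForm_tmul, h1, star_sum, Finset.sum_mul,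
      Finset.mul_sum]
    refine (Finset.sum_congr rfl fun j _ => Finset.sum_comm).trans ?_
    exact Finset.sum_comm
  rw [isPos_iff, h]
  exact Finset.sum_nonneg fun k _ => star_mul_self_nonneg _

/-- The algebraic tensor product `X ⊗ D` with the `D`-valued semi-inner product
`⟨x ⊗ b, y ⊗ c⟩ = b* Ψ(⟨x, y⟩) c` and the right action `(x ⊗ b) · d = x ⊗ b d`. -/
@[reducible]
noncomputable def tensorPre : PreHilbertModule D (X ⊗[ℂ] D) where
  ip v w := tensorForm X Ψ v w
  act d := TensorProduct.map LinearMap.id (LinearMap.mulRight ℂ d)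
  ip_add_right v := map_add (tensorForm X Ψ v)
  ip_smul_right z v := map_smul (tensorForm X Ψ v) z
  star_ip := star_tensorForm X Ψ
  ip_self_pos := tensorForm_self_pos X Ψ
  ip_act d v w := by
    change tensorForm X Ψ v (TensorProduct.map LinearMap.id (LinearMap.mulRight ℂ d) w)
      = tensorForm X Ψ v w * d
    induction v using TensorProduct.induction_on with
    | zero => simp
    | add v v' h h' => rw [map_add, LinearMap.add_apply, LinearMap.add_apply, h, h', add_mul]
    | tmul x b =>
      induction w using TensorProduct.induction_on with
      | zero => simp
      | add v v' h h' => rw [map_add, map_add, h, h', map_add, add_mul]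
      | tmul y c =>
        rw [TensorProduct.map_tmul, tensorForm_tmul, tensorForm_tmul, mul_assoc]
        change star b * (Ψ (innerProd C x y)).fst (c * d) = _
        rw [multiplier_mul]

/-- The interior tensor product `X ⊗_Ψ D` of a Hilbert `C`-module `X` with `D` along a
*-homomorphism `Ψ : C → M(D)`; a Hilbert `D`-module. -/
abbrev InteriorTensor : Type (max v w) := (tensorPre X Ψ).Completed

variable {X}

/-- the elementary tensor `x ⊗ d` in `X ⊗_Ψ D` -/
noncomputable def interiorTmul (x : X) (d : D) : InteriorTensor X Ψ :=
  (tensorPre X Ψ).toCompleted (x ⊗ₜ[ℂ] d)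

end tensor

section L2

variable {G : Type u} [TopologicalSpace G] [MeasurableSpace G] [BorelSpace G]
  (A : Type v) [NonUnitalCStarAlgebra A] (μ : Measure G) [IsFiniteMeasureOnCompacts μ]

variable {A} in
theorem integrable_star_mul (f g : C_c(G, A)) : Integrable (fun t => star (f t) * g t) μ := by
  refine Continuous.integrable_of_hasCompactSupport ?_ g.hasCompactSupport.mul_left
  exact (continuous_star.comp f.continuous).mul g.continuous

/-- `C_c(G, A)` with the `A`-valued inner product `⟨f, g⟩ = ∫ f(t)* g(t) dt` and the pointwise
right action `(f · a)(t) = f(t) a`. -/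
@[reducible]
noncomputable def l2Pre : PreHilbertModule A C_c(G, A) where
  ip f g := ∫ t, star (f t) * g t ∂μ
  act a :=
    { toFun := fun f =>
        { toFun := fun t => f t * a
          continuous_toFun := f.continuous.mul continuous_const
          hasCompactSupport' := f.hasCompactSupport.mul_right }
      map_add' := fun f g => by ext t; exact add_mul (f t) (g t) a
      map_smul' := fun c f => by ext t; exact smul_mul_assoc c (f t) a }
  ip_add_right f g h := by
    rw [← integral_add (integrable_star_mul μ f g) (integrable_star_mul μ f h)]
    simp only [CompactlySupportedContinuousMap.add_apply, mul_add]
  ip_smul_right c f g := by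
    rw [← integral_smul]
    simp only [CompactlySupportedContinuousMap.smul_apply, mul_smul_comm]
  star_ip f g := by
    have := (starL' ℝ : A ≃L[ℝ] A).integral_comp_comm (μ := μ) (fun t => star (f t) * g t)
    refine this.symm.trans ?_
    simp
  ip_self_pos f := by
    let _ := CStarAlgebra.spectralOrder A
    let _ := CStarAlgebra.spectralOrderedRing A
    rw [isPos_iff]
    exact integral_nonneg fun t => star_mul_self_nonneg (f t)
  ip_act a f g := by
    rw [← integral_mul_const_of_integrable (integrable_star_mul μ f g)]
    exact congrArg (integral μ) (funext fun t => (mul_assoc (star (f t)) (g t) a).symm)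

/-- The Hilbert `A`-module `L²(G, A)`, the completion of `C_c(G, A)`. -/
abbrev L2 : Type (max u v) := (l2Pre A μ).Completed


variable {A} in
/-- the canonical map `C_c(G, A) → L²(G, A)` -/
noncomputable def toL2 : C_c(G, A) →ₗ[ℂ] L2 A μ := (l2Pre A μ).toCompleted

end L2

section systems

open HilbertModule

variable {G : Type u} [TopologicalSpace G] [Group G] [IsTopologicalGroup G]
  [LocallyCompactSpace G] [MeasurableSpace G] [BorelSpace G]

/-- The modular function `Δ` of `G`, normalized by `μ(E t) = Δ(t) μ(E)` for left Haar measures `μ`;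
equivalently `Δ(t) ∫ f(s t) ds = ∫ f(s) ds`. (Mathlib's `modularCharacterFun` is defined by
`∫ f(s t) ds = modularCharacterFun t * ∫ f(s) ds`, so it is the inverse of `Δ`.) -/
noncomputable def modular (t : G) : ℝ := ((Measure.modularCharacterFun t : NNReal) : ℝ)⁻¹

variable {A : Type v} [NonUnitalCStarAlgebra A] (α : G →* (A ≃⋆ₐ[ℂ] A)) (μ : Measure G)

/-- the function `⟨⟨ξ, η⟩⟩ : t ↦ Δ(t)^(-1/2) ξ* α_t(η)` -/
noncomputable def bracket (ξ η : A) (t : G) : A :=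
  (modular t ^ (-(1 / 2) : ℝ)) • (star ξ * α t η)

/-- The action `α` is Rieffel proper with respect to the dense subspace `R ⊆ A`: for `ξ, η ∈ R`
the functions `t ↦ Δ(t)^(-1/2) ξ* α_t(η)` and `t ↦ ξ* α_t(η)` belong to `L¹(G, A)`. -/
structure IsRieffelProper (R : Submodule ℂ A) : Prop where
  dense : Dense (R : Set A)
  integrable_bracket : ∀ ξ ∈ R, ∀ η ∈ R, Integrable (bracket α ξ η) μ
  integrable : ∀ ξ ∈ R, ∀ η ∈ R, Integrable (fun t => star ξ * α t η) μ

/-- `ξ * φ = ∫ Δ(t)^(-1/2) α_t(ξ φ(t⁻¹)) dt` -/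
noncomputable def elementConv (ξ : A) (φ : G → A) : A :=
  ∫ t, (modular t ^ (-(1 / 2) : ℝ)) • α t (ξ * φ t⁻¹) ∂μ

variable [IsFiniteMeasureOnCompacts μ]

/-- `P ∈ L(L²(G, A))` is the Laurent operator with (continuous) symbol `φ : G → A`, i.e.
`P = λ_φ` with `(λ_φ g)(t) = ∫ α_{t⁻¹}(φ(s)) g(s⁻¹ t) ds = ∫ Δ(s)⁻¹ α_{t⁻¹}(φ(t s⁻¹)) g(s) ds`
for `g ∈ C_c(G, A)`; this is expressed through the inner products
`⟨h, P g⟩ = ∫ h(t)* (λ_φ g)(t) dt`, `g, h ∈ C_c(G, A)`, which determine `P`. -/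
def IsLaurent (φ : G → A) (P : Adjointable A (L2 A μ)) : Prop :=
  ∀ g h : C_c(G, A), innerProd A (toL2 μ h) (P.1 (toL2 μ g))
    = ∫ t, star (h t) * ∫ s, α t⁻¹ (φ s) * g (s⁻¹ * t) ∂μ ∂μ

/-- `T : L²(G, A) → A` is the operator `|ξ⟩⟩ : f ↦ ∫ Δ(t)^(-1/2) α_{t⁻¹}(ξ) f(t) dt`. -/
def IsKet (ξ : A) (T : L2 A μ →L[ℂ] A) : Prop :=
  ∀ f : C_c(G, A), T (toL2 μ f) = ∫ t, (modular t ^ (-(1 / 2) : ℝ)) • (α t⁻¹ ξ * f t) ∂μ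

/-- The reduced crossed product `A ⋊_{α,r} G ⊆ L(L²(G, A))` as a C*-subalgebra: the closure of the
*-algebra of the operators `λ_φ`, `φ ∈ C_c(G, A)`. -/
noncomputable def crossedProduct : NonUnitalStarSubalgebra ℂ (Adjointable A (L2 A μ)) :=
  (NonUnitalStarAlgebra.adjoin ℂ
    {P | ∃ φ : C_c(G, A), IsLaurent α μ φ P}).topologicalClosure

instance isClosed_crossedProduct :
    IsClosed (crossedProduct α μ : Set (Adjointable A (L2 A μ))) :=
  NonUnitalStarSubalgebra.isClosed_topologicalClosure _

/-- The reduced crossed product `A ⋊_{α,r} G` as a C*-algebra. -/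
def CrossedProduct : Type (max u v) := crossedProduct α μ

noncomputable instance : NonUnitalCStarAlgebra (CrossedProduct α μ) :=
  inferInstanceAs (NonUnitalCStarAlgebra (crossedProduct α μ))

variable {α μ} in
/-- an element of `A ⋊_{α,r} G` as an operator on `L²(G, A)` -/
def CrossedProduct.op (P : CrossedProduct α μ) : Adjointable A (L2 A μ) := P.1

/-- The Hilbert `A ⋊_{α,r} G`-module `F(R)` of a subspace `R` of `A`: the completion of
`R̃ = span {ξ * φ : ξ ∈ R, φ ∈ C_c(G, A)}` with respect to the `A ⋊_{α,r} G`-valued inner product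
`⟨⟨x, y⟩⟩`, realized as the closed linear span of the operators `|ξ * φ⟩⟩ : L²(G, A) → A`.

There is at most one such module, since `carrier_eq` determines it; the remaining fields say that
every `x = ξ * φ` does define an operator `|x⟩⟩`, that the inner product `S* T` and the action
`T ∘ c` of the module restrict to the space, and that `|x⟩⟩* |y⟩⟩` is the element `⟨⟨x, y⟩⟩` of
`A ⋊_{α,r} G`. -/
structure FixModule (R : Submodule ℂ A) extends OperatorModule (crossedProduct α μ) where
  carrier_eq : carrier = (Submodule.span ℂ
    {T | ∃ ξ ∈ R, ∃ φ : C_c(G, A), IsKet α μ (elementConv α μ ξ φ) T}).topologicalClosure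
  exists_ket : ∀ ξ ∈ R, ∀ φ : C_c(G, A), ∃ T ∈ carrier, IsKet α μ (elementConv α μ ξ φ) T
  isLaurent_ip : ∀ x y (S T : carrier), IsKet α μ x S.1 → IsKet α μ y T.1 →
    IsLaurent α μ (bracket α x y) (toOperatorModule.ip S T).1

/-- the underlying space of `F(R)` -/
abbrev FixModule.Carrier {R : Submodule ℂ A} (F : FixModule α μ R) : Type (max u v) :=
  F.toOperatorModule.carrier

noncomputable instance {R : Submodule ℂ A} (F : FixModule α μ R) :
    HilbertModule (CrossedProduct α μ) F.Carrier :=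
  inferInstanceAs (HilbertModule (crossedProduct α μ) F.toOperatorModule.carrier)

/-- The action `α` is saturated with respect to `R`: the elements `⟨⟨x, y⟩⟩` with
`x, y ∈ R̃ = span {ξ * φ : ξ ∈ R, φ ∈ C_c(G, A)}` span a dense subspace of `A ⋊_{α,r} G`. -/
def IsSaturated (R : Submodule ℂ A) : Prop :=
  Dense (Submodule.span ℂ {P : CrossedProduct α μ | ∃ ξ ∈ R, ∃ η ∈ R, ∃ φ ψ : C_c(G, A),
    IsLaurent α μ (bracket α (elementConv α μ ξ φ) (elementConv α μ η ψ)) P.op} : Set (CrossedProduct α μ))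

end systems

section morphisms

open HilbertModule

/-- A *-homomorphism `Φ : A → M(B)` is nondegenerate if `Φ(A) B` spans a dense subspace of `B`. -/
def IsNondegenerate {A : Type u} {B : Type v} [NonUnitalCStarAlgebra A] [NonUnitalCStarAlgebra B]
    (Φ : A →⋆ₙₐ[ℂ] 𝓜(ℂ, B)) : Prop :=
  Dense (Submodule.span ℂ {b : B | ∃ a c, b = (Φ a).fst c} : Set B)

/-- the subspace `Φ(R) B`, the linear span of the products `Φ(x) c` with `x ∈ R`, `c ∈ B` -/
def mulRange {A : Type u} {B : Type v} [NonUnitalCStarAlgebra A] [NonUnitalCStarAlgebra B]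
    (Φ : A →⋆ₙₐ[ℂ] 𝓜(ℂ, B)) (R : Submodule ℂ A) : Submodule ℂ B :=
  Submodule.span ℂ {b : B | ∃ x ∈ R, ∃ c, b = (Φ x).fst c}

/-- An isomorphism of Hilbert `D`-modules. -/
structure HilbertModuleIso (D : Type u) (E : Type v) (F : Type w) [NonUnitalCStarAlgebra D]
    [NormedAddCommGroup E] [NormedSpace ℂ E] [HilbertModule D E]
    [NormedAddCommGroup F] [NormedSpace ℂ F] [HilbertModule D F] extends E ≃ₗ[ℂ] F where
  map_innerProd : ∀ x y, innerProd D (toFun x) (toFun y) = innerProd D x y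
  map_rsmul : ∀ x d, toFun (rsmul D x d) = rsmul D (toFun x) d

variable {G : Type u} [TopologicalSpace G] [Group G] [IsTopologicalGroup G]
  [LocallyCompactSpace G] [MeasurableSpace G] [BorelSpace G]
  {A : Type v} [NonUnitalCStarAlgebra A] {B : Type w} [NonUnitalCStarAlgebra B]
  {α : G →* (A ≃⋆ₐ[ℂ] A)} {β : G →* (B ≃⋆ₐ[ℂ] B)} {μ : Measure G} [IsFiniteMeasureOnCompacts μ]

/-- `Ψ : A ⋊_{α,r} G → M(B ⋊_{β,r} G)` is the *-homomorphism associated to `Φ : A → M(B)`: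
for `φ ∈ C_c(G, A)` and `ψ ∈ C_c(G, B)`, the product `Ψ(φ) ψ` is the convolution product
`t ↦ ∫ Φ(φ(s)) β_s(ψ(s⁻¹ t)) ds`. -/
def IsAssociated (Φ : A →⋆ₙₐ[ℂ] 𝓜(ℂ, B))
    (Ψ : CrossedProduct α μ →⋆ₙₐ[ℂ] 𝓜(ℂ, CrossedProduct β μ)) : Prop :=
  ∀ (φ : C_c(G, A)) (ψ : C_c(G, B)) (P : CrossedProduct α μ) (Q : CrossedProduct β μ),
    IsLaurent α μ φ P.op → IsLaurent β μ ψ Q.op →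
    IsLaurent β μ (fun t => ∫ s, (Φ (φ s)).fst (β s (ψ (s⁻¹ * t))) ∂μ) ((Ψ P).fst Q).op

variable (β μ) in
/-- `m * g = ∫ Δ(t)^(-1/2) β_t(m g(t⁻¹)) dt` for a multiplier `m` of `B` -/
noncomputable def multiplierConv (m : 𝓜(ℂ, B)) (g : G → B) : B :=
  ∫ t, (modular t ^ (-(1 / 2) : ℝ)) • β t (m.fst (g t⁻¹)) ∂μ

end morphisms

end RieffelProper

open RieffelProper

/-! Everything takes place on L²(G, B), which is the interior tensor product L²(G, A) ⊗_Φ B via f ⊗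
b ↦ Φ(f(·))b; nondegeneracy of Φ gives the density (`isInduced_tensorL2`). Two kinds of operators
are inflated along this identification. An adjointable P on L²(G, A) gives P ⊗ 1 on L²(G, B)
(`IsInduced.map`), and an operator T : L²(G, A) → A for which T*T exists gives T ⊗ 1 : L²(G, B) → B
(`IsInduced.ket`). They satisfy (S ⊗ 1)*(T ⊗ 1) = S*T ⊗ 1 (`isStarComp_ket`).

Crossed products. Let (U_s g)(t) = g(s⁻¹t) and (M_a g)(t) = Φ(α_{t⁻¹}(a))g(t) on L²(G, B), and Λ_φ =
∫ M_{φ(s)} U_s ds for φ ∈ C_c(G, A). Then λ_φ ⊗ 1 = Λ_φ (`inflate_laurentOp`) and Λ_φ λ_ψ = λ_{φ*ψ}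
(`lamOp_mul_lamOp`), so P ↦ P ⊗ 1 maps A ⋊ G into multipliers of B ⋊ G. This is Ψ = Φ ⋊ G; density
of the λ_φ gives uniqueness. For nondegeneracy, Λ_{f⊗a} λ_ψ tends to M_a λ_ψ as the bump f
concentrates at 1, and M_a λ_{h⊗d} = λ_{h⊗Φ(a)d}; the elements Φ(a)d are total
(`laurentOp_mem_of_lamOp`).

Properness. For ξ = Φ(x)b and η = Φ(y)d, equivariance gives ξ*β_t(η) = b*Φ(x*α_t(y))β_t(d), so
integrability is inherited from x*α_t(y). Since G need not be σ-compact, measurability requires an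
argument with cut-offs (`integrable_apply_family`).

Modules. The two identities |x⟩⟩*|y⟩⟩ = λ_{⟨⟨x,y⟩⟩} and |x⟩⟩λ_g = |x*g⟩⟩ show that F(R) is well
defined. For ξ ∈ R_A the operator S = |ξ⟩⟩ ⊗ 1 satisfies S M_b = |Φ(ξ)b⟩⟩ for b ∈ B (M_b formed with
B acting on itself) and S λ_g = |Φ(ξ)*g⟩⟩. The isomorphism is T ⊗ Q ↦ (T ⊗ 1)Q. It preserves inner
products because ((S ⊗ 1)P)*((T ⊗ 1)Q) = P*Ψ(⟨S, T⟩)Q. Its values lie in F(R_B) because the M_b λ_ψ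
are total in B ⋊ G (`ketL_comp_mem`); its range is dense because the Λ_φ λ_ψ are total too
(`inducedModule_le`).

Saturation. The elements PΨ(⟨S, T⟩)Q are inner products in F(R_B). If the ⟨S, T⟩ are total in A ⋊ G,
then by continuity all PΨ(C)Q, by nondegeneracy of Ψ all PQ, and hence all of B ⋊ G lie in the
closed span of inner products (`isSaturated_mulRange`). -/

namespace RieffelProper

open HilbertModule
open scoped Pointwise

set_option linter.unusedSectionVars false

/-! ### Operators E → A and the relation P = S*T -/

section basics

variable {A : Type*} {E : Type*} [NonUnitalCStarAlgebra A] [NormedAddCommGroup E]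
  [NormedSpace ℂ E] [HilbertModule A E]

theorem innerProd_zero_right (x : E) : innerProd A x 0 = 0 := by
  simpa using innerProd_smul_right (A := A) 0 x 0

theorem innerProd_zero_left (x : E) : innerProd A 0 x = 0 := by
  rw [← star_innerProd, innerProd_zero_right, star_zero]

theorem clm_ext_of_dense {V W : Type*} [NormedAddCommGroup V] [NormedSpace ℂ V]
    [NormedAddCommGroup W] [NormedSpace ℂ W] {S : Set V}
    (hS : Dense (Submodule.span ℂ S : Set V)) {T T' : V →L[ℂ] W} (h : ∀ x ∈ S, T x = T' x) :
    T = T' :=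
  ContinuousLinearMap.ext_on hS h

variable (A E) in
theorem continuous_innerProd : Continuous fun p : E × E => innerProd A p.1 p.2 := by
  let f : E →L⋆[ℂ] E →L[ℂ] A := LinearMap.mkContinuous₂
    (HilbertModule.toPreHilbertModule (A := A) (E := E)).ipₛₗ 1 fun x y => by
      rw [one_mul]; exact norm_innerProd_le x y
  have : Continuous fun p : E × E => f p.1 p.2 := by fun_prop
  exact this

variable (A) in
theorem norm_le_of_innerProd_le {T : E →L[ℂ] E} {c : ℝ} (hc : 0 ≤ c)
    (h : ∀ x y, ‖innerProd A x (T y)‖ ≤ c * ‖x‖ * ‖y‖) : ‖T‖ ≤ c := by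
  refine T.opNorm_le_bound hc fun y => ?_
  by_contra! hlt
  have h1 := h (T y) y
  rw [← norm_sq_eq_innerProd A] at h1
  have h2 : 0 < ‖T y‖ := lt_of_le_of_lt (by positivity) hlt
  nlinarith

/-- `P = S* T` for operators `S, T : E → A`. -/
def IsStarComp (S T : E →L[ℂ] A) (P : Adjointable A E) : Prop :=
  ∀ x y, innerProd A x (P.1 y) = star (S x) * T y

theorem IsStarComp.adjoint {S T : E →L[ℂ] A} {P : Adjointable A E} (h : IsStarComp S T P) :
    IsStarComp T S (star P) := fun x y => by
  rw [← Adjointable.inner_left, ← star_innerProd, h, star_mul, star_star]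

/-- This estimate makes T ↦ S*T continuous where it is defined, so that S*T ∈ C survives limits in
T. -/
theorem IsStarComp.norm_le {S T : E →L[ℂ] A} {P : Adjointable A E} (h : IsStarComp S T P) :
    ‖P‖ ≤ ‖S‖ * ‖T‖ := by
  refine norm_le_of_innerProd_le A (T := P.1) (by positivity) fun x y => ?_
  rw [h]
  calc _ ≤ ‖S x‖ * ‖T y‖ := by rw [← norm_star (S x)]; exact norm_mul_le _ _
    _ ≤ (‖S‖ * ‖x‖) * (‖T‖ * ‖y‖) := by gcongr <;> exact ContinuousLinearMap.le_opNorm _ _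
    _ = _ := by ring

theorem IsStarComp.comp {S T : E →L[ℂ] A} {P : Adjointable A E} (h : IsStarComp S T P)
    (Q R : Adjointable A E) : IsStarComp (S.comp Q.1) (T.comp R.1) (star Q * P * R) := fun x y => by
  change innerProd A x ((star Q).1 (P.1 (R.1 y))) = _
  rw [← Adjointable.inner_left, h]
  rfl

theorem IsStarComp.add_right {S T T' : E →L[ℂ] A} {P P' : Adjointable A E}
    (h : IsStarComp S T P) (h' : IsStarComp S T' P') : IsStarComp S (T + T') (P + P') :=
  fun x y => by
    change innerProd A x (P.1 y + P'.1 y) = _ * (T y + T' y)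
    rw [innerProd_add_right, h, h', mul_add]

theorem IsStarComp.smul_right {S T : E →L[ℂ] A} {P : Adjointable A E} (c : ℂ)
    (h : IsStarComp S T P) : IsStarComp S (c • T) (c • P) := fun x y => by
  change innerProd A x (c • P.1 y) = _ * (c • T y)
  rw [innerProd_smul_right, h, mul_smul_comm]

theorem IsStarComp.zero_right (S : E →L[ℂ] A) : IsStarComp S 0 (0 : Adjointable A E) :=
  fun x y => by
    change innerProd A x 0 = _ * 0
    rw [innerProd_zero_right, mul_zero]

/-- For a closed subalgebra `C`, the set of all `T` with `S* T ∈ C` is closed. -/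
theorem isClosed_isStarComp (C : NonUnitalStarSubalgebra ℂ (Adjointable A E))
    (hC : IsClosed (C : Set (Adjointable A E))) (S : E →L[ℂ] A) :
    IsClosed {T : E →L[ℂ] A | ∃ P ∈ C, IsStarComp S T P} := by
  refine IsSeqClosed.isClosed fun T T₀ hT hlim => ?_
  choose P hPC hP using hT
  have hsub : ∀ n m, IsStarComp S (T n - T m) (P n - P m) := fun n m => by
    have := (hP n).add_right ((hP m).smul_right (-1))
    simpa [sub_eq_add_neg] using this
  -- The adjointable operators inherit the Cauchy property from ‖P n - P m‖ ≤ ‖S‖‖T n - T m‖; the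
  -- summand 1 below allows S = 0.
  have hcau : CauchySeq P := by
    have hT := hlim.cauchySeq
    rw [Metric.cauchySeq_iff'] at hT ⊢
    intro ε hε
    obtain ⟨N, hN⟩ := hT (ε / (‖S‖ + 1)) (by positivity)
    refine ⟨N, fun n hn => ?_⟩
    have h1 := hN n hn
    rw [dist_eq_norm] at h1 ⊢
    rw [lt_div_iff₀ (by positivity)] at h1
    nlinarith [(hsub n N).norm_le, norm_nonneg (T n - T N), norm_nonneg S]
  obtain ⟨Q, hQ⟩ := cauchySeq_tendsto_of_complete hcau
  refine ⟨Q, hC.mem_of_tendsto hQ (.of_forall hPC), fun x y => ?_⟩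
  have e1 : Continuous fun P : Adjointable A E => P.1 y :=
    (ContinuousLinearMap.apply ℂ E y).continuous.comp continuous_subtype_val
  have e2 : Continuous fun T : E →L[ℂ] A => T y := (ContinuousLinearMap.apply ℂ A y).continuous
  have h1 := (((continuous_innerProd_right A x).comp e1).tendsto Q).comp hQ
  have h2 := ((continuous_const (y := star (S x))).mul e2).tendsto T₀ |>.comp hlim
  exact tendsto_nhds_unique (h1.congr fun n => hP n x y) h2

theorem isStarComp_mem_of_mem_span {C : NonUnitalStarSubalgebra ℂ (Adjointable A E)}
    (hC : IsClosed (C : Set (Adjointable A E))) {s : Set (E →L[ℂ] A)} {S T : E →L[ℂ] A}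
    (h : ∀ T ∈ s, ∃ P ∈ C, IsStarComp S T P) (hT : T ∈ (Submodule.span ℂ s).topologicalClosure) :
    ∃ P ∈ C, IsStarComp S T P := by
  refine (isClosed_isStarComp C hC S).closure_subset_iff.2 (fun T hT => ?_) hT
  induction hT using Submodule.span_induction with
  | mem T hT => exact h T hT
  | zero => exact ⟨0, C.zero_mem, IsStarComp.zero_right S⟩
  | add T T' _ _ h h' =>
    obtain ⟨⟨P, hP, e⟩, P', hP', e'⟩ := And.intro h h'
    exact ⟨P + P', C.add_mem hP hP', e.add_right e'⟩
  | smul c T _ h =>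
    obtain ⟨P, hP, e⟩ := h
    exact ⟨c • P, SMulMemClass.smul_mem c hP, e.smul_right c⟩

/-- The closed linear span of a set of operators `T : E → A` is a concrete Hilbert module. -/
noncomputable def OperatorModule.ofSpan (C : NonUnitalStarSubalgebra ℂ (Adjointable A E))
    (hC : IsClosed (C : Set (Adjointable A E))) (s : Set (E →L[ℂ] A))
    (hcomp : ∀ T ∈ s, ∀ c ∈ C, T.comp (c : E →L[ℂ] E) ∈ (Submodule.span ℂ s).topologicalClosure)
    (hip : ∀ S ∈ s, ∀ T ∈ s, ∃ P ∈ C, IsStarComp S T P) : OperatorModule C where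
  carrier := (Submodule.span ℂ s).topologicalClosure
  isClosed := Submodule.isClosed_topologicalClosure _
  comp_mem T hT c hc := by
    have hcont : Continuous fun T : E →L[ℂ] A => T.comp (c : E →L[ℂ] E) :=
      ((ContinuousLinearMap.compL ℂ E E A).flip (c : E →L[ℂ] E)).continuous
    have : IsClosed ((fun T : E →L[ℂ] A => T.comp (c : E →L[ℂ] E)) ⁻¹'
        ((Submodule.span ℂ s).topologicalClosure : Set (E →L[ℂ] A))) :=
      (Submodule.isClosed_topologicalClosure _).preimage hcont
    refine this.closure_subset_iff.2 (fun T hT => ?_) hT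
    rw [Set.mem_preimage, SetLike.mem_coe]
    induction hT using Submodule.span_induction with
    | mem T hT => exact hcomp T hT c hc
    | zero => rw [ContinuousLinearMap.zero_comp]; exact Submodule.zero_mem _
    | add T T' _ _ h h' => rw [ContinuousLinearMap.add_comp]; exact Submodule.add_mem _ h h'
    | smul z T _ h => rw [ContinuousLinearMap.smul_comp]; exact Submodule.smul_mem _ z h
  exists_ip S hS T hT := by
    -- The closed span is reached in the right-hand variable only; the left-hand one is treated by
    -- exchanging S and T and taking adjoints.
    refine isStarComp_mem_of_mem_span hC (fun T hT => ?_) hT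
    obtain ⟨P, hP, e⟩ := isStarComp_mem_of_mem_span hC (S := T) (fun S hS => hip T hT S hS) hS
    exact ⟨star P, star_mem hP, e.adjoint⟩

end basics

/-! ### Interior tensor products E ⊗_Φ B and the operators P ⊗ 1, T ⊗ 1 -/

section induced

variable {A : Type*} {B : Type*} {E : Type*} {F : Type*} [NonUnitalCStarAlgebra A]
  [NonUnitalCStarAlgebra B]
  [NormedAddCommGroup E] [NormedSpace ℂ E] [HilbertModule A E]
  [NormedAddCommGroup F] [NormedSpace ℂ F] [HilbertModule B F]
  (Φ : A →⋆ₙₐ[ℂ] 𝓜(ℂ, B))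

/-- The bilinear map `j` exhibits the Hilbert `B`-module `F` as the interior tensor product
`E ⊗_Φ B`. -/
structure IsInduced (j : E →ₗ[ℂ] B →ₗ[ℂ] F) : Prop where
  innerProd_apply : ∀ x y b c,
    innerProd B (j x b) (j y c) = star b * (Φ (innerProd A x y)).fst c
  dense : Dense (Submodule.span ℂ {z | ∃ x b, z = j x b} : Set F)

namespace IsInduced

variable {Φ} {j : E →ₗ[ℂ] B →ₗ[ℂ] F} (h : IsInduced Φ j)
include h

theorem denseRange_lift : DenseRange (TensorProduct.lift j) := by
  refine h.dense.mono ?_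
  have : Submodule.span ℂ {z | ∃ x b, z = j x b} ≤ LinearMap.range (TensorProduct.lift j) := by
    rw [Submodule.span_le]
    rintro _ ⟨x, b, rfl⟩
    exact ⟨x ⊗ₜ b, TensorProduct.lift.tmul x b⟩
  exact this

theorem innerProd_lift (v w : E ⊗[ℂ] B) :
    innerProd B (TensorProduct.lift j v) (TensorProduct.lift j w) = tensorForm E Φ v w := by
  induction v using TensorProduct.induction_on with
  | zero => simp [innerProd_zero_left]
  | add v v' h h' => rw [map_add, innerProd_add_left, h, h', map_add, LinearMap.add_apply]
  | tmul x b =>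
    induction w using TensorProduct.induction_on with
    | zero => simp [innerProd_zero_right]
    | add v v' h h' => rw [map_add, innerProd_add_right, h, h', map_add]
    | tmul y c => rw [TensorProduct.lift.tmul, TensorProduct.lift.tmul, h.innerProd_apply,
        tensorForm_tmul]

theorem norm_lift_sq (v : E ⊗[ℂ] B) : ‖TensorProduct.lift j v‖ ^ 2 = ‖tensorForm E Φ v v‖ := by
  rw [norm_sq_eq_innerProd B, h.innerProd_lift]

omit h in
theorem tensorForm_rTensor (P Q : Adjointable A E) (v w : E ⊗[ℂ] B) :
    tensorForm E Φ (P.1.toLinearMap.rTensor B v) (Q.1.toLinearMap.rTensor B w)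
      = tensorForm E Φ v ((star P * Q).1.toLinearMap.rTensor B w) := by
  induction v using TensorProduct.induction_on with
  | zero => simp
  | add v v' h h' => rw [map_add, map_add, LinearMap.add_apply, h, h', map_add, LinearMap.add_apply]
  | tmul x b =>
    induction w using TensorProduct.induction_on with
    | zero => simp
    | add v v' h h' => simp only [map_add, h, h']
    | tmul y c =>
      simp only [LinearMap.rTensor_tmul, tensorForm_tmul, ContinuousLinearMap.coe_coe]
      rw [Adjointable.inner_left]
      rfl

/-- Since ‖P‖² - P*P is positive it has the form S*S, and positivity of the form at (S ⊗ 1)v says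
that ⟨(P ⊗ 1)v, (P ⊗ 1)v⟩ ≤ ‖P‖²⟨v, v⟩. An estimate tensor by tensor would not be in terms of the
norm of v. -/
theorem norm_lift_rTensor_le (P : Adjointable A E) (v : E ⊗[ℂ] B) :
    ‖TensorProduct.lift j (P.1.toLinearMap.rTensor B v)‖ ≤ ‖P‖ * ‖TensorProduct.lift j v‖ := by
  let _ := CStarAlgebra.spectralOrder B
  let _ := CStarAlgebra.spectralOrderedRing B
  let _ := CStarAlgebra.spectralOrder (Adjointable A E)
  let _ := CStarAlgebra.spectralOrderedRing (Adjointable A E)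
  have h0 : star P * P ≤ algebraMap ℝ (Adjointable A E) ‖star P * P‖ :=
    IsSelfAdjoint.le_algebraMap_norm_self (IsSelfAdjoint.star_mul_self P)
  obtain ⟨S, hS⟩ := CStarAlgebra.nonneg_iff_eq_star_mul_self.1 (sub_nonneg.2 h0)
  have e1 : tensorForm E Φ (P.1.toLinearMap.rTensor B v) (P.1.toLinearMap.rTensor B v)
      + tensorForm E Φ (S.1.toLinearMap.rTensor B v) (S.1.toLinearMap.rTensor B v)
      = ‖star P * P‖ • tensorForm E Φ v v := by
    rw [tensorForm_rTensor, tensorForm_rTensor, ← map_add, ← hS, ← LinearMap.add_apply,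
      ← LinearMap.rTensor_add]
    have : (star P * P).1.toLinearMap + (algebraMap ℝ (Adjointable A E) ‖star P * P‖
        - star P * P).1.toLinearMap = ((‖star P * P‖ : ℝ) : ℂ) • LinearMap.id := by
      ext x
      change (star P * P).1 x + ((algebraMap ℝ (Adjointable A E) ‖star P * P‖).1 x
        - (star P * P).1 x) = _
      rw [add_sub_cancel, Algebra.algebraMap_eq_smul_one]
      rfl
    rw [this, LinearMap.rTensor_smul, LinearMap.rTensor_id, LinearMap.smul_apply,
      LinearMap.id_apply, map_smul, Complex.coe_smul]
  have h1 : tensorForm E Φ (P.1.toLinearMap.rTensor B v) (P.1.toLinearMap.rTensor B v)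
      ≤ ‖star P * P‖ • tensorForm E Φ v v := by
    rw [← e1]
    exact le_add_of_nonneg_right ((isPos_iff _).1 (tensorForm_self_pos E Φ _))
  have h2 := CStarAlgebra.norm_le_norm_of_nonneg_of_le
    ((isPos_iff _).1 (tensorForm_self_pos E Φ _)) h1
  rw [norm_smul, norm_norm, CStarRing.norm_star_mul_self, ← h.norm_lift_sq, ← h.norm_lift_sq] at h2
  rw [← abs_of_nonneg (norm_nonneg (TensorProduct.lift j _)),
    ← abs_of_nonneg (a := ‖P‖ * _) (by positivity), ← sq_le_sq, mul_pow, sq ‖P‖]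
  exact h2

omit h in
variable (j) in
/-- the operator `P ⊗ 1` on `E ⊗_Φ B`, as a bounded operator -/
noncomputable def preMap (P : Adjointable A E) : F →L[ℂ] F :=
  haveI : CompleteSpace F := HilbertModule.complete B
  LinearMap.extendOfNorm ((TensorProduct.lift j).comp (P.1.toLinearMap.rTensor B))
    (TensorProduct.lift j)

theorem preMap_lift (P : Adjointable A E) (v : E ⊗[ℂ] B) :
    preMap j P (TensorProduct.lift j v)
      = TensorProduct.lift j (P.1.toLinearMap.rTensor B v) :=
  haveI : CompleteSpace F := HilbertModule.complete B
  LinearMap.extendOfNorm_eq h.denseRange_lift ⟨‖P‖, fun v => h.norm_lift_rTensor_le P v⟩ v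

theorem preMap_apply (P : Adjointable A E) (x : E) (b : B) :
    preMap j P (j x b) = j (P.1 x) b := by
  have := h.preMap_lift P (x ⊗ₜ b)
  rwa [LinearMap.rTensor_tmul, TensorProduct.lift.tmul, TensorProduct.lift.tmul] at this

theorem ext {V : Type*} [NormedAddCommGroup V] [NormedSpace ℂ V] {T T' : F →L[ℂ] V}
    (hT : ∀ x b, T (j x b) = T' (j x b)) : T = T' :=
  clm_ext_of_dense h.dense (by rintro _ ⟨x, b, rfl⟩; exact hT x b)

theorem innerProd_preMap (P : Adjointable A E) (x y : F) :
    innerProd B (preMap j P x) y = innerProd B x (preMap j (star P) y) := by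
  refine h.denseRange_lift.induction_on₂ (p := fun x y =>
    innerProd B (preMap j P x) y = innerProd B x (preMap j (star P) y)) ?_ ?_ x y
  · have hc := continuous_innerProd B F
    refine isClosed_eq (hc.comp (f := fun p : F × F => (preMap j P p.1, p.2)) (by fun_prop))
      (hc.comp (f := fun p : F × F => (p.1, preMap j (star P) p.2)) (by fun_prop))
  · intro v w
    rw [h.preMap_lift, h.preMap_lift, h.innerProd_lift, h.innerProd_lift]
    have := tensorForm_rTensor (Φ := Φ) P 1 v w
    rw [mul_one] at this
    rw [← this]
    congr 1
    exact (LinearMap.congr_fun (LinearMap.rTensor_id B E) w).symm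

/-- the *-homomorphism `P ↦ P ⊗ 1` from `L(E)` to `L(E ⊗_Φ B)` -/
noncomputable def map : Adjointable A E →⋆ₙₐ[ℂ] Adjointable B F where
  toFun P := ⟨preMap j P, preMap j (star P), h.innerProd_preMap P⟩
  map_zero' := Subtype.ext (h.ext fun x b => by
    rw [h.preMap_apply]
    change j 0 b = 0
    rw [map_zero, LinearMap.zero_apply])
  map_add' P Q := Subtype.ext (h.ext fun x b => by
    rw [h.preMap_apply]
    change j (P.1 x + Q.1 x) b = preMap j P (j x b) + preMap j Q (j x b)
    rw [h.preMap_apply, h.preMap_apply, map_add, LinearMap.add_apply])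
  map_smul' c P := Subtype.ext (h.ext fun x b => by
    rw [h.preMap_apply]
    change j (c • P.1 x) b = c • preMap j P (j x b)
    rw [h.preMap_apply, map_smul, LinearMap.smul_apply])
  map_mul' P Q := Subtype.ext (h.ext fun x b => by
    rw [h.preMap_apply]
    change j (P.1 (Q.1 x)) b = preMap j P (preMap j Q (j x b))
    rw [h.preMap_apply, h.preMap_apply])
  map_star' P := Adjointable.eq_star (h.innerProd_preMap P)

theorem map_apply (P : Adjointable A E) (x : E) (b : B) : (h.map P).1 (j x b) = j (P.1 x) b :=
  h.preMap_apply P x b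

omit h [HilbertModule A E] in
variable (Φ) in
/-- the bilinear map `(x, b) ↦ Φ(T x) b` -/
noncomputable def ketForm (T : E →L[ℂ] A) : E →ₗ[ℂ] B →ₗ[ℂ] B :=
  LinearMap.mk₂ ℂ (fun x b => (Φ (T x)).fst b) (fun x y b => by simp) (fun c x b => by simp)
    (fun x b b' => by simp) (fun c x b => by simp)

omit h in
-- On elementary tensors both sides are b*Φ((Sx)*(Ty))c.
theorem star_lift_ketForm_mul {S T : E →L[ℂ] A} {P : Adjointable A E} (hP : IsStarComp S T P)
    (v w : E ⊗[ℂ] B) :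
    star (TensorProduct.lift (ketForm Φ S) v) * TensorProduct.lift (ketForm Φ T) w
      = tensorForm E Φ v (P.1.toLinearMap.rTensor B w) := by
  induction v using TensorProduct.induction_on with
  | zero => simp
  | add v v' h h' => rw [map_add, star_add, add_mul, h, h', map_add, LinearMap.add_apply]
  | tmul x b =>
    induction w using TensorProduct.induction_on with
    | zero => simp
    | add v v' h h' => simp only [map_add, mul_add, h, h']
    | tmul y c =>
      simp only [LinearMap.rTensor_tmul, tensorForm_tmul, ContinuousLinearMap.coe_coe,
        TensorProduct.lift.tmul, ketForm, LinearMap.mk₂_apply]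
      rw [hP, map_mul, map_star, DoubleCentralizer.mul_fst]
      exact (multiplier_central (star (Φ (S x))) b ((Φ (T y)).fst c)).symm.trans (by
        rw [star_star]) |>.symm

omit h [HilbertModule A E] [HilbertModule B F] in
variable (Φ j) in
/-- the operator `T ⊗ 1 : E ⊗_Φ B → A ⊗_Φ B ⊆ B` for `T : E → A` -/
noncomputable def ket (T : E →L[ℂ] A) : F →L[ℂ] B :=
  LinearMap.extendOfNorm (TensorProduct.lift (ketForm Φ T)) (TensorProduct.lift j)

/-- The operator T*T supplies the bound without which `ket` has no meaning: the squared norm of the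
right-hand side is ‖⟨v, (P ⊗ 1)v⟩‖ ≤ ‖P‖‖v‖². -/
theorem ket_lift {T : E →L[ℂ] A} {P : Adjointable A E} (hP : IsStarComp T T P) (v : E ⊗[ℂ] B) :
    ket Φ j T (TensorProduct.lift j v) = TensorProduct.lift (ketForm Φ T) v := by
  refine LinearMap.extendOfNorm_eq h.denseRange_lift ⟨√‖P‖, fun v => ?_⟩ v
  rw [← abs_of_nonneg (norm_nonneg (TensorProduct.lift (ketForm Φ T) v)),
    ← abs_of_nonneg (a := √‖P‖ * _) (by positivity), ← sq_le_sq, mul_pow,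
    Real.sq_sqrt (norm_nonneg _), sq ‖TensorProduct.lift (ketForm Φ T) v‖,
    ← CStarRing.norm_star_mul_self, star_lift_ketForm_mul hP, ← h.innerProd_lift]
  refine (norm_innerProd_le _ _).trans ?_
  rw [sq, mul_left_comm]
  exact mul_le_mul_of_nonneg_left (h.norm_lift_rTensor_le P v) (norm_nonneg _)

theorem ket_apply {T : E →L[ℂ] A} {P : Adjointable A E} (hP : IsStarComp T T P) (x : E) (b : B) :
    ket Φ j T (j x b) = (Φ (T x)).fst b := by
  have := h.ket_lift hP (x ⊗ₜ b)
  rwa [TensorProduct.lift.tmul, TensorProduct.lift.tmul] at this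

/-- The existence of S*S and T*T serves only to make both extensions bounded; the identity itself is
`star_lift_ketForm_mul` on the algebraic tensor product, extended by density. -/
theorem isStarComp_ket {S T : E →L[ℂ] A} {P Q R : Adjointable A E} (hP : IsStarComp S T P)
    (hQ : IsStarComp S S Q) (hR : IsStarComp T T R) :
    IsStarComp (ket Φ j S) (ket Φ j T) (h.map P) := fun x y => by
  refine h.denseRange_lift.induction_on₂ (p := fun x y =>
    innerProd B x ((h.map P).1 y) = star (ket Φ j S x) * ket Φ j T y) ?_ ?_ x y
  · have hc := continuous_innerProd B F
    refine isClosed_eq (hc.comp (f := fun p : F × F => (p.1, (h.map P).1 p.2)) (by fun_prop)) ?_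
    exact (continuous_star.comp ((ket Φ j S).continuous.comp continuous_fst)).mul
      ((ket Φ j T).continuous.comp continuous_snd)
  · intro v w
    rw [h.ket_lift hQ, h.ket_lift hR, star_lift_ketForm_mul hP, ← h.innerProd_lift]
    congr 1
    exact h.preMap_lift P w

end IsInduced

end induced

/-! ### Multipliers of a C*-subalgebra -/

section multipliers

variable {L : Type*} [CStarAlgebra L] {C : Type*} [NonUnitalCStarAlgebra C]
  (D : NonUnitalStarSubalgebra ℂ L) [hD : IsClosed (D : Set L)]

/-- An element `m` of `L` with `m D ⊆ D` and `D m ⊆ D` defines a multiplier of `D`. -/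
noncomputable def multiplierOf (m : L) (h : ∀ d ∈ D, m * d ∈ D) (h' : ∀ d ∈ D, d * m ∈ D) :
    𝓜(ℂ, D) where
  fst := LinearMap.mkContinuous
    { toFun := fun d => (⟨m * d.1, h d.1 d.2⟩ : D)
      map_add' := fun d e => Subtype.ext (mul_add m d.1 e.1)
      map_smul' := fun c d => Subtype.ext (mul_smul_comm c m d.1) } ‖m‖
    fun d => norm_mul_le m d.1
  snd := LinearMap.mkContinuous
    { toFun := fun d => (⟨d.1 * m, h' d.1 d.2⟩ : D)
      map_add' := fun d e => Subtype.ext (add_mul d.1 e.1 m)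
      map_smul' := fun c d => Subtype.ext (smul_mul_assoc c d.1 m) } ‖m‖
    fun d => (norm_mul_le d.1 m).trans_eq (mul_comm _ _)
  central d e := Subtype.ext (mul_assoc d.1 m e.1)

/-- The right half of a multiplier is determined by the left half through (dm)z = d(mz), because an
element w with wz = 0 for all z satisfies ww* = 0. -/
theorem multiplier_ext {D : Type*} [NonUnitalCStarAlgebra D] {m n : 𝓜(ℂ, D)}
    (h : ∀ d, m.fst d = n.fst d) : m = n := by
  refine DoubleCentralizer.ext ℂ D m n (Prod.ext (ContinuousLinearMap.ext h)
    (ContinuousLinearMap.ext fun d => ?_))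
  have e : ∀ z, (m.snd d - n.snd d) * z = 0 := fun z => by
    rw [sub_mul, m.central, n.central, h, sub_self]
  have := CStarRing.mul_star_self_eq_zero_iff (m.snd d - n.snd d) |>.1 (e _)
  exact sub_eq_zero.1 this

/-- A *-homomorphism `θ : C → L` with `θ(C) D ⊆ D` induces a *-homomorphism `C → M(D)`. -/
noncomputable def multiplierHom (θ : C →⋆ₙₐ[ℂ] L) (h : ∀ c, ∀ d ∈ D, θ c * d ∈ D) :
    C →⋆ₙₐ[ℂ] 𝓜(ℂ, D) :=
  have h' : ∀ c, ∀ d ∈ D, d * θ c ∈ D := fun c d hd => by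
    have := star_mem (h (star c) (star d) (star_mem hd))
    rwa [star_mul, star_star, map_star, star_star] at this
  { toFun := fun c => multiplierOf D (θ c) (h c) (h' c)
    map_zero' := multiplier_ext fun d => Subtype.ext
      (show θ 0 * d.1 = 0 by rw [map_zero, zero_mul])
    map_add' := fun a b => multiplier_ext fun d => Subtype.ext
      (show θ (a + b) * d.1 = θ a * d.1 + θ b * d.1 by rw [map_add, add_mul])
    map_smul' := fun c a => multiplier_ext fun d => Subtype.ext
      (show θ (c • a) * d.1 = c • (θ a * d.1) by rw [map_smul, smul_mul_assoc])
    map_mul' := fun a b => multiplier_ext fun d => Subtype.ext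
      (show θ (a * b) * d.1 = θ a * (θ b * d.1) by rw [map_mul, mul_assoc])
    map_star' := fun a => multiplier_ext fun d => by
      rw [DoubleCentralizer.star_fst]
      refine Subtype.ext ?_
      change θ (star a) * d.1 = star (star d.1 * θ a)
      rw [star_mul, star_star, map_star] }

end multipliers

/-! ### Isomorphisms out of a completion -/

section iso

variable {D : Type*} {V : Type*} {F : Type*} [NonUnitalCStarAlgebra D] [AddCommGroup V]
  [Module ℂ V] [NormedAddCommGroup F] [NormedSpace ℂ F] [HilbertModule D F]

theorem denseRange_toCompleted (S : PreHilbertModule D V) : DenseRange S.toCompleted :=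
  Completion.denseRange_coe (α := S.Space)

/-- A linear map with dense range which preserves the inner product extends to an isomorphism of
the completion. -/
theorem exists_hilbertModuleIso (S : PreHilbertModule D V) (u : V →ₗ[ℂ] F)
    (hu : ∀ v w, innerProd D (u v) (u w) = S.ip v w) (hd : DenseRange u) :
    ∃ U : HilbertModuleIso D S.Completed F, ∀ v, U.toFun (S.toCompleted v) = u v := by
  have : CompleteSpace F := HilbertModule.complete D
  have hnorm : ∀ v, ‖u v‖ = ‖S.toCompleted v‖ := fun v => by
    have h1 := norm_sq_eq_innerProd D (u v)
    have h2 := norm_sq_eq_innerProd D (S.toCompleted v)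
    rw [hu] at h1
    rw [show innerProd D (S.toCompleted v) (S.toCompleted v) = S.ip v v from S.ip_toCompleted v v,
      ← h1] at h2
    exact ((sq_eq_sq₀ (norm_nonneg _) (norm_nonneg _)).1 h2).symm
  let U : S.Completed ≃L[ℂ] F := (LinearEquiv.refl ℂ V).extend S.toCompleted u
    (denseRange_toCompleted S) ⟨1, fun v => by rw [one_mul]; exact (hnorm v).le⟩ hd
    ⟨1, fun v => by rw [one_mul]; exact (hnorm v).ge⟩
  have hU : ∀ v, U (S.toCompleted v) = u v := fun v => LinearEquiv.extend_eq _ _ _ _ _ _ _ v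
  have hip : ∀ x y, innerProd D (U x) (U y) = innerProd D x y := fun x y => by
    refine (denseRange_toCompleted S).induction_on₂ (p := fun x y =>
      innerProd D (U x) (U y) = innerProd D x y) ?_ ?_ x y
    · exact isClosed_eq ((continuous_innerProd D F).comp
        (f := fun p : S.Completed × S.Completed => (U p.1, U p.2)) (by fun_prop))
        (continuous_innerProd D S.Completed)
    · intro v w
      rw [hU, hU, hu]
      exact (S.ip_toCompleted v w).symm
  refine ⟨{ U.toLinearEquiv with
    map_innerProd := hip
    map_rsmul := fun x d => ext_innerProd D fun z => ?_ }, hU⟩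
  -- A surjection which preserves inner products is automatically compatible with the actions: test
  -- against vectors of the form U z.
  obtain ⟨z, rfl⟩ := U.surjective z
  change innerProd D (U z) (U (rsmul D x d)) = innerProd D (U z) (rsmul D (U x) d)
  rw [hip, innerProd_rsmul, innerProd_rsmul, hip]

end iso

/-! ### The modular function and inversion of the Haar integral -/

section modular

variable {G : Type*} [TopologicalSpace G] [Group G] [IsTopologicalGroup G]
  [LocallyCompactSpace G] [MeasurableSpace G] [BorelSpace G]

/-- The image of μ under right translation by t is again left invariant, and `modularCharacterFun`
is the factor that compares it with μ. -/
theorem integral_mul_right_eq (μ : Measure G) [μ.IsHaarMeasure] {f : G → ℝ} (hf : Continuous f)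
    (hc : HasCompactSupport f) (t : G) :
    ∫ s, f (s * t) ∂μ = Measure.modularCharacterFun t * ∫ s, f s ∂μ := by
  rw [Measure.modularCharacterFun_eq_haarScalarFactor μ t,
    ← integral_map (φ := (· * t)) (f := f) (by fun_prop)
      hf.aestronglyMeasurable]
  rw [Measure.integral_isMulLeftInvariant_eq_smul_of_hasCompactSupport (Measure.map (· * t) μ) μ hf hc,
    integral_smul_nnreal_measure]
  rfl

theorem modular_pos (t : G) : 0 < modular t :=
  inv_pos.2 (NNReal.coe_pos.2 (Measure.modularCharacterFun_pos t))

theorem modular_mul (s t : G) : modular (s * t) = modular s * modular t := by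
  rw [modular, Measure.modularCharacterFun_map_mul, NNReal.coe_mul, mul_inv]; rfl

theorem modular_one : modular (1 : G) = 1 := by
  rw [modular, Measure.modularCharacterFun_map_one, NNReal.coe_one, inv_one]

theorem modular_inv (t : G) : modular t⁻¹ = (modular t)⁻¹ :=
  eq_inv_of_mul_eq_one_left (by rw [← modular_mul, inv_mul_cancel, modular_one])

theorem continuous_integral_apply_mul (μ : Measure G) [IsFiniteMeasureOnCompacts μ] {f : G → ℝ}
    (hf : Continuous f) (hc : HasCompactSupport f) : Continuous fun t => ∫ s, f (s * t) ∂μ := by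
  refine continuous_iff_continuousAt.2 fun t₀ => ?_
  obtain ⟨V, hV, ht⟩ := exists_compact_mem_nhds t₀
  refine (continuousOn_integral_of_compact_support (s := V) (k := tsupport f * V⁻¹)
    (IsCompact.mul hc hV.inv) (f := fun t s => f (s * t)) (by fun_prop)
    fun t s ht hs => ?_).continuousAt ht
  contrapose! hs
  exact ⟨s * t, subset_tsupport _ hs, t⁻¹, Set.inv_mem_inv.2 ht, by simp⟩

/-- For a fixed bump f, Δ(t) is the quotient of ∫ f(s) ds by ∫ f(st) ds, whose denominator is
continuous in t and never zero. -/
theorem continuous_modular : Continuous (modular : G → ℝ) := by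
  obtain ⟨⟨f, hf⟩, hc, h0, h1⟩ : ∃ f : C(G, ℝ), HasCompactSupport f ∧ 0 ≤ f ∧ f 1 ≠ 0 :=
    exists_continuous_nonneg_pos 1
  have hI : (∫ s, f s ∂(Measure.haar : Measure G)) ≠ 0 :=
    ne_of_gt (hf.integral_pos_of_hasCompactSupport_nonneg_nonzero hc h0 h1)
  have e : ∀ t : G, modular t = (∫ s, f s ∂(Measure.haar : Measure G))
      / ∫ s, f (s * t) ∂(Measure.haar : Measure G) := fun t => by
    rw [integral_mul_right_eq _ hf hc, modular]
    have := (NNReal.coe_pos.2 (Measure.modularCharacterFun_pos t)).ne'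
    field_simp
  rw [funext e]
  refine continuous_const.div (continuous_integral_apply_mul _ hf hc) fun t => ?_
  rw [integral_mul_right_eq _ hf hc]
  exact mul_ne_zero (NNReal.coe_pos.2 (Measure.modularCharacterFun_pos t)).ne' hI

/-- the function `Δ^(-1/2)` -/
noncomputable def rootModular (t : G) : ℝ := modular t ^ (-(1 / 2) : ℝ)

theorem rootModular_pos (t : G) : 0 < rootModular t := Real.rpow_pos_of_pos (modular_pos t) _

theorem rootModular_mul (s t : G) : rootModular (s * t) = rootModular s * rootModular t := by
  rw [rootModular, modular_mul, Real.mul_rpow (modular_pos s).le (modular_pos t).le]; rfl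

theorem rootModular_one : rootModular (1 : G) = 1 := by rw [rootModular, modular_one, Real.one_rpow]

theorem rootModular_inv (t : G) : rootModular t⁻¹ = (rootModular t)⁻¹ :=
  eq_inv_of_mul_eq_one_left (by rw [← rootModular_mul, inv_mul_cancel, rootModular_one])

theorem modular_inv_eq (t : G) : (modular t)⁻¹ = rootModular t * rootModular t := by
  rw [rootModular, ← Real.rpow_add (modular_pos t), ← Real.rpow_neg_one]; norm_num

theorem continuous_rootModular : Continuous (rootModular : G → ℝ) :=
  continuous_modular.rpow_const fun t => Or.inl (modular_pos t).ne'

/-- The image ν of μ under inversion is right invariant. The comparison formula for left and right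
invariant measures expresses ∫ f dμ by an integral against ν with density (∫ g(z⁻¹y) dν(z))⁻¹, and
this inner integral is Δ(y)⁻¹ ∫ g dμ. The substitution y = t⁻¹ leaves the weight Δ(t)⁻¹. -/
theorem integral_modular_inv_real (μ : Measure G) [μ.IsHaarMeasure] [μ.Regular] {f : G → ℝ}
    (hf : Continuous f) (hc : HasCompactSupport f) :
    ∫ t, (modular t)⁻¹ * f t⁻¹ ∂μ = ∫ t, f t ∂μ := by
  obtain ⟨⟨g, hg⟩, gc, g0, g1⟩ : ∃ f : C(G, ℝ), HasCompactSupport f ∧ 0 ≤ f ∧ f 1 ≠ 0 :=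
    exists_continuous_nonneg_pos 1
  have hI : (∫ s, g s ∂μ) ≠ 0 :=
    ne_of_gt (hg.integral_pos_of_hasCompactSupport_nonneg_nonzero gc g0 g1)
  have h := Measure.integral_isMulLeftInvariant_isMulRightInvariant_combo (μ := μ) (ν := μ.inv)
    hf hc hg gc g0 g1
  have e : ∀ y : G, ∫ z, g (z⁻¹ * y) ∂μ.inv = (modular y)⁻¹ * ∫ z, g z ∂μ := fun y => by
    have := (Homeomorph.inv G).measurableEmbedding.integral_map (μ := μ)
      (fun z => g (z⁻¹ * y))
    rw [Measure.inv]
    refine this.trans ?_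
    simp only [Homeomorph.coe_inv, inv_inv]
    rw [integral_mul_right_eq μ hg gc, modular, inv_inv]
  simp only [e] at h
  have e2 := (Homeomorph.inv G).measurableEmbedding.integral_map (μ := μ)
      (fun y => f y * ((modular y)⁻¹ * ∫ z, g z ∂μ)⁻¹)
  rw [Measure.inv] at h
  rw [h, show Inv.inv = ⇑(Homeomorph.inv G) from rfl, e2]
  rw [← integral_mul_const]
  refine integral_congr_ae (.of_forall fun t => ?_)
  change (modular t)⁻¹ * f t⁻¹ = f t⁻¹ * ((modular t⁻¹)⁻¹ * ∫ z, g z ∂μ)⁻¹ * ∫ z, g z ∂μ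
  rw [modular_inv]
  have := (modular_pos t).ne'
  field_simp

/-- Continuous functionals commute with both integrals and separate points, which reduces the claim
to scalar functions. -/
theorem integral_modular_inv (μ : Measure G) [μ.IsHaarMeasure] [μ.Regular] {E : Type*}
    [NormedAddCommGroup E] [NormedSpace ℝ E] [CompleteSpace E] {f : G → E}
    (hf : Continuous f) (hc : HasCompactSupport f) :
    ∫ t, (modular t)⁻¹ • f t⁻¹ ∂μ = ∫ t, f t ∂μ := by
  refine (SeparatingDual.eq_iff_forall_dual_eq (R := ℝ)).2 fun l => ?_
  have i1 : Integrable f μ := hf.integrable_of_hasCompactSupport hc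
  have hc' : HasCompactSupport fun t => f t⁻¹ := hc.comp_homeomorph (Homeomorph.inv G)
  have i2 : Integrable (fun t => (modular t)⁻¹ • f t⁻¹) μ :=
    Continuous.integrable_of_hasCompactSupport
      ((continuous_modular.inv₀ fun t => (modular_pos t).ne').smul (hf.comp continuous_inv))
      hc'.smul_left
  rw [← l.integral_comp_comm i1, ← l.integral_comp_comm i2]
  simp only [map_smul, smul_eq_mul]
  exact integral_modular_inv_real μ (f := fun t => l (f t)) (l.continuous.comp hf)
    (hc.comp_left (map_zero l))

end modular

/-! ### Continuous integrable functions without σ-compactness -/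

section measurability

variable {G : Type*} [TopologicalSpace G] [T2Space G] [LocallyCompactSpace G]
  [MeasurableSpace G] [BorelSpace G] {μ : Measure G} [μ.Regular]

/-- The open sets {‖f‖ > 1/(n+1)} have finite measure, and the mass of f outside them tends to zero.
For large n such a set is exhausted by a compact K up to measure δ, by inner regularity, with δ
chosen so that sets of measure below δ carry mass less than ε/2. -/
theorem exists_isCompact_setLIntegral_compl_lt {A : Type*} [NormedAddCommGroup A] {f : G → A}
    (hfc : Continuous f) (hf : Integrable f μ) {ε : ENNReal} (hε : ε ≠ 0) :
    ∃ K : Set G, IsCompact K ∧ ∫⁻ t in Kᶜ, ‖f t‖ₑ ∂μ < ε := by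
  have hfin : ∫⁻ t, ‖f t‖ₑ ∂μ ≠ ⊤ := hf.2.ne
  have hε2 : ε / 2 ≠ 0 := (ENNReal.half_pos hε).ne'
  obtain ⟨δ, hδ, hs⟩ := exists_pos_setLIntegral_lt_of_measure_lt hfin hε2
  let U : ℕ → Set G := fun n => {t | 1 / ((n : ℝ) + 1) < ‖f t‖}
  have hU : ∀ n, IsOpen (U n) := fun n => isOpen_lt continuous_const hfc.norm
  have hUm : ∀ n, MeasurableSet (U n)ᶜ := fun n => (hU n).measurableSet.compl
  have hanti : Antitone fun n => (U n)ᶜ := fun m n hmn t ht => by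
    simp only [U, Set.mem_compl_iff, Set.mem_ofPred_eq, not_lt] at ht ⊢
    exact ht.trans (Nat.one_div_le_one_div hmn)
  have hlim := tendsto_measure_iInter_atTop (μ := μ.withDensity fun t => ‖f t‖ₑ)
    (fun n => (hUm n).nullMeasurableSet) hanti ⟨0, by
      rw [withDensity_apply _ (hUm 0)]
      exact ((setLIntegral_le_lintegral _ _).trans_lt hfin.lt_top).ne⟩
  have h0 : (μ.withDensity fun t => ‖f t‖ₑ) (⋂ n, (U n)ᶜ) = 0 := by
    rw [withDensity_apply _ (MeasurableSet.iInter hUm)]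
    refine setLIntegral_eq_zero (MeasurableSet.iInter hUm) fun t ht => ?_
    simp only [U, Set.mem_iInter, Set.mem_compl_iff, Set.mem_ofPred_eq, not_lt] at ht
    have : ‖f t‖ ≤ 0 := ge_of_tendsto' tendsto_one_div_add_atTop_nhds_zero_nat ht
    simpa using norm_le_zero_iff.1 this
  rw [h0] at hlim
  obtain ⟨n, hn⟩ := ((tendsto_order.1 hlim).2 (ε / 2) (ENNReal.half_pos hε)).exists
  rw [Function.comp_apply, withDensity_apply _ (hUm n)] at hn
  obtain ⟨K, hKU, hK, hKδ⟩ := (hU n).measurableSet.exists_isCompact_sdiff_lt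
    (hf.measure_norm_gt_lt_top (by positivity)).ne hδ.ne'
  refine ⟨K, hK, ?_⟩
  calc ∫⁻ t in Kᶜ, ‖f t‖ₑ ∂μ ≤ ∫⁻ t in (U n \ K) ∪ (U n)ᶜ, ‖f t‖ₑ ∂μ :=
        lintegral_mono_set fun t ht => by
          by_cases h : t ∈ U n
          · exact Or.inl ⟨h, ht⟩
          · exact Or.inr h
    _ ≤ _ := lintegral_union_le _ _ _
    _ < ε / 2 + ε / 2 := ENNReal.add_lt_add (hs _ hKδ) hn
    _ = ε := ENNReal.add_halves ε

/-- Continuous integrable functions are approximated in `L¹` by cut-offs. -/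
theorem exists_cutoff {A : Type*} [NormedAddCommGroup A] [NormedSpace ℝ A] {f : G → A}
    (hfc : Continuous f) (hf : Integrable f μ) {ε : ENNReal} (hε : ε ≠ 0) :
    ∃ χ : C(G, ℝ), HasCompactSupport χ ∧ eLpNorm (fun t => χ t • f t - f t) 1 μ < ε := by
  obtain ⟨K, hK, hlt⟩ := exists_isCompact_setLIntegral_compl_lt hfc hf hε
  obtain ⟨χ, h1, hc, -, h01⟩ :=
    exists_continuousMap_one_of_isCompact_subset_isOpen hK isOpen_univ (Set.subset_univ K)
  refine ⟨χ, hc, lt_of_le_of_lt ?_ hlt⟩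
  rw [eLpNorm_one_eq_lintegral_enorm, ← lintegral_indicator hK.measurableSet.compl]
  refine lintegral_mono fun t => ?_
  by_cases ht : t ∈ K
  · simp [h1 ht]
  · rw [Set.indicator_of_mem (show t ∈ Kᶜ from ht)]
    refine enorm_le_iff_norm_le.2 ?_
    have : χ t • f t - f t = -((1 - χ t) • f t) := by rw [sub_smul, one_smul, neg_sub]
    rw [this, norm_neg, norm_smul, Real.norm_of_nonneg (by linarith [(h01 t).2])]
    exact mul_le_of_le_one_left (norm_nonneg _) (by linarith [(h01 t).1])

/-- Applying a continuous family of bounded operators to a continuous integrable function gives an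
integrable function. -/
theorem integrable_apply_family {A B : Type*} [NormedAddCommGroup A] [NormedSpace ℝ A]
    [NormedAddCommGroup B] {f : G → A} (hfc : Continuous f)
    (hf : Integrable f μ) {T : G → A → B} (hT : Continuous fun p : G × A => T p.1 p.2)
    {C : ℝ} (hC : ∀ t a, ‖T t a‖ ≤ C * ‖a‖) : Integrable (fun t => T t (f t)) μ := by
  have h0 : ∀ t, T t 0 = 0 := fun t => norm_le_zero_iff.1 (by simpa using hC t 0)
  have hε : ∀ n : ℕ, ENNReal.ofReal ((1 / 2 : ℝ) ^ n) ≠ 0 := fun n => by simp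
  choose χ χc χn using fun n => exists_cutoff hfc hf (hε n)
  have gint : ∀ n, Integrable (fun t => χ n t • f t) μ := fun n =>
    ((χ n).continuous.smul hfc).integrable_of_hasCompactSupport (χc n).smul_right
  have hlim : Filter.Tendsto (fun n => eLpNorm ((fun t => χ n t • f t) - f) 1 μ) Filter.atTop
      (nhds 0) := by
    have h1 : Filter.Tendsto (fun n : ℕ => ENNReal.ofReal ((1 / 2 : ℝ) ^ n)) Filter.atTop
        (nhds 0) := by
      rw [← ENNReal.ofReal_zero]
      exact (ENNReal.continuous_ofReal.tendsto 0).comp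
        (tendsto_pow_atTop_nhds_zero_of_lt_one (by norm_num) (by norm_num))
    exact tendsto_of_tendsto_of_tendsto_of_le_of_le tendsto_const_nhds h1 (fun n => zero_le)
      fun n => (χn n).le
  obtain ⟨ns, -, hns⟩ := (tendstoInMeasure_of_tendsto_eLpNorm one_ne_zero
    (fun n => (gint n).aestronglyMeasurable) hf.aestronglyMeasurable hlim).exists_seq_tendsto_ae
  -- A continuous function on G may have non-separable range and thus fail to be strongly
  -- measurable. The functions T t (χ t • f t) are continuous with compact support, and along a
  -- subsequence they converge to T t (f t) almost everywhere.
  have hmeas : AEStronglyMeasurable (fun t => T t (f t)) μ := by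
    refine aestronglyMeasurable_of_tendsto_ae Filter.atTop
      (f := fun n t => T t (χ (ns n) t • f t)) (fun n => ?_) ?_
    · have hcont : Continuous fun t => T t (χ (ns n) t • f t) :=
        hT.comp (continuous_id.prodMk ((χ (ns n)).continuous.smul hfc))
      refine (hcont.integrable_of_hasCompactSupport (μ := μ) ?_).aestronglyMeasurable
      exact (χc (ns n)).mono fun t ht h => ht (by simp [h, h0])
    · filter_upwards [hns] with t ht
      exact ((hT.comp (Continuous.prodMk_right t)).tendsto (f t)).comp ht
  exact (hf.norm.const_mul C).mono' hmeas (.of_forall fun t => hC t (f t))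

end measurability

/-! ### Approximation and parameter integrals in C_c(G, B) -/

section compactSupport

variable {G : Type*} [TopologicalSpace G] [LocallyCompactSpace G] [T2Space G]
  {B : Type*} [NormedAddCommGroup B] [NormedSpace ℂ B]

/-- the function `t ↦ h(t) b` -/
noncomputable def smulCc (h : C_c(G, ℝ)) : B →ₗ[ℂ] C_c(G, B) where
  toFun b :=
    { toFun := fun t => h t • b
      continuous_toFun := h.continuous.smul continuous_const
      hasCompactSupport' := h.hasCompactSupport.smul_right }
  map_add' b c := by ext t; exact smul_add (h t) b c
  map_smul' c b := by ext t; exact smul_comm (h t) c b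

theorem smulCc_apply (h : C_c(G, ℝ)) (b : B) (t : G) : smulCc h b t = h t • b := rfl

theorem cc_sum_apply {ι : Type*} (s : Finset ι) (f : ι → C_c(G, B)) (t : G) :
    (∑ i ∈ s, f i) t = ∑ i ∈ s, f i t :=
  map_sum (AddMonoidHom.mk' (fun f : C_c(G, B) => f t) fun _ _ => rfl) f s

/-- Continuous functions with compact support are approximated, uniformly and with supports in a
fixed compact set, by sums of functions `t ↦ h(t) b`. -/
theorem exists_approx_smulCc {S : Set B} (hS : Dense (Submodule.span ℂ S : Set B))
    (f : C_c(G, B)) : ∃ K : Set G, IsCompact K ∧ (∀ t ∉ K, f t = 0) ∧ ∀ ε > 0,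
      ∃ g ∈ Submodule.span ℂ {g : C_c(G, B) | ∃ h : C_c(G, ℝ), ∃ b ∈ S, g = smulCc h b},
        (∀ t ∉ K, g t = 0) ∧ ∀ t, ‖f t - g t‖ ≤ ε := by
  obtain ⟨K, hK, hsub⟩ := exists_compact_superset (K := tsupport f) f.hasCompactSupport
  have hfK : ∀ t ∉ K, f t = 0 := fun t ht =>
    image_eq_zero_of_notMem_tsupport fun h => ht (interior_subset (hsub h))
  refine ⟨K, hK, hfK, fun ε hε => ?_⟩
  have hex : ∀ s : G, ∃ b ∈ Submodule.span ℂ S, ‖f s - b‖ < ε := fun s => by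
    obtain ⟨b, hb, hd⟩ := Metric.dense_iff.1 hS (f s) ε hε
    exact ⟨b, hd, by rwa [← dist_eq_norm, dist_comm]⟩
  choose b hbS hb using hex
  let V : G → Set G := fun s => {t | ‖f t - b s‖ < ε} ∩ interior K
  have hV : ∀ s, IsOpen (V s) := fun s =>
    (isOpen_lt (f.continuous.sub continuous_const).norm continuous_const).inter isOpen_interior
  have hcomp : IsCompact (tsupport f) := f.hasCompactSupport
  obtain ⟨T, hT⟩ := hcomp.elim_finite_subcover V hV fun s hs =>
    Set.mem_iUnion.2 ⟨s, hb s, hsub hs⟩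
  -- The approximant is ∑ ρ_s ⊗ b_s for a partition of unity subordinate to finitely many open
  -- subsets of K on which f stays within ε of the vector b_s.
  obtain ⟨ρ, hρ, hρc⟩ := PartitionOfUnity.exists_isSubordinate_of_locallyFinite_t2space
    hcomp (fun s : T => V s) (fun s => hV s)
    (locallyFinite_of_finite _) (by
      refine hT.trans fun t ht => ?_
      simp only [Set.mem_iUnion] at ht ⊢
      obtain ⟨s, hs, h⟩ := ht
      exact ⟨⟨s, hs⟩, h⟩)
  let h : T → C_c(G, ℝ) := fun s => ⟨ρ s, hρc s⟩
  have hh : ∀ s t, h s t = ρ s t := fun s t => rfl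
  refine ⟨∑ s : T, smulCc (h s) (b s), Submodule.sum_mem _ fun s _ => ?_, fun t ht => ?_,
    fun t => ?_⟩
  · have hle : Submodule.span ℂ S ≤ Submodule.comap (smulCc (h s)) (Submodule.span ℂ
        {g : C_c(G, B) | ∃ h : C_c(G, ℝ), ∃ b ∈ S, g = smulCc h b}) :=
      Submodule.span_le.2 fun b hb => Submodule.subset_span ⟨h s, b, hb, rfl⟩
    exact hle (hbS s)
  · rw [cc_sum_apply]
    refine Finset.sum_eq_zero fun s _ => ?_
    have : ρ s t = 0 := image_eq_zero_of_notMem_tsupport fun h =>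
      ht (interior_subset (hρ s h).2)
    rw [smulCc_apply, hh, this, zero_smul]
  · have hsum : ∑ s : T, ρ s t ≤ 1 := by
      rw [← finsum_eq_sum_of_fintype]; exact ρ.sum_le_one t
    have e : f t - (∑ s : T, smulCc (h s) (b s)) t = ∑ s : T, ρ s t • (f t - b s) := by
      rw [cc_sum_apply]
      simp only [smulCc_apply, hh, smul_sub, Finset.sum_sub_distrib]
      congr 1
      -- Outside the support of f the weights need not add up to 1, but there f vanishes.
      by_cases ht : t ∈ tsupport f
      · have : ∑ s : T, ρ s t = 1 := by
          rw [← finsum_eq_sum_of_fintype]; exact ρ.sum_eq_one ht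
        rw [← Finset.sum_smul, this, one_smul]
      · rw [image_eq_zero_of_notMem_tsupport ht]; simp
    rw [e]
    refine (norm_sum_le _ _).trans ?_
    calc ∑ s : T, ‖ρ s t • (f t - b s)‖ ≤ ∑ s : T, ρ s t * ε := by
          refine Finset.sum_le_sum fun s _ => ?_
          rw [norm_smul, Real.norm_of_nonneg (ρ.nonneg s t)]
          by_cases ht : t ∈ tsupport (ρ s)
          · exact mul_le_mul_of_nonneg_left (hρ s ht).1.le (ρ.nonneg s t)
          · rw [image_eq_zero_of_notMem_tsupport ht, zero_mul, zero_mul]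
      _ ≤ 1 * ε := by rw [← Finset.sum_mul]; exact mul_le_mul_of_nonneg_right hsum hε.le
      _ = ε := one_mul ε

variable [MeasurableSpace G] [BorelSpace G] (μ : Measure G) [IsFiniteMeasureOnCompacts μ]

/-- the function `t ↦ ∫ F(s, t) ds` -/
noncomputable def integralCc (F : G → G → B) (hF : Continuous fun p : G × G => F p.1 p.2)
    (hc : HasCompactSupport fun p : G × G => F p.1 p.2) : C_c(G, B) where
  toFun t := ∫ s, F s t ∂μ
  continuous_toFun := by
    rw [← continuousOn_univ]
    refine continuousOn_integral_of_compact_support (f := fun t s => F s t)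
      (hc.isCompact.image continuous_fst)
      (hF.comp (continuous_snd.prodMk continuous_fst)).continuousOn fun t s _ hs => ?_
    by_contra h
    exact hs ⟨(s, t), subset_tsupport _ h, rfl⟩
  hasCompactSupport' := by
    refine HasCompactSupport.intro (hc.isCompact.image continuous_snd) fun t ht => ?_
    have : ∀ s, F s t = 0 := fun s => by
      by_contra h
      exact ht ⟨(s, t), subset_tsupport _ h, rfl⟩
    simp [this]

end compactSupport

/-! ### The Hilbert module L²(G, B) -/

section L2

variable {G : Type*} [TopologicalSpace G] [LocallyCompactSpace G] [T2Space G]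
  [MeasurableSpace G] [BorelSpace G] {μ : Measure G} [IsFiniteMeasureOnCompacts μ]
  {B : Type*} [NonUnitalCStarAlgebra B]

theorem innerProd_toL2 (f g : C_c(G, B)) :
    innerProd B (toL2 μ f) (toL2 μ g) = ∫ t, star (f t) * g t ∂μ :=
  (l2Pre B μ).ip_toCompleted f g

theorem denseRange_toL2 : DenseRange (toL2 (A := B) μ) := denseRange_toCompleted (l2Pre B μ)

instance : CompleteSpace (L2 B μ) := HilbertModule.complete B

theorem norm_toL2_sq_le (f : C_c(G, B)) : ‖toL2 μ f‖ ^ 2 ≤ ∫ t, ‖f t‖ ^ 2 ∂μ := by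
  rw [norm_sq_eq_innerProd B, innerProd_toL2]
  refine (norm_integral_le_integral_norm _).trans_eq ?_
  simp only [CStarRing.norm_star_mul_self, sq]

theorem norm_toL2_le {K : Set G} (hK : IsCompact K) {f : C_c(G, B)} (hf : ∀ t ∉ K, f t = 0)
    {ε : ℝ} (hε : 0 ≤ ε) (h : ∀ t, ‖f t‖ ≤ ε) : ‖toL2 μ f‖ ≤ √(μ.real K) * ε := by
  have h1 : ∫ t, ‖f t‖ ^ 2 ∂μ ≤ μ.real K * ε ^ 2 := by
    rw [← setIntegral_eq_integral_of_forall_compl_eq_zero (s := K) fun t ht => by simp [hf t ht]]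
    have : IsFiniteMeasure (μ.restrict K) := ⟨by simpa using hK.measure_lt_top⟩
    calc ∫ t in K, ‖f t‖ ^ 2 ∂μ ≤ ∫ t in K, ε ^ 2 ∂μ := by
          refine integral_mono_of_nonneg (.of_forall fun t => by positivity)
            (integrable_const _) (.of_forall fun t => ?_)
          exact pow_le_pow_left₀ (norm_nonneg _) (h t) 2
      _ = _ := by simp
  rw [← abs_of_nonneg (norm_nonneg (toL2 μ f)), ← abs_of_nonneg (a := _ * ε) (by positivity),
    ← sq_le_sq, mul_pow, Real.sq_sqrt measureReal_nonneg]
  exact (norm_toL2_sq_le f).trans h1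

variable (B μ) in
theorem dense_span_smulCc {S : Set B} (hS : Dense (Submodule.span ℂ S : Set B)) :
    Dense (Submodule.span ℂ
      {z : L2 B μ | ∃ h : C_c(G, ℝ), ∃ b ∈ S, z = toL2 μ (smulCc h b)} : Set (L2 B μ)) := by
  have key : ∀ f : C_c(G, B), toL2 μ f ∈ closure (Submodule.span ℂ
      {z : L2 B μ | ∃ h : C_c(G, ℝ), ∃ b ∈ S, z = toL2 μ (smulCc h b)} : Set (L2 B μ)) := fun f => by
    obtain ⟨K, hK, hf, happ⟩ := exists_approx_smulCc hS f
    refine Metric.mem_closure_iff.2 fun ε hε => ?_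
    obtain ⟨g, hg, hgK, hfg⟩ := happ (ε / (√(μ.real K) + 1)) (by positivity)
    refine ⟨toL2 μ g, ?_, ?_⟩
    · have hle : Submodule.span ℂ {g : C_c(G, B) | ∃ h : C_c(G, ℝ), ∃ b ∈ S, g = smulCc h b} ≤
          Submodule.comap (toL2 μ) (Submodule.span ℂ
          {z : L2 B μ | ∃ h : C_c(G, ℝ), ∃ b ∈ S, z = toL2 μ (smulCc h b)}) :=
        Submodule.span_le.2 fun g ⟨h, b, hb, e⟩ => Submodule.subset_span ⟨h, b, hb, by rw [e]⟩
      exact hle hg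
    · rw [dist_eq_norm, ← map_sub]
      have h1 : ‖toL2 μ (f - g)‖ ≤ √(μ.real K) * (ε / (√(μ.real K) + 1)) :=
        norm_toL2_le hK (fun t ht => by
          change f t - g t = 0
          rw [hf t ht, hgK t ht, sub_zero]) (by positivity) hfg
      refine h1.trans_lt ?_
      rw [mul_div_assoc', div_lt_iff₀ (by positivity)]
      nlinarith [Real.sqrt_nonneg (μ.real K)]
  rw [dense_iff_closure_eq, ← Set.univ_subset_iff, ← denseRange_toL2.closure_range]
  exact closure_minimal (Set.range_subset_iff.2 key) isClosed_closure

/-- The squared distance is at most ∫ ‖F y t - F x t‖² dt; for y near x this is an integral over a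
fixed compact set, hence continuous in y. -/
theorem continuous_toL2_family {X : Type*} [TopologicalSpace X] {F : X → C_c(G, B)}
    (hF : Continuous fun p : X × G => F p.1 p.2)
    (hK : ∀ x, ∃ V ∈ nhds x, ∃ K : Set G, IsCompact K ∧ ∀ y ∈ V, ∀ t ∉ K, F y t = 0) :
    Continuous fun x => toL2 μ (F x) := by
  refine continuous_iff_continuousAt.2 fun x => ?_
  obtain ⟨V, hV, K, hK, h0⟩ := hK x
  have h1 : ContinuousOn (fun y => ∫ t, ‖F y t - F x t‖ ^ 2 ∂μ) V := by
    refine continuousOn_integral_of_compact_support (f := fun y t => ‖F y t - F x t‖ ^ 2) hK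
      (Continuous.continuousOn ?_) fun y t hy ht => ?_
    · exact ((hF.sub ((F x).continuous.comp continuous_snd)).norm.pow 2)
    · simp [h0 y hy t ht, h0 x (mem_of_mem_nhds hV) t ht]
  have h2 := (h1.continuousAt hV).tendsto
  simp only [sub_self, norm_zero, ne_eq, OfNat.ofNat_ne_zero, not_false_eq_true, zero_pow,
    integral_zero] at h2
  rw [ContinuousAt, tendsto_iff_norm_sub_tendsto_zero]
  have h3 : Filter.Tendsto (fun y => √(∫ t, ‖F y t - F x t‖ ^ 2 ∂μ)) (nhds x) (nhds 0) := by
    rw [← Real.sqrt_zero]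
    exact (Real.continuous_sqrt.tendsto 0).comp h2
  refine squeeze_zero (fun y => norm_nonneg _) (fun y => ?_) h3
  rw [← map_sub]
  exact Real.le_sqrt_of_sq_le (norm_toL2_sq_le (F y - F x))

variable (B) in
/-- the bounded operator `⟨x, ·⟩` -/
noncomputable def innerProdL {E : Type*} [NormedAddCommGroup E] [NormedSpace ℂ E]
    [HilbertModule B E] (x : E) : E →L[ℂ] B :=
  ((HilbertModule.toPreHilbertModule (A := B) (E := E)).ipₛₗ x).mkContinuous ‖x‖
    fun y => norm_innerProd_le x y

theorem innerProd_integral {E : Type*} [NormedAddCommGroup E] [NormedSpace ℂ E]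
    [HilbertModule B E] (x : E) {f : G → E} (hf : Integrable f μ) :
    innerProd B x (∫ s, f s ∂μ) = ∫ s, innerProd B x (f s) ∂μ := by
  have : CompleteSpace E := HilbertModule.complete B
  exact ((innerProdL B x).integral_comp_comm hf).symm

theorem ext_toL2 {x y : L2 B μ}
    (h : ∀ f : C_c(G, B), innerProd B (toL2 μ f) x = innerProd B (toL2 μ f) y) : x = y := by
  refine ext_innerProd B fun z => ?_
  exact denseRange_toL2.induction (P := fun z => innerProd B z x = innerProd B z y)
    (by rintro _ ⟨f, rfl⟩; exact h f)
    (isClosed_eq (continuous_innerProd_left B x) (continuous_innerProd_left B y)) z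

theorem clm_ext_toL2 {W : Type*} [NormedAddCommGroup W] [NormedSpace ℂ W] {T T' : L2 B μ →L[ℂ] W}
    (h : ∀ f : C_c(G, B), T (toL2 μ f) = T' (toL2 μ f)) : T = T' :=
  ContinuousLinearMap.ext fun z => denseRange_toL2.induction (P := fun z => T z = T' z)
    (by rintro _ ⟨f, rfl⟩; exact h f) (isClosed_eq T.continuous T'.continuous) z

section family

variable {F : G → C_c(G, B)} (hF : Continuous fun p : G × G => F p.1 p.2)
  (hc : HasCompactSupport fun p : G × G => F p.1 p.2)
include hF hc

theorem integrable_toL2_family : Integrable (fun s => toL2 μ (F s)) μ := by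
  have h0 : ∀ s t, F s t ≠ 0 → (s, t) ∈ tsupport fun p : G × G => F p.1 p.2 :=
    fun s t h => subset_tsupport _ h
  refine Continuous.integrable_of_hasCompactSupport (continuous_toL2_family hF fun s => ?_) ?_
  · refine ⟨Set.univ, Filter.univ_mem, _, hc.isCompact.image continuous_snd, fun s _ t ht => ?_⟩
    by_contra h
    exact ht ⟨(s, t), h0 s t h, rfl⟩
  · refine HasCompactSupport.intro (hc.isCompact.image continuous_fst) fun s hs => ?_
    have : F s = 0 := by
      ext t
      by_contra h
      exact hs ⟨(s, t), h0 s t h, rfl⟩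
    rw [this, map_zero]

/-- Tested against C_c(G, B) this is Fubini for continuous functions of compact support, a form
which needs no σ-finiteness. -/
theorem toL2_integralCc :
    toL2 μ (integralCc μ (fun s t => F s t) hF hc) = ∫ s, toL2 μ (F s) ∂μ := by
  refine ext_toL2 fun h => ?_
  rw [innerProd_integral _ (integrable_toL2_family hF hc), innerProd_toL2]
  simp only [innerProd_toL2]
  have hc' : HasCompactSupport fun p : G × G => star (h p.1) * F p.2 p.1 :=
    HasCompactSupport.mul_left (f := fun p : G × G => star (h p.1))
      (hc.comp_homeomorph (Homeomorph.prodComm G G))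
  rw [integral_integral_swap_of_hasCompactSupport (f := fun s t => star (h t) * F s t) ?_ ?_]
  · refine integral_congr_ae (.of_forall fun t => ?_)
    change star (h t) * ∫ s, F s t ∂μ = ∫ s, star (h t) * F s t ∂μ
    refine (integral_const_mul_of_integrable ?_).symm
    refine Continuous.integrable_of_hasCompactSupport (hF.comp (Continuous.prodMk_left t)) ?_
    refine HasCompactSupport.intro (hc.isCompact.image continuous_fst) fun s hs => ?_
    by_contra h
    exact hs ⟨(s, t), subset_tsupport (fun p : G × G => F p.1 p.2) h, rfl⟩
  · exact (continuous_star.comp (h.continuous.comp continuous_snd)).mul hF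
  · exact HasCompactSupport.mul_left (f := fun p : G × G => star (h p.2)) hc

end family

end L2

/-- `α` and `β` are strongly continuous and `Φ : A → M(B)` is equivariant. -/
structure IsCovariant {G : Type*} [TopologicalSpace G] [Group G]
    {A : Type*} [NonUnitalCStarAlgebra A] {B : Type*} [NonUnitalCStarAlgebra B]
    (α : G →* (A ≃⋆ₐ[ℂ] A)) (β : G →* (B ≃⋆ₐ[ℂ] B)) (Φ : A →⋆ₙₐ[ℂ] 𝓜(ℂ, B)) : Prop where
  continuous_left : ∀ a, Continuous fun t => α t a
  continuous_right : ∀ b, Continuous fun t => β t b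
  map_apply : ∀ t a b, (Φ (α t a)).fst (β t b) = β t ((Φ a).fst b)

/-! ### Joint continuity of actions and multiplications -/

section actions

variable {A : Type*} [NonUnitalCStarAlgebra A] {B : Type*} [NonUnitalCStarAlgebra B]

theorem norm_starAlgEquiv (e : A ≃⋆ₐ[ℂ] A) (a : A) : ‖e a‖ = ‖a‖ :=
  NonUnitalStarAlgHom.norm_map e e.injective a

theorem norm_multiplier_apply_le (Φ : A →⋆ₙₐ[ℂ] 𝓜(ℂ, B)) (a : A) (b : B) :
    ‖(Φ a).fst b‖ ≤ ‖a‖ * ‖b‖ := by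
  refine ((Φ a).fst.le_opNorm b).trans (mul_le_mul_of_nonneg_right ?_ (norm_nonneg b))
  rw [DoubleCentralizer.norm_fst]
  exact NonUnitalStarAlgHom.norm_apply_le Φ a

/-- `(a, b) ↦ Φ(a) b` as a bounded bilinear map -/
noncomputable def multL (Φ : A →⋆ₙₐ[ℂ] 𝓜(ℂ, B)) : A →L[ℂ] B →L[ℂ] B :=
  LinearMap.mkContinuous₂ (LinearMap.mk₂ ℂ (fun a b => (Φ a).fst b) (fun a a' b => by simp)
    (fun c a b => by simp) (fun a b b' => by simp) (fun c a b => by simp)) 1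
    fun a b => by rw [one_mul]; exact norm_multiplier_apply_le Φ a b

theorem continuous_multiplier_apply (Φ : A →⋆ₙₐ[ℂ] 𝓜(ℂ, B)) {X : Type*} [TopologicalSpace X]
    {f : X → A} {g : X → B} (hf : Continuous f) (hg : Continuous g) :
    Continuous fun x => (Φ (f x)).fst (g x) :=
  ((multL Φ).continuous.comp hf).clm_apply hg

/-- Automorphisms are isometric, so the difference splits into an isometric image of g y - g x and a
term controlled by strong continuity at the fixed vector g x. -/
theorem continuous_action {G : Type*} [TopologicalSpace G] [Group G] {α : G →* (A ≃⋆ₐ[ℂ] A)}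
    (hα : ∀ a, Continuous fun t => α t a) {X : Type*} [TopologicalSpace X]
    {f : X → G} {g : X → A} (hf : Continuous f) (hg : Continuous g) :
    Continuous fun x => α (f x) (g x) := by
  refine continuous_iff_continuousAt.2 fun x => ?_
  rw [ContinuousAt, tendsto_iff_norm_sub_tendsto_zero]
  have h1 : Filter.Tendsto (fun y => ‖g y - g x‖ + ‖α (f y) (g x) - α (f x) (g x)‖) (nhds x)
      (nhds 0) := by
    have e1 := tendsto_iff_norm_sub_tendsto_zero.1 (hg.tendsto x)
    have e2 := tendsto_iff_norm_sub_tendsto_zero.1 (((hα (g x)).comp hf).tendsto x)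
    simpa using e1.add e2
  refine squeeze_zero (fun y => norm_nonneg _) (fun y => ?_) h1
  have : α (f y) (g y) - α (f x) (g x)
      = α (f y) (g y - g x) + (α (f y) (g x) - α (f x) (g x)) := by
    rw [map_sub]; abel
  rw [this]
  refine (norm_add_le _ _).trans_eq ?_
  rw [norm_starAlgEquiv]

theorem action_mul {G : Type*} [Group G] (α : G →* (A ≃⋆ₐ[ℂ] A)) (s t : G) (a : A) :
    α (s * t) a = α s (α t a) := by rw [map_mul]; rfl

/-- the inclusion of `B` into `M(B)` -/
noncomputable abbrev toMult (B : Type*) [NonUnitalCStarAlgebra B] : B →⋆ₙₐ[ℂ] 𝓜(ℂ, B) :=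
  DoubleCentralizer.coeHom

theorem toMult_fst (b c : B) : (toMult B b).fst c = b * c := rfl

end actions

namespace IsCovariant

variable {G : Type*} [TopologicalSpace G] [Group G] [IsTopologicalGroup G]
  {A : Type*} [NonUnitalCStarAlgebra A] {B : Type*} [NonUnitalCStarAlgebra B]
  {α : G →* (A ≃⋆ₐ[ℂ] A)} {β : G →* (B ≃⋆ₐ[ℂ] B)} {Φ : A →⋆ₙₐ[ℂ] 𝓜(ℂ, B)}

theorem self (hβ : ∀ b, Continuous fun t => β t b) : IsCovariant β β (toMult B) :=
  ⟨hβ, hβ, fun t a b => (map_mul (β t) a b).symm⟩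

variable (c : IsCovariant α β Φ)

/-- `(a g)(t) = Φ(α_{t⁻¹}(a)) g(t)` -/
noncomputable def coeffCc (a : A) : C_c(G, B) →ₗ[ℂ] C_c(G, B) where
  toFun g :=
    { toFun := fun t => (Φ (α t⁻¹ a)).fst (g t)
      continuous_toFun := continuous_multiplier_apply Φ
        ((c.continuous_left a).comp continuous_inv) g.continuous
      hasCompactSupport' := g.hasCompactSupport.mono fun t ht h => ht (by
        simp only [h, map_zero]) }
  map_add' f g := by ext t; exact map_add (Φ (α t⁻¹ a)).fst (f t) (g t)
  map_smul' z g := by ext t; exact map_smul (Φ (α t⁻¹ a)).fst z (g t)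

theorem coeffCc_apply (a : A) (g : C_c(G, B)) (t : G) :
    c.coeffCc a g t = (Φ (α t⁻¹ a)).fst (g t) := rfl

end IsCovariant

section extension

variable {G : Type*} [TopologicalSpace G] [LocallyCompactSpace G] [T2Space G]
  [MeasurableSpace G] [BorelSpace G] (μ : Measure G) [IsFiniteMeasureOnCompacts μ]
  {B : Type*} [NonUnitalCStarAlgebra B] {W : Type*} [NormedAddCommGroup W] [NormedSpace ℂ W]
  [CompleteSpace W]

/-- the continuous extension to `L²(G, B)` of a bounded linear map on `C_c(G, B)` -/
noncomputable def extendL2 (f : C_c(G, B) →ₗ[ℂ] W) : L2 B μ →L[ℂ] W :=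
  LinearMap.extendOfNorm f (toL2 μ)

variable {μ} in
theorem extendL2_toL2 {f : C_c(G, B) →ₗ[ℂ] W} {C : ℝ} (h : ∀ g, ‖f g‖ ≤ C * ‖toL2 μ g‖)
    (g : C_c(G, B)) : extendL2 μ f (toL2 μ g) = f g :=
  LinearMap.extendOfNorm_eq (f := f) (e := toL2 μ) denseRange_toL2 ⟨C, h⟩ g

variable {μ} in
theorem norm_extendL2_le {f : C_c(G, B) →ₗ[ℂ] W} {C : ℝ} (hC : 0 ≤ C)
    (h : ∀ g, ‖f g‖ ≤ C * ‖toL2 μ g‖) : ‖extendL2 μ f‖ ≤ C :=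
  LinearMap.opNorm_extendOfNorm_le (f := f) (e := toL2 μ) denseRange_toL2 hC h

end extension

/-! ### Left translation on L²(G, B) -/

section translation

variable {G : Type*} [TopologicalSpace G] [Group G] [IsTopologicalGroup G]
  {B : Type*} [NonUnitalCStarAlgebra B]

variable (B) in
/-- left translation, `(s g)(t) = g(s⁻¹ t)` -/
noncomputable def transCc (s : G) : C_c(G, B) →ₗ[ℂ] C_c(G, B) where
  toFun g :=
    { toFun := fun t => g (s⁻¹ * t)
      continuous_toFun := g.continuous.comp (continuous_const_mul s⁻¹)
      hasCompactSupport' := g.hasCompactSupport.comp_homeomorph (Homeomorph.mulLeft s⁻¹) }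
  map_add' _ _ := rfl
  map_smul' _ _ := rfl

theorem transCc_apply (s : G) (g : C_c(G, B)) (t : G) : transCc B s g t = g (s⁻¹ * t) := rfl

variable [LocallyCompactSpace G] [T2Space G] [MeasurableSpace G] [BorelSpace G]
  (μ : Measure G) [μ.IsHaarMeasure]

theorem innerProd_transCc (s : G) (f g : C_c(G, B)) :
    innerProd B (toL2 μ (transCc B s f)) (toL2 μ g)
      = innerProd B (toL2 μ f) (toL2 μ (transCc B s⁻¹ g)) := by
  rw [innerProd_toL2, innerProd_toL2, ← integral_mul_left_eq_self _ s]
  simp only [transCc_apply, inv_mul_cancel_left, inv_inv]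

theorem norm_transCc (s : G) (g : C_c(G, B)) : ‖toL2 μ (transCc B s g)‖ = ‖toL2 μ g‖ := by
  have e : transCc B s⁻¹ (transCc B s g) = g := by
    ext t; simp [transCc_apply]
  have h1 := norm_sq_eq_innerProd B (toL2 μ (transCc B s g))
  rw [innerProd_transCc, e, ← norm_sq_eq_innerProd B] at h1
  exact (sq_eq_sq₀ (norm_nonneg _) (norm_nonneg _)).1 h1

variable (B) in
/-- the left translation operator on `L²(G, B)` -/
noncomputable def transOp (s : G) : L2 B μ →L[ℂ] L2 B μ :=
  extendL2 μ ((toL2 μ).comp (transCc B s))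

theorem transOp_toL2 (s : G) (g : C_c(G, B)) :
    transOp B μ s (toL2 μ g) = toL2 μ (transCc B s g) :=
  extendL2_toL2 (f := (toL2 μ).comp (transCc B s)) (C := 1)
    (fun g => by rw [one_mul]; exact (norm_transCc μ s g).le) g

theorem norm_transOp_le (s : G) : ‖transOp B μ s‖ ≤ 1 :=
  norm_extendL2_le (f := (toL2 μ).comp (transCc B s)) zero_le_one fun g => by
    rw [one_mul]; exact (norm_transCc μ s g).le

theorem transOp_mul (s t : G) (x : L2 B μ) :
    transOp B μ (s * t) x = transOp B μ s (transOp B μ t x) := by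
  have : transOp B μ (s * t) = (transOp B μ s).comp (transOp B μ t) := clm_ext_toL2 fun g => by
    rw [ContinuousLinearMap.comp_apply, transOp_toL2, transOp_toL2, transOp_toL2]
    congr 1
    ext r
    simp [transCc_apply, mul_assoc]
  rw [this]; rfl

theorem innerProd_transOp (s : G) (x y : L2 B μ) :
    innerProd B (transOp B μ s x) y = innerProd B x (transOp B μ s⁻¹ y) := by
  refine denseRange_toL2.induction_on₂ (p := fun x y =>
    innerProd B (transOp B μ s x) y = innerProd B x (transOp B μ s⁻¹ y)) ?_ ?_ x y
  · have hc := continuous_innerProd B (L2 B μ)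
    exact isClosed_eq (hc.comp (f := fun p : L2 B μ × L2 B μ => (transOp B μ s p.1, p.2))
      (by fun_prop)) (hc.comp (f := fun p : L2 B μ × L2 B μ => (p.1, transOp B μ s⁻¹ p.2))
      (by fun_prop))
  · intro f g
    rw [transOp_toL2, transOp_toL2, innerProd_transCc]

/-- For x in C_c(G, B) the translates have supports in a common compact set, locally in s; the
general case follows by an ε/3 argument since ‖U_s‖ ≤ 1. -/
theorem continuous_transOp (x : L2 B μ) : Continuous fun s => transOp B μ s x := by
  have h : ∀ g : C_c(G, B), Continuous fun s => transOp B μ s (toL2 μ g) := fun g => by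
    simp only [transOp_toL2]
    refine continuous_toL2_family (F := fun s => transCc B s g) ?_ fun s => ?_
    · exact g.continuous.comp (by fun_prop : Continuous fun p : G × G => p.1⁻¹ * p.2)
    · obtain ⟨V, hV, hs⟩ := exists_compact_mem_nhds s
      refine ⟨V, hs, V * tsupport g, IsCompact.mul hV g.hasCompactSupport, fun r hr t ht => ?_⟩
      by_contra h
      exact ht ⟨r, hr, r⁻¹ * t, subset_tsupport _ h, by simp⟩
  refine continuous_iff_continuousAt.2 fun s => Metric.continuousAt_iff'.2 fun ε hε => ?_
  obtain ⟨g, hg⟩ := denseRange_toL2.exists_dist_lt x (show 0 < ε / 3 by positivity)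
  filter_upwards [Metric.continuousAt_iff'.1 (h g).continuousAt (ε / 3) (by positivity)] with r hr
  have hle : ∀ r, dist (transOp B μ r x) (transOp B μ r (toL2 μ g)) < ε / 3 := fun r => by
    refine lt_of_le_of_lt ?_ hg
    rw [dist_eq_norm, dist_eq_norm, ← map_sub]
    exact ((transOp B μ r).le_of_opNorm_le (norm_transOp_le μ r) _).trans_eq (one_mul _)
  calc _ ≤ dist (transOp B μ r x) (transOp B μ r (toL2 μ g))
        + dist (transOp B μ r (toL2 μ g)) (transOp B μ s (toL2 μ g))
        + dist (transOp B μ s (toL2 μ g)) (transOp B μ s x) := dist_triangle4 _ _ _ _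
    _ < ε / 3 + ε / 3 + ε / 3 := by
      refine add_lt_add (add_lt_add (hle r) hr) ?_
      rw [dist_comm]; exact hle s
    _ = ε := by ring

end translation

/-! ### The covariant pair (M, U) of (A, α) on L²(G, B) and its integrated form -/

namespace IsCovariant

variable {G : Type*} [TopologicalSpace G] [Group G] [IsTopologicalGroup G]
  [LocallyCompactSpace G] [T2Space G] [MeasurableSpace G] [BorelSpace G]
  {A : Type*} [NonUnitalCStarAlgebra A] {B : Type*} [NonUnitalCStarAlgebra B]
  {α : G →* (A ≃⋆ₐ[ℂ] A)} {β : G →* (B ≃⋆ₐ[ℂ] B)} {Φ : A →⋆ₙₐ[ℂ] 𝓜(ℂ, B)}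
  (c : IsCovariant α β Φ) (μ : Measure G)

theorem star_mult_apply_mul (a : A) (b d : B) :
    star ((Φ a).fst b) * d = star b * (Φ (star a)).fst d := by
  rw [← multiplier_central (Φ (star a)) b d, map_star, star_star]

/-- In M(B) the element ‖a‖² - Φ(a)*Φ(a) is positive, say S*S, and compressing by b leaves (Sb)*(Sb)
≥ 0. An inequality in B, not merely of norms, is required because it is integrated in
`norm_coeffCc_le`. -/
theorem star_mult_le [PartialOrder B] [StarOrderedRing B] (a : A) (b : B) :
    star ((Φ a).fst b) * (Φ a).fst b ≤ ‖a‖ ^ 2 • (star b * b) := by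
  let _ := CStarAlgebra.spectralOrder 𝓜(ℂ, B)
  let _ := CStarAlgebra.spectralOrderedRing 𝓜(ℂ, B)
  have h0 : star (Φ a) * Φ a ≤ algebraMap ℝ 𝓜(ℂ, B) ‖star (Φ a) * Φ a‖ :=
    IsSelfAdjoint.le_algebraMap_norm_self (IsSelfAdjoint.star_mul_self (Φ a))
  have h0' : star (Φ a) * Φ a ≤ algebraMap ℝ 𝓜(ℂ, B) (‖a‖ ^ 2) := by
    refine h0.trans (algebraMap_mono 𝓜(ℂ, B) ?_)
    rw [CStarRing.norm_star_mul_self, ← sq]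
    exact pow_le_pow_left₀ (norm_nonneg _) (NonUnitalStarAlgHom.norm_apply_le Φ a) 2
  obtain ⟨S, hS⟩ := CStarAlgebra.nonneg_iff_eq_star_mul_self.1 (sub_nonneg.2 h0')
  rw [← sub_nonneg]
  have e : ‖a‖ ^ 2 • (star b * b) - star ((Φ a).fst b) * (Φ a).fst b
      = star (S.fst b) * S.fst b := by
    have h1 := multiplier_central (star S) b (S.fst b)
    rw [star_star] at h1
    have h2 := multiplier_central (star (Φ a)) b ((Φ a).fst b)
    rw [star_star] at h2
    rw [h1, h2, ← mul_smul_comm, ← mul_sub]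
    congr 1
    have h3 : (algebraMap ℝ 𝓜(ℂ, B) (‖a‖ ^ 2) - star (Φ a) * Φ a).fst b = (star S * S).fst b := by
      rw [hS]
    rw [Algebra.algebraMap_eq_smul_one] at h3
    exact h3
  rw [e]
  exact star_mul_self_nonneg _

section

variable [IsFiniteMeasureOnCompacts μ]

theorem norm_coeffCc_le (a : A) (g : C_c(G, B)) :
    ‖toL2 μ (c.coeffCc a g)‖ ≤ ‖a‖ * ‖toL2 μ g‖ := by
  let _ := CStarAlgebra.spectralOrder B
  let _ := CStarAlgebra.spectralOrderedRing B
  rw [← abs_of_nonneg (norm_nonneg (toL2 μ (c.coeffCc a g))),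
    ← abs_of_nonneg (a := ‖a‖ * _) (by positivity), ← sq_le_sq, mul_pow,
    norm_sq_eq_innerProd B, norm_sq_eq_innerProd B (toL2 μ g), innerProd_toL2, innerProd_toL2]
  have h1 : ∫ t, star (c.coeffCc a g t) * c.coeffCc a g t ∂μ
      ≤ ‖a‖ ^ 2 • ∫ t, star (g t) * g t ∂μ := by
    have i1 : Integrable (fun t => ‖a‖ ^ 2 • (star (g t) * g t)) μ :=
      (integrable_star_mul μ g g).smul (‖a‖ ^ 2)
    rw [← sub_nonneg, ← integral_smul, ← integral_sub i1 (integrable_star_mul μ _ _)]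
    refine integral_nonneg fun t => ?_
    change 0 ≤ ‖a‖ ^ 2 • (star (g t) * g t)
      - star ((Φ (α t⁻¹ a)).fst (g t)) * (Φ (α t⁻¹ a)).fst (g t)
    rw [sub_nonneg, ← norm_starAlgEquiv (α t⁻¹) a]
    exact star_mult_le _ _
  have h2 := CStarAlgebra.norm_le_norm_of_nonneg_of_le
    (integral_nonneg fun t => star_mul_self_nonneg (c.coeffCc a g t)) h1
  rwa [norm_smul, norm_pow, norm_norm] at h2

theorem innerProd_coeffCc (a : A) (f g : C_c(G, B)) :
    innerProd B (toL2 μ (c.coeffCc a f)) (toL2 μ g)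
      = innerProd B (toL2 μ f) (toL2 μ (c.coeffCc (star a) g)) := by
  rw [innerProd_toL2, innerProd_toL2]
  refine integral_congr_ae (.of_forall fun t => ?_)
  change star ((Φ (α t⁻¹ a)).fst (f t)) * g t = star (f t) * (Φ (α t⁻¹ (star a))).fst (g t)
  rw [star_mult_apply_mul, map_star (α t⁻¹)]

/-- the operator `(a g)(t) = Φ(α_{t⁻¹}(a)) g(t)` on `L²(G, B)`, as a function of `a` -/
noncomputable def coeffOp : A →L[ℂ] L2 B μ →L[ℂ] L2 B μ :=
  have h : ∀ (a : A) (g : C_c(G, B)),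
      extendL2 μ ((toL2 μ).comp (c.coeffCc a)) (toL2 μ g)
        = toL2 μ (c.coeffCc a g) := fun a g =>
    extendL2_toL2 (f := (toL2 μ).comp (c.coeffCc a)) (fun g => c.norm_coeffCc_le μ a g) g
  LinearMap.mkContinuous
    { toFun := fun a => extendL2 μ ((toL2 μ).comp (c.coeffCc a))
      map_add' := fun a a' => clm_ext_toL2 fun g => by
        rw [add_apply, h, h, h, ← map_add]
        congr 1
        ext t
        simp [coeffCc_apply]
      map_smul' := fun z a => clm_ext_toL2 fun g => by
        rw [smul_apply, h, h, ← map_smul]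
        congr 1
        ext t
        simp [coeffCc_apply] } 1
    fun a => by
      rw [one_mul]
      exact norm_extendL2_le (f := (toL2 μ).comp (c.coeffCc a)) (norm_nonneg a)
        fun g => c.norm_coeffCc_le μ a g

theorem coeffOp_toL2 (a : A) (g : C_c(G, B)) :
    c.coeffOp μ a (toL2 μ g) = toL2 μ (c.coeffCc a g) :=
  extendL2_toL2 (f := (toL2 μ).comp (c.coeffCc a)) (fun g => c.norm_coeffCc_le μ a g) g

theorem norm_coeffOp_le (a : A) : ‖c.coeffOp μ a‖ ≤ ‖a‖ :=
  norm_extendL2_le (f := (toL2 μ).comp (c.coeffCc a)) (norm_nonneg a)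
    fun g => c.norm_coeffCc_le μ a g

theorem innerProd_coeffOp (a : A) (x y : L2 B μ) :
    innerProd B (c.coeffOp μ a x) y = innerProd B x (c.coeffOp μ (star a) y) := by
  refine denseRange_toL2.induction_on₂ (p := fun x y =>
    innerProd B (c.coeffOp μ a x) y = innerProd B x (c.coeffOp μ (star a) y)) ?_ ?_ x y
  · have hc := continuous_innerProd B (L2 B μ)
    exact isClosed_eq (hc.comp (f := fun p : L2 B μ × L2 B μ => (c.coeffOp μ a p.1, p.2))
      (by fun_prop)) (hc.comp (f := fun p : L2 B μ × L2 B μ => (p.1, c.coeffOp μ (star a) p.2))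
      (by fun_prop))
  · intro f g
    rw [coeffOp_toL2, coeffOp_toL2, innerProd_coeffCc]

theorem coeffOp_coeffOp (cB : IsCovariant β β (toMult B)) (a : A) (b : B) (x : L2 B μ) :
    c.coeffOp μ a (cB.coeffOp μ b x) = cB.coeffOp μ ((Φ a).fst b) x := by
  have : (c.coeffOp μ a).comp (cB.coeffOp μ b) = cB.coeffOp μ ((Φ a).fst b) :=
    clm_ext_toL2 fun g => by
      rw [ContinuousLinearMap.comp_apply, coeffOp_toL2, coeffOp_toL2, coeffOp_toL2]
      congr 1
      ext t
      simp only [coeffCc_apply, toMult_fst]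
      rw [multiplier_mul, c.map_apply]
  rw [← this]; rfl

end

variable [μ.IsHaarMeasure]

theorem transOp_coeffOp (s : G) (a : A) (x : L2 B μ) :
    transOp B μ s (c.coeffOp μ a x) = c.coeffOp μ (α s a) (transOp B μ s x) := by
  have : (transOp B μ s).comp (c.coeffOp μ a) = (c.coeffOp μ (α s a)).comp (transOp B μ s) :=
    clm_ext_toL2 fun g => by
      rw [ContinuousLinearMap.comp_apply, ContinuousLinearMap.comp_apply, coeffOp_toL2,
        transOp_toL2, transOp_toL2, coeffOp_toL2]
      congr 1
      ext t
      simp only [coeffCc_apply, transCc_apply]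
      rw [← action_mul, mul_inv_rev, inv_inv]
  exact congrArg (fun T => T x) this

theorem continuous_integrand {X : Type*} [TopologicalSpace X] {φ : X → A} (hφ : Continuous φ)
    {s : X → G} (hs : Continuous s) (x : L2 B μ) :
    Continuous fun r => c.coeffOp μ (φ r) (transOp B μ (s r) x) :=
  ((c.coeffOp μ).continuous.comp hφ).clm_apply ((continuous_transOp μ x).comp hs)

theorem norm_integrand_le (a : A) (s : G) (x : L2 B μ) :
    ‖c.coeffOp μ a (transOp B μ s x)‖ ≤ ‖a‖ * ‖x‖ :=
  ((c.coeffOp μ a).le_of_opNorm_le (c.norm_coeffOp_le μ a) _).trans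
    (mul_le_mul_of_nonneg_left (((transOp B μ s).le_of_opNorm_le (norm_transOp_le μ s) _).trans_eq
      (one_mul _)) (norm_nonneg a))

theorem integrable_integrand (φ : C_c(G, A)) (x : L2 B μ) :
    Integrable (fun s => c.coeffOp μ (φ s) (transOp B μ s x)) μ := by
  refine (c.continuous_integrand μ φ.continuous continuous_id x).integrable_of_hasCompactSupport
    (φ.hasCompactSupport.mono fun _ hs h => hs ?_)
  simp [h]

/-- the integrated form `x ↦ ∫ φ(s) U_s x ds` -/
noncomputable def intOp (φ : C_c(G, A)) : L2 B μ →L[ℂ] L2 B μ :=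
  LinearMap.mkContinuous
    { toFun := fun x => ∫ s, c.coeffOp μ (φ s) (transOp B μ s x) ∂μ
      map_add' := fun x y => by
        rw [← integral_add (c.integrable_integrand μ φ x) (c.integrable_integrand μ φ y)]
        simp only [map_add]
      map_smul' := fun z x => by
        rw [RingHom.id_apply, ← integral_smul]
        simp only [map_smul] } (∫ s, ‖φ s‖ ∂μ)
    fun x => by
      rw [← integral_mul_const]
      exact norm_integral_le_of_norm_le ((φ.continuous.norm.integrable_of_hasCompactSupport
        φ.hasCompactSupport.norm).mul_const _) (.of_forall fun s => c.norm_integrand_le μ _ s x)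

theorem intOp_apply (φ : C_c(G, A)) (x : L2 B μ) :
    c.intOp μ φ x = ∫ s, c.coeffOp μ (φ s) (transOp B μ s x) ∂μ := rfl

theorem norm_intOp_le (φ : C_c(G, A)) : ‖c.intOp μ φ‖ ≤ ∫ s, ‖φ s‖ ∂μ :=
  LinearMap.mkContinuous_norm_le _ (integral_nonneg fun _ => norm_nonneg _) _

theorem intOp_add (φ ψ : C_c(G, A)) : c.intOp μ (φ + ψ) = c.intOp μ φ + c.intOp μ ψ :=
  ContinuousLinearMap.ext fun x => by
    rw [add_apply, intOp_apply, intOp_apply, intOp_apply,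
      ← integral_add (c.integrable_integrand μ φ x) (c.integrable_integrand μ ψ x)]
    simp

theorem intOp_smul (z : ℂ) (φ : C_c(G, A)) : c.intOp μ (z • φ) = z • c.intOp μ φ :=
  ContinuousLinearMap.ext fun x => by
    rw [smul_apply, intOp_apply, intOp_apply, ← integral_smul]
    simp

theorem hasCompactSupport_conv {φ : C_c(G, A)} {g : C_c(G, B)} {F : G → G → B}
    (h : ∀ s t, φ s = 0 → F s t = 0) (h' : ∀ s t, g (s⁻¹ * t) = 0 → F s t = 0) :
    HasCompactSupport fun p : G × G => F p.1 p.2 := by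
  refine HasCompactSupport.intro (φ.hasCompactSupport.isCompact.prod
    (φ.hasCompactSupport.isCompact.mul g.hasCompactSupport.isCompact)) fun p hp => ?_
  by_contra hne
  have h1 : p.1 ∈ tsupport φ := subset_tsupport _ fun e => hne (h p.1 p.2 e)
  have h2 : p.1⁻¹ * p.2 ∈ tsupport g := subset_tsupport _ fun e => hne (h' p.1 p.2 e)
  exact hp ⟨h1, p.1, h1, _, h2, by simp⟩

theorem continuous_laurent_integrand (φ : C_c(G, A)) (g : C_c(G, B)) :
    Continuous fun p : G × G => c.coeffCc (φ p.1) (transCc B p.1 g) p.2 := by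
  refine continuous_multiplier_apply Φ ?_ (g.continuous.comp (by fun_prop))
  exact continuous_action c.continuous_left (by fun_prop) (φ.continuous.comp continuous_fst)

theorem hasCompactSupport_laurent_integrand (φ : C_c(G, A)) (g : C_c(G, B)) :
    HasCompactSupport fun p : G × G => c.coeffCc (φ p.1) (transCc B p.1 g) p.2 := by
  refine hasCompactSupport_conv (φ := φ) (g := g)
    (F := fun s t => c.coeffCc (φ s) (transCc B s g) t) (fun s t h => ?_) fun s t h => ?_
  · simp [coeffCc_apply, h]
  · simp [coeffCc_apply, transCc_apply, h]

/-- the function `t ↦ ∫ Φ(α_{t⁻¹}(φ(s))) g(s⁻¹ t) ds` -/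
noncomputable def laurentCc (φ : C_c(G, A)) (g : C_c(G, B)) : C_c(G, B) :=
  integralCc μ (fun s t => c.coeffCc (φ s) (transCc B s g) t) (c.continuous_laurent_integrand φ g)
    (c.hasCompactSupport_laurent_integrand φ g)

/-- For A = B acting on itself this identifies the integrated form with the Laurent operator λ_φ. -/
theorem intOp_toL2 (φ : C_c(G, A)) (g : C_c(G, B)) :
    c.intOp μ φ (toL2 μ g) = toL2 μ (c.laurentCc μ φ g) := by
  rw [laurentCc, toL2_integralCc (F := fun s => c.coeffCc (φ s) (transCc B s g)), intOp_apply]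
  simp only [transOp_toL2, coeffOp_toL2]

end IsCovariant

theorem innerProd_integral_left {G : Type*} [MeasurableSpace G] {μ : Measure G}
    {B : Type*} [NonUnitalCStarAlgebra B] {E : Type*} [NormedAddCommGroup E] [NormedSpace ℂ E]
    [HilbertModule B E] (x : E) {f : G → E} (hf : Integrable f μ) :
    innerProd B (∫ s, f s ∂μ) x = ∫ s, innerProd B (f s) x ∂μ := by
  have : CompleteSpace E := HilbertModule.complete B
  have h1 : innerProd B x (∫ s, f s ∂μ) = ∫ s, innerProd B x (f s) ∂μ :=
    ((innerProdL B x).integral_comp_comm hf).symm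
  have h2 := (starL' ℝ : B ≃L[ℝ] B).integral_comp_comm (μ := μ) (fun s => innerProd B x (f s))
  rw [← star_innerProd, h1]
  refine h2.symm.trans (integral_congr_ae (.of_forall fun s => ?_))
  exact star_innerProd x (f s)

/-! ### Adjoints and products of integrated forms -/

section

variable {G : Type*} [TopologicalSpace G] [Group G] [IsTopologicalGroup G]
  [LocallyCompactSpace G] [T2Space G] [MeasurableSpace G] [BorelSpace G]
  {A : Type*} [NonUnitalCStarAlgebra A] {B : Type*} [NonUnitalCStarAlgebra B]
  {α : G →* (A ≃⋆ₐ[ℂ] A)} {β : G →* (B ≃⋆ₐ[ℂ] B)} {Φ : A →⋆ₙₐ[ℂ] 𝓜(ℂ, B)}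

/-- the involution `φ*(t) = Δ(t)⁻¹ α_t(φ(t⁻¹)*)` on `C_c(G, A)` -/
noncomputable def starCc (hα : ∀ a, Continuous fun t => α t a) (φ : C_c(G, A)) : C_c(G, A) where
  toFun t := (modular t)⁻¹ • α t (star (φ t⁻¹))
  continuous_toFun := (continuous_modular.inv₀ fun t => (modular_pos t).ne').smul
    (continuous_action hα continuous_id
      (continuous_star.comp (φ.continuous.comp continuous_inv)))
  hasCompactSupport' := (φ.hasCompactSupport.comp_homeomorph (Homeomorph.inv G)).mono
    fun t ht h => ht (by
      have : φ t⁻¹ = 0 := h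
      simp [this])

theorem starCc_apply (hα : ∀ a, Continuous fun t => α t a) (φ : C_c(G, A)) (t : G) :
    starCc hα φ t = (modular t)⁻¹ • α t (star (φ t⁻¹)) := rfl

namespace IsCovariant

variable (c : IsCovariant α β Φ) (μ : Measure G) [μ.IsHaarMeasure]

section

variable [μ.Regular]

/-- The adjoint of M_a U_s is U_{s⁻¹} M_{a*} = M_{α_{s⁻¹}(a*)} U_{s⁻¹}. Replacing s by s⁻¹ in the
integral produces the factor Δ(s)⁻¹ of the involution. -/
theorem innerProd_intOp (φ : C_c(G, A)) (x y : L2 B μ) :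
    innerProd B (c.intOp μ φ x) y = innerProd B x (c.intOp μ (starCc c.continuous_left φ) y) := by
  rw [intOp_apply, intOp_apply, innerProd_integral_left _ (c.integrable_integrand μ φ x),
    innerProd_integral _ (c.integrable_integrand μ _ y)]
  have e : ∀ s, innerProd B (c.coeffOp μ (φ s) (transOp B μ s x)) y
      = innerProd B x (c.coeffOp μ (α s⁻¹ (star (φ s))) (transOp B μ s⁻¹ y)) := fun s => by
    rw [innerProd_coeffOp, innerProd_transOp, transOp_coeffOp]
  simp only [e]
  rw [← integral_modular_inv μ]
  · refine integral_congr_ae (.of_forall fun s => ?_)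
    simp only [starCc_apply, inv_inv]
    have : c.coeffOp μ ((modular s)⁻¹ • α s (star (φ s⁻¹)))
        = (((modular s)⁻¹ : ℝ) : ℂ) • c.coeffOp μ (α s (star (φ s⁻¹))) := by
      rw [← Complex.coe_smul, map_smul]
    rw [this, smul_apply, innerProd_smul_right, Complex.coe_smul]
  · refine (continuous_innerProd_right B x).comp (c.continuous_integrand μ ?_ continuous_inv y)
    exact continuous_action c.continuous_left continuous_inv (continuous_star.comp φ.continuous)
  · refine φ.hasCompactSupport.mono fun s hs h => hs ?_
    simp [h, innerProd_zero_right]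

/-- the integrated form of `φ`, as an adjointable operator -/
noncomputable def lamOp (φ : C_c(G, A)) : Adjointable B (L2 B μ) :=
  ⟨c.intOp μ φ, c.intOp μ (starCc c.continuous_left φ), c.innerProd_intOp μ φ⟩

theorem star_lamOp (φ : C_c(G, A)) :
    star (c.lamOp μ φ) = c.lamOp μ (starCc c.continuous_left φ) :=
  (Adjointable.eq_star (T := c.lamOp μ φ) (S := c.lamOp μ (starCc c.continuous_left φ))
    (c.innerProd_intOp μ φ)).symm

theorem norm_lamOp_le (φ : C_c(G, A)) : ‖c.lamOp μ φ‖ ≤ ∫ s, ‖φ s‖ ∂μ := c.norm_intOp_le μ φ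

theorem lamOp_add (φ ψ : C_c(G, A)) : c.lamOp μ (φ + ψ) = c.lamOp μ φ + c.lamOp μ ψ :=
  Subtype.ext (c.intOp_add μ φ ψ)

theorem lamOp_smul (z : ℂ) (φ : C_c(G, A)) : c.lamOp μ (z • φ) = z • c.lamOp μ φ :=
  Subtype.ext (c.intOp_smul μ z φ)

/-- `lamOp` as a linear map -/
noncomputable def lamL : C_c(G, A) →ₗ[ℂ] Adjointable B (L2 B μ) where
  toFun := c.lamOp μ
  map_add' := c.lamOp_add μ
  map_smul' := c.lamOp_smul μ

/-- the operator of pointwise multiplication by `a`, as an adjointable operator -/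
noncomputable def coeffAdj (a : A) : Adjointable B (L2 B μ) :=
  ⟨c.coeffOp μ a, c.coeffOp μ (star a), c.innerProd_coeffOp μ a⟩

end

include c in
theorem continuous_conv_integrand (φ : C_c(G, A)) (ψ : C_c(G, B)) :
    Continuous fun p : G × G => (Φ (φ p.1)).fst (β p.1 (ψ (p.1⁻¹ * p.2))) :=
  continuous_multiplier_apply Φ (φ.continuous.comp continuous_fst)
    (continuous_action c.continuous_right continuous_fst (ψ.continuous.comp (by fun_prop)))

include c in
theorem hasCompactSupport_conv_integrand (φ : C_c(G, A)) (ψ : C_c(G, B)) :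
    HasCompactSupport fun p : G × G => (Φ (φ p.1)).fst (β p.1 (ψ (p.1⁻¹ * p.2))) :=
  hasCompactSupport_conv (φ := φ) (g := ψ) (F := fun s t => (Φ (φ s)).fst (β s (ψ (s⁻¹ * t))))
    (fun s t h => by simp [h]) (fun s t h => by simp [h])

/-- the convolution product `t ↦ ∫ Φ(φ(s)) β_s(ψ(s⁻¹ t)) ds` -/
noncomputable def convCc (φ : C_c(G, A)) (ψ : C_c(G, B)) : C_c(G, B) :=
  integralCc μ (fun s t => (Φ (φ s)).fst (β s (ψ (s⁻¹ * t))))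
    (c.continuous_conv_integrand φ ψ) (c.hasCompactSupport_conv_integrand φ ψ)

include c in
theorem integrable_conv_integrand (φ : C_c(G, A)) (ψ : C_c(G, B)) (t : G) :
    Integrable (fun s => (Φ (φ s)).fst (β s (ψ (s⁻¹ * t)))) μ := by
  refine Continuous.integrable_of_hasCompactSupport
    ((c.continuous_conv_integrand φ ψ).comp (Continuous.prodMk_left t))
    (φ.hasCompactSupport.mono fun s hs h => hs ?_)
  simp [h]

/-- The relations U_s M_b = M_{β_s(b)} U_s and M_a M_b = M_{Φ(a)b} give the integrand
M_{Φ(φ(s))β_s(ψ(r))} U_{sr}; left translation of r by s⁻¹ and Fubini collect the coefficient of U_r.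
-/
theorem intOp_intOp (cB : IsCovariant β β (toMult B)) (φ : C_c(G, A)) (ψ : C_c(G, B))
    (x : L2 B μ) : c.intOp μ φ (cB.intOp μ ψ x) = cB.intOp μ (c.convCc μ φ ψ) x := by
  have e1 : ∀ s, c.coeffOp μ (φ s) (transOp B μ s (cB.intOp μ ψ x))
      = ∫ r, cB.coeffOp μ ((Φ (φ s)).fst (β s (ψ (s⁻¹ * r)))) (transOp B μ r x) ∂μ := fun s => by
    rw [intOp_apply, ← ContinuousLinearMap.comp_apply (c.coeffOp μ (φ s)),
      ← ContinuousLinearMap.integral_comp_comm _ (cB.integrable_integrand μ ψ x)]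
    refine Eq.trans (integral_congr_ae (.of_forall fun r => ?_)) (integral_mul_left_eq_self
      (fun r => cB.coeffOp μ ((Φ (φ s)).fst (β s (ψ (s⁻¹ * r)))) (transOp B μ r x)) s)
    simp only [ContinuousLinearMap.comp_apply, transOp_coeffOp, inv_mul_cancel_left]
    rw [coeffOp_coeffOp c μ cB, ← transOp_mul]
  rw [intOp_apply]
  simp only [e1]
  rw [integral_integral_swap_of_hasCompactSupport (f := fun s r =>
    cB.coeffOp μ ((Φ (φ s)).fst (β s (ψ (s⁻¹ * r)))) (transOp B μ r x)) ?_ ?_]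
  · rw [intOp_apply]
    refine integral_congr_ae (.of_forall fun r => ?_)
    have h := ((cB.coeffOp μ).flip (transOp B μ r x)).integral_comp_comm
      (c.integrable_conv_integrand μ φ ψ r)
    exact h
  · exact ((cB.coeffOp μ).continuous.comp (c.continuous_conv_integrand φ ψ)).clm_apply
      ((continuous_transOp μ x).comp continuous_snd)
  · refine (c.hasCompactSupport_conv_integrand φ ψ).mono fun p hp h => hp ?_
    have h' : (Φ (φ p.1)).fst (β p.1 (ψ (p.1⁻¹ * p.2))) = 0 := h
    change cB.coeffOp μ ((Φ (φ p.1)).fst (β p.1 (ψ (p.1⁻¹ * p.2)))) (transOp B μ p.2 x) = 0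
    rw [h', map_zero, zero_apply]

variable [μ.Regular]

theorem lamOp_mul_lamOp (cB : IsCovariant β β (toMult B)) (φ : C_c(G, A)) (ψ : C_c(G, B)) :
    c.lamOp μ φ * cB.lamOp μ ψ = cB.lamOp μ (c.convCc μ φ ψ) :=
  Subtype.ext (ContinuousLinearMap.ext fun x => c.intOp_intOp μ cB φ ψ x)

/-- `(a ψ)(t) = Φ(a) ψ(t)` -/
noncomputable def mulCc (Φ : A →⋆ₙₐ[ℂ] 𝓜(ℂ, B)) (a : A) (ψ : C_c(G, B)) : C_c(G, B) where
  toFun t := (Φ a).fst (ψ t)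
  continuous_toFun := (Φ a).fst.continuous.comp ψ.continuous
  hasCompactSupport' := ψ.hasCompactSupport.comp_left (map_zero (Φ a).fst)

theorem mulCc_apply (a : A) (ψ : C_c(G, B)) (t : G) : mulCc Φ a ψ t = (Φ a).fst (ψ t) := rfl

theorem coeffAdj_mul_lamOp (cB : IsCovariant β β (toMult B)) (a : A) (ψ : C_c(G, B)) :
    c.coeffAdj μ a * cB.lamOp μ ψ = cB.lamOp μ (mulCc Φ a ψ) := by
  refine Subtype.ext (ContinuousLinearMap.ext fun x => ?_)
  change c.coeffOp μ a (cB.intOp μ ψ x) = cB.intOp μ (mulCc Φ a ψ) x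
  rw [intOp_apply, intOp_apply,
    ← ContinuousLinearMap.integral_comp_comm _ (cB.integrable_integrand μ ψ x)]
  simp only [coeffOp_coeffOp c μ cB, mulCc_apply]

end IsCovariant

/-! ### Laurent operators and the reduced crossed product -/

section laurent

variable (hβ : ∀ b, Continuous fun t => β t b) (μ : Measure G) [μ.IsHaarMeasure] [μ.Regular]

/-- the Laurent operator with symbol `φ ∈ C_c(G, B)` -/
noncomputable def laurentOp (φ : C_c(G, B)) : Adjointable B (L2 B μ) :=
  (IsCovariant.self hβ).lamOp μ φ

theorem isLaurent_unique {φ : G → B} {P Q : Adjointable B (L2 B μ)} (hP : IsLaurent β μ φ P)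
    (hQ : IsLaurent β μ φ Q) : P = Q :=
  Subtype.ext (clm_ext_toL2 fun g => ext_toL2 fun h => by rw [hP g h, hQ g h])

theorem isLaurent_laurentOp (φ : C_c(G, B)) : IsLaurent β μ φ (laurentOp hβ μ φ) := fun g h => by
  change innerProd B (toL2 μ h) ((IsCovariant.self hβ).intOp μ φ (toL2 μ g)) = _
  rw [IsCovariant.intOp_toL2, innerProd_toL2]
  rfl

theorem isLaurent_iff {φ : C_c(G, B)} {P : Adjointable B (L2 B μ)} :
    IsLaurent β μ φ P ↔ P = laurentOp hβ μ φ :=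
  ⟨fun h => isLaurent_unique μ h (isLaurent_laurentOp hβ μ φ),
    fun h => h ▸ isLaurent_laurentOp hβ μ φ⟩

theorem norm_laurentOp_le (φ : C_c(G, B)) : ‖laurentOp hβ μ φ‖ ≤ ∫ s, ‖φ s‖ ∂μ :=
  (IsCovariant.self hβ).norm_lamOp_le μ φ

theorem star_laurentOp (φ : C_c(G, B)) : star (laurentOp hβ μ φ) = laurentOp hβ μ (starCc hβ φ) :=
  (IsCovariant.self hβ).star_lamOp μ φ

theorem laurentOp_mul (φ ψ : C_c(G, B)) : laurentOp hβ μ φ * laurentOp hβ μ ψ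
    = laurentOp hβ μ ((IsCovariant.self hβ).convCc μ φ ψ) :=
  (IsCovariant.self hβ).lamOp_mul_lamOp μ (IsCovariant.self hβ) φ ψ

theorem laurentOp_mem (φ : C_c(G, B)) : laurentOp hβ μ φ ∈ crossedProduct β μ :=
  NonUnitalStarSubalgebra.le_topologicalClosure _
    (NonUnitalStarAlgebra.subset_adjoin ℂ _ ⟨φ, isLaurent_laurentOp hβ μ φ⟩)

/-- The Laurent operators with symbol in `C_c(G, B)` are dense in the reduced crossed product. -/
theorem mem_crossedProduct_iff {P : Adjointable B (L2 B μ)} :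
    P ∈ crossedProduct β μ ↔ P ∈ closure (Set.range (laurentOp hβ μ)) := by
  -- The operators λ_φ are already closed under sums, products and adjoints, so the *-algebra which
  -- they generate contains nothing else.
  let L : NonUnitalStarSubalgebra ℂ (Adjointable B (L2 B μ)) :=
    { carrier := Set.range (laurentOp hβ μ)
      add_mem' := by
        rintro _ _ ⟨φ, rfl⟩ ⟨ψ, rfl⟩
        exact ⟨φ + ψ, (IsCovariant.self hβ).lamOp_add μ φ ψ⟩
      zero_mem' := ⟨0, ((IsCovariant.self hβ).lamL μ).map_zero⟩
      mul_mem' := by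
        rintro _ _ ⟨φ, rfl⟩ ⟨ψ, rfl⟩
        exact ⟨_, (laurentOp_mul hβ μ φ ψ).symm⟩
      smul_mem' := by
        rintro z _ ⟨φ, rfl⟩
        exact ⟨z • φ, (IsCovariant.self hβ).lamOp_smul μ z φ⟩
      star_mem' := by
        rintro _ ⟨φ, rfl⟩
        exact ⟨_, (star_laurentOp hβ μ φ).symm⟩ }
  have e : NonUnitalStarAlgebra.adjoin ℂ
      {P : Adjointable B (L2 B μ) | ∃ φ : C_c(G, B), IsLaurent β μ φ P} = L := by
    refine le_antisymm (NonUnitalStarAlgebra.adjoin_le ?_) ?_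
    · rintro P ⟨φ, hφ⟩
      exact ⟨φ, ((isLaurent_iff hβ μ).1 hφ).symm⟩
    · rintro _ ⟨φ, rfl⟩
      exact NonUnitalStarAlgebra.subset_adjoin ℂ _ ⟨φ, isLaurent_laurentOp hβ μ φ⟩
  rw [crossedProduct, e]
  exact Iff.rfl

theorem crossedProduct_induction {p : Adjointable B (L2 B μ) → Prop} (hp : IsClosed {P | p P})
    (h : ∀ φ : C_c(G, B), p (laurentOp hβ μ φ)) {P : Adjointable B (L2 B μ)}
    (hP : P ∈ crossedProduct β μ) : p P :=
  closure_minimal (Set.range_subset_iff.2 h) hp ((mem_crossedProduct_iff hβ μ).1 hP)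

theorem norm_laurentOp_le_of_bound {K : Set G} (hK : IsCompact K) {φ : C_c(G, B)}
    (hφ : ∀ t ∉ K, φ t = 0) {ε : ℝ} (h : ∀ t, ‖φ t‖ ≤ ε) :
    ‖laurentOp hβ μ φ‖ ≤ μ.real K * ε := by
  refine (norm_laurentOp_le hβ μ φ).trans ?_
  rw [← setIntegral_eq_integral_of_forall_compl_eq_zero (s := K) fun t ht => by simp [hφ t ht]]
  have : IsFiniteMeasure (μ.restrict K) := ⟨by simpa using hK.measure_lt_top⟩
  calc ∫ t in K, ‖φ t‖ ∂μ ≤ ∫ t in K, ε ∂μ :=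
        integral_mono_of_nonneg (.of_forall fun t => norm_nonneg _) (integrable_const _)
          (.of_forall h)
    _ = _ := by simp

/-- A closed subspace which contains `λ_ψ` for all `ψ = h ⊗ b` with `b` in a total subset
of `B` contains all `λ_ψ`, `ψ ∈ C_c(G, B)`. -/
theorem laurentOp_mem_of_smulCc {N : Submodule ℂ (Adjointable B (L2 B μ))}
    (hN : IsClosed (N : Set (Adjointable B (L2 B μ)))) {S : Set B}
    (hS : Dense (Submodule.span ℂ S : Set B))
    (h : ∀ (f : C_c(G, ℝ)), ∀ b ∈ S, laurentOp hβ μ (smulCc f b) ∈ N) (ψ : C_c(G, B)) :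
    laurentOp hβ μ ψ ∈ N := by
  obtain ⟨K, hK, hf, happ⟩ := exists_approx_smulCc hS ψ
  refine hN.closure_subset (Metric.mem_closure_iff.2 fun ε hε => ?_)
  obtain ⟨g, hg, hgK, hfg⟩ := happ (ε / (μ.real K + 1)) (by positivity)
  refine ⟨laurentOp hβ μ g, ?_, ?_⟩
  · have hle : Submodule.span ℂ {g : C_c(G, B) | ∃ h : C_c(G, ℝ), ∃ b ∈ S, g = smulCc h b} ≤
        Submodule.comap ((IsCovariant.self hβ).lamL μ) N :=
      Submodule.span_le.2 fun g ⟨f, b, hb, e⟩ => by rw [e]; exact h f b hb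
    exact hle hg
  · have e : laurentOp hβ μ ψ - laurentOp hβ μ g = laurentOp hβ μ (ψ - g) :=
      (((IsCovariant.self hβ).lamL μ).map_sub ψ g).symm
    rw [dist_eq_norm, e]
    refine (norm_laurentOp_le_of_bound hβ μ hK (fun t ht => ?_) hfg).trans_lt ?_
    · change ψ t - g t = 0
      rw [hf t ht, hgK t ht, sub_zero]
    · rw [mul_div_assoc', div_lt_iff₀ (by positivity)]
      nlinarith [measureReal_nonneg (μ := μ) (s := K)]

end laurent

end

section

variable {G : Type*} [TopologicalSpace G] [Group G] [IsTopologicalGroup G]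
  [LocallyCompactSpace G] [T2Space G] [MeasurableSpace G] [BorelSpace G]
  {A : Type*} [NonUnitalCStarAlgebra A] {B : Type*} [NonUnitalCStarAlgebra B]
  {α : G →* (A ≃⋆ₐ[ℂ] A)} {β : G →* (B ≃⋆ₐ[ℂ] B)} {Φ : A →⋆ₙₐ[ℂ] 𝓜(ℂ, B)}

/-! ### The identification L²(G, A) ⊗_Φ B = L²(G, B) -/

section tensor

/-- `(f, b) ↦ Φ(f(·)) b` -/
noncomputable def tensorCc (Φ : A →⋆ₙₐ[ℂ] 𝓜(ℂ, B)) (b : B) : C_c(G, A) →ₗ[ℂ] C_c(G, B) where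
  toFun f :=
    { toFun := fun t => (Φ (f t)).fst b
      continuous_toFun := continuous_multiplier_apply Φ f.continuous continuous_const
      hasCompactSupport' := f.hasCompactSupport.mono fun t ht h => ht (by simp [h]) }
  map_add' f g := by ext t; simp
  map_smul' z f := by ext t; simp

theorem tensorCc_apply (b : B) (f : C_c(G, A)) (t : G) : tensorCc Φ b f t = (Φ (f t)).fst b := rfl

variable (Φ) (μ : Measure G) [IsFiniteMeasureOnCompacts μ]

theorem innerProd_tensorCc (b d : B) (f g : C_c(G, A)) :
    innerProd B (toL2 μ (tensorCc Φ b f)) (toL2 μ (tensorCc Φ d g))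
      = star b * (Φ (innerProd A (toL2 μ f) (toL2 μ g))).fst d := by
  let l : A →L[ℂ] B := (ContinuousLinearMap.mul ℂ B (star b)).comp ((multL Φ).flip d)
  have h := l.integral_comp_comm (integrable_star_mul μ f g)
  rw [innerProd_toL2, innerProd_toL2]
  refine Eq.trans (integral_congr_ae (.of_forall fun t => ?_)) h
  change star ((Φ (f t)).fst b) * (Φ (g t)).fst d = star b * (Φ (star (f t) * g t)).fst d
  rw [IsCovariant.star_mult_apply_mul, map_mul, DoubleCentralizer.mul_fst]
  rfl

theorem norm_tensorCc_le (b : B) (f : C_c(G, A)) :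
    ‖toL2 μ (tensorCc Φ b f)‖ ≤ ‖b‖ * ‖toL2 μ f‖ := by
  rw [← abs_of_nonneg (norm_nonneg (toL2 μ (tensorCc Φ b f))),
    ← abs_of_nonneg (a := ‖b‖ * _) (by positivity), ← sq_le_sq, mul_pow,
    norm_sq_eq_innerProd B, norm_sq_eq_innerProd A (toL2 μ f), innerProd_tensorCc]
  refine (norm_mul_le _ _).trans ?_
  rw [norm_star, sq, mul_assoc]
  refine mul_le_mul_of_nonneg_left ?_ (norm_nonneg b)
  rw [mul_comm]
  exact norm_multiplier_apply_le Φ _ b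

/-- the canonical map `L²(G, A) × B → L²(G, B)` which identifies `L²(G, A) ⊗_Φ B` with
`L²(G, B)` -/
noncomputable def tensorL2 : L2 A μ →ₗ[ℂ] B →ₗ[ℂ] L2 B μ :=
  have h : ∀ (b : B) (f : C_c(G, A)), extendL2 μ ((toL2 μ).comp (tensorCc Φ b)) (toL2 μ f)
      = toL2 μ (tensorCc Φ b f) := fun b f =>
    extendL2_toL2 (f := (toL2 μ).comp (tensorCc Φ b)) (fun f => norm_tensorCc_le Φ μ b f) f
  LinearMap.flip
    { toFun := fun b => (extendL2 μ ((toL2 μ).comp (tensorCc Φ b))).toLinearMap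
      map_add' := fun b b' => by
        rw [← ContinuousLinearMap.toLinearMap_add]
        refine congrArg _ (clm_ext_toL2 fun f => ?_)
        rw [add_apply, h, h, h, ← map_add]
        refine congrArg (toL2 μ) ?_
        ext t
        simp [tensorCc_apply]
      map_smul' := fun z b => by
        rw [RingHom.id_apply, ← ContinuousLinearMap.toLinearMap_smul]
        refine congrArg _ (clm_ext_toL2 fun f => ?_)
        rw [smul_apply, h, h, ← map_smul]
        refine congrArg (toL2 μ) ?_
        ext t
        simp [tensorCc_apply] }

/-- the operator `x ↦ x ⊗ b` from `L²(G, A)` to `L²(G, B)` -/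
noncomputable def tensorOp (b : B) : L2 A μ →L[ℂ] L2 B μ :=
  extendL2 μ ((toL2 μ).comp (tensorCc Φ b))

theorem tensorL2_apply (x : L2 A μ) (b : B) : tensorL2 Φ μ x b = tensorOp Φ μ b x := rfl

theorem tensorOp_toL2 (b : B) (f : C_c(G, A)) :
    tensorOp Φ μ b (toL2 μ f) = toL2 μ (tensorCc Φ b f) :=
  extendL2_toL2 (f := (toL2 μ).comp (tensorCc Φ b)) (fun f => norm_tensorCc_le Φ μ b f) f

theorem isInduced_tensorL2 (hΦ : IsNondegenerate Φ) : IsInduced Φ (tensorL2 Φ μ) where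
  innerProd_apply x y b d := by
    simp only [tensorL2_apply]
    refine denseRange_toL2.induction_on₂ (p := fun x y =>
      innerProd B (tensorOp Φ μ b x) (tensorOp Φ μ d y)
        = star b * (Φ (innerProd A x y)).fst d) ?_ ?_ x y
    · refine isClosed_eq ((continuous_innerProd B (L2 B μ)).comp
        (f := fun p : L2 A μ × L2 A μ => (tensorOp Φ μ b p.1, tensorOp Φ μ d p.2)) (by fun_prop)) ?_
      exact continuous_const.mul (continuous_multiplier_apply Φ (continuous_innerProd A (L2 A μ))
        continuous_const)
    · intro f g
      rw [tensorOp_toL2, tensorOp_toL2, innerProd_tensorCc]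
  dense := by
    -- The total elements h ⊗ Φ(a)b of L²(G, B) are the tensors (h ⊗ a) ⊗ b.
    refine (dense_span_smulCc μ B hΦ).mono (Submodule.span_mono ?_)
    rintro _ ⟨h, _, ⟨a, b, rfl⟩, rfl⟩
    refine ⟨toL2 μ (smulCc h a), b, ?_⟩
    rw [tensorL2_apply, tensorOp_toL2]
    refine congrArg (toL2 μ) ?_
    ext t
    simp only [smulCc_apply, tensorCc_apply]
    rw [← Complex.coe_smul, ← Complex.coe_smul, map_smul]
    rfl

end tensor

/-! ### Inflation of operators from L²(G, A) to L²(G, B), and totality of Λ_φ λ_ψ -/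

namespace IsCovariant

variable (c : IsCovariant α β Φ) (μ : Measure G) [μ.IsHaarMeasure]

theorem tensorOp_transOp (b : B) (s : G) (x : L2 A μ) :
    tensorOp Φ μ b (transOp A μ s x) = transOp B μ s (tensorOp Φ μ b x) := by
  have : (tensorOp Φ μ b).comp (transOp A μ s) = (transOp B μ s).comp (tensorOp Φ μ b) :=
    clm_ext_toL2 fun f => by
      rw [ContinuousLinearMap.comp_apply, ContinuousLinearMap.comp_apply, transOp_toL2,
        tensorOp_toL2, tensorOp_toL2, transOp_toL2]
      rfl
  exact congrArg (fun T => T x) this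

theorem tensorOp_coeffOp (cA : IsCovariant α α (toMult A)) (b : B) (a : A) (x : L2 A μ) :
    tensorOp Φ μ b (cA.coeffOp μ a x) = c.coeffOp μ a (tensorOp Φ μ b x) := by
  have : (tensorOp Φ μ b).comp (cA.coeffOp μ a) = (c.coeffOp μ a).comp (tensorOp Φ μ b) :=
    clm_ext_toL2 fun f => by
      rw [ContinuousLinearMap.comp_apply, ContinuousLinearMap.comp_apply, coeffOp_toL2,
        tensorOp_toL2, tensorOp_toL2, coeffOp_toL2]
      refine congrArg (toL2 μ) ?_
      ext t
      simp only [tensorCc_apply, coeffCc_apply, toMult_fst]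
      rw [map_mul, DoubleCentralizer.mul_fst]
      rfl
  exact congrArg (fun T => T x) this

theorem tensorOp_intOp (cA : IsCovariant α α (toMult A)) (b : B) (φ : C_c(G, A)) (x : L2 A μ) :
    tensorOp Φ μ b (cA.intOp μ φ x) = c.intOp μ φ (tensorOp Φ μ b x) := by
  rw [intOp_apply, intOp_apply,
    ← ContinuousLinearMap.integral_comp_comm _ (cA.integrable_integrand μ φ x)]
  simp only [c.tensorOp_coeffOp μ cA, tensorOp_transOp]

variable [μ.Regular] (hΦ : IsNondegenerate Φ)

/-- the *-homomorphism `L(L²(G, A)) → L(L²(G, B))`, `P ↦ P ⊗_Φ 1` -/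
noncomputable def inflate (μ : Measure G) [IsFiniteMeasureOnCompacts μ] (hΦ : IsNondegenerate Φ) :
    Adjointable A (L2 A μ) →⋆ₙₐ[ℂ] Adjointable B (L2 B μ) :=
  (isInduced_tensorL2 Φ μ hΦ).map

theorem continuous_inflate : Continuous (inflate (Φ := Φ) μ hΦ) :=
  AddMonoidHomClass.continuous_of_bound (inflate (Φ := Φ) μ hΦ) 1 fun P => by
    rw [one_mul]
    exact NonUnitalStarAlgHom.norm_apply_le (inflate (Φ := Φ) μ hΦ) P

/-- The maps x ↦ x ⊗ b intertwine the covariant pairs on L²(G, A) and L²(G, B), hence their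
integrated forms; tensors are total. -/
theorem inflate_laurentOp (φ : C_c(G, A)) :
    inflate μ hΦ (laurentOp c.continuous_left μ φ) = c.lamOp μ φ :=
  Subtype.ext ((isInduced_tensorL2 Φ μ hΦ).ext fun x b =>
    ((isInduced_tensorL2 Φ μ hΦ).map_apply (laurentOp c.continuous_left μ φ) x b).trans
      (c.tensorOp_intOp μ (IsCovariant.self c.continuous_left) b φ x))

include c in
-- By continuity in P and Q it suffices that Λ_φ λ_ψ = λ_{φ*ψ}. This is what lets inflated operators
-- act as multipliers of B ⋊ G.
theorem inflate_mul_mem {P : Adjointable A (L2 A μ)} (hP : P ∈ crossedProduct α μ)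
    {Q : Adjointable B (L2 B μ)} (hQ : Q ∈ crossedProduct β μ) :
    inflate μ hΦ P * Q ∈ crossedProduct β μ := by
  have hcl : IsClosed (crossedProduct β μ : Set (Adjointable B (L2 B μ))) :=
    isClosed_crossedProduct β μ
  refine crossedProduct_induction c.continuous_left μ
    (p := fun P => inflate μ hΦ P * Q ∈ crossedProduct β μ)
    (hcl.preimage ((continuous_inflate μ hΦ).mul continuous_const)) (fun φ => ?_) hP
  refine crossedProduct_induction c.continuous_right μ
    (p := fun Q => inflate μ hΦ (laurentOp c.continuous_left μ φ) * Q ∈ crossedProduct β μ)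
    (hcl.preimage (continuous_const.mul continuous_id)) (fun ψ => ?_) hQ
  rw [c.inflate_laurentOp]
  refine (c.lamOp_mul_lamOp μ (IsCovariant.self c.continuous_right) φ ψ) ▸ ?_
  exact laurentOp_mem c.continuous_right μ _

/-- `(s ψ)(t) = β_s(ψ(s⁻¹ t))` -/
noncomputable def shiftCc (hβ : ∀ b, Continuous fun t => β t b) (s : G) (ψ : C_c(G, B)) :
    C_c(G, B) where
  toFun t := β s (ψ (s⁻¹ * t))
  continuous_toFun := continuous_action hβ continuous_const
    (ψ.continuous.comp (continuous_const_mul s⁻¹))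
  hasCompactSupport' := (transCc B s ψ).hasCompactSupport.mono fun t ht h => ht (by
    have : ψ (s⁻¹ * t) = 0 := h
    simp [this])

theorem shiftCc_apply (hβ : ∀ b, Continuous fun t => β t b) (s : G) (ψ : C_c(G, B)) (t : G) :
    shiftCc hβ s ψ t = β s (ψ (s⁻¹ * t)) := rfl

theorem transOp_intOp (cB : IsCovariant β β (toMult B)) (s : G) (ψ : C_c(G, B)) (x : L2 B μ) :
    transOp B μ s (cB.intOp μ ψ x) = cB.intOp μ (shiftCc cB.continuous_left s ψ) x := by
  rw [intOp_apply, intOp_apply,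
    ← ContinuousLinearMap.integral_comp_comm _ (cB.integrable_integrand μ ψ x)]
  refine Eq.trans (integral_congr_ae (.of_forall fun r => ?_)) (integral_mul_left_eq_self
    (fun r => cB.coeffOp μ (shiftCc cB.continuous_left s ψ r) (transOp B μ r x)) s)
  simp only [transOp_coeffOp, shiftCc_apply, inv_mul_cancel_left, ← transOp_mul]

omit [μ.Regular] in
theorem tendsto_integral_shiftCc (hβ : ∀ b, Continuous fun t => β t b) (ψ : C_c(G, B)) :
    Filter.Tendsto (fun s => ∫ t, ‖shiftCc hβ s ψ t - ψ t‖ ∂μ) (nhds 1) (nhds 0) := by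
  obtain ⟨V, hV, h1⟩ := exists_compact_mem_nhds (1 : G)
  have hK : IsCompact (V * tsupport ψ) := hV.mul ψ.hasCompactSupport
  have hmem : ∀ s ∈ V, ∀ t ∉ V * tsupport ψ, ψ (s⁻¹ * t) = 0 := fun s hs t ht => by
    by_contra h
    exact ht ⟨s, hs, s⁻¹ * t, subset_tsupport _ h, by simp⟩
  have h2 : ContinuousOn (fun s => ∫ t, ‖shiftCc hβ s ψ t - ψ t‖ ∂μ) V := by
    refine continuousOn_integral_of_compact_support
      (f := fun s t => ‖shiftCc hβ s ψ t - ψ t‖) hK (Continuous.continuousOn ?_)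
      fun s t hs ht => ?_
    · refine Continuous.norm (Continuous.sub ?_ (ψ.continuous.comp continuous_snd))
      exact continuous_action hβ continuous_fst (ψ.continuous.comp (by fun_prop))
    · have e1 := hmem s hs t ht
      have e2 := hmem 1 (mem_of_mem_nhds h1) t ht
      rw [inv_one, one_mul] at e2
      simp [shiftCc_apply, e1, e2]
  have h3 := (h2.continuousAt h1).tendsto
  have h4 : ∫ t, ‖shiftCc hβ 1 ψ t - ψ t‖ ∂μ = 0 := by
    simp [shiftCc_apply]
  rwa [h4] at h3

omit [μ.Regular] in
theorem exists_bump {V : Set G} (hV : V ∈ nhds (1 : G)) :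
    ∃ h : C_c(G, ℝ), (∀ t, 0 ≤ h t) ∧ (∀ t ∉ V, h t = 0) ∧ ∫ t, h t ∂μ = 1 := by
  obtain ⟨f, h1, hc, hsub, h01⟩ := exists_continuousMap_one_of_isCompact_subset_isOpen
    (isCompact_singleton (x := (1 : G))) isOpen_interior
    (Set.singleton_subset_iff.2 (mem_interior_iff_mem_nhds.2 hV))
  have hf1 : f 1 = 1 := h1 rfl
  have hI : 0 < ∫ t, f t ∂μ := f.continuous.integral_pos_of_hasCompactSupport_nonneg_nonzero
    (x := 1) hc (fun t => (h01 t).1) (by rw [hf1]; exact one_ne_zero)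
  refine ⟨(∫ t, f t ∂μ)⁻¹ • ⟨f, hc⟩, fun t => ?_, fun t ht => ?_, ?_⟩
  · exact mul_nonneg (inv_nonneg.2 hI.le) (h01 t).1
  · change (∫ t, f t ∂μ)⁻¹ * f t = 0
    rw [image_eq_zero_of_notMem_tsupport fun h => ht (interior_subset (hsub h)), mul_zero]
  · change ∫ t, (∫ t, f t ∂μ)⁻¹ * f t ∂μ = 1
    rw [integral_const_mul, inv_mul_cancel₀ hI.ne']

include c in
-- One has Λ_{f⊗a} λ_ψ = ∫ f(s) M_a U_s λ_ψ ds, and U_s λ_ψ is the Laurent operator of the shift of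
-- ψ by s, which tends to ψ in L¹ as s → 1. A bump f of integral 1 near the identity therefore
-- brings Λ_{f⊗a} λ_ψ close to M_a λ_ψ in norm.
theorem coeffAdj_mul_laurentOp_mem {N : Submodule ℂ (Adjointable B (L2 B μ))}
    (hN : IsClosed (N : Set (Adjointable B (L2 B μ))))
    (h : ∀ φ ψ, c.lamOp μ φ * laurentOp c.continuous_right μ ψ ∈ N) (a : A) (ψ : C_c(G, B)) :
    c.coeffAdj μ a * laurentOp c.continuous_right μ ψ ∈ N := by
  have cB := IsCovariant.self c.continuous_right
  refine hN.closure_subset (Metric.mem_closure_iff.2 fun ε hε => ?_)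
  obtain ⟨f, f0, fV, f1⟩ := exists_bump μ ((tendsto_integral_shiftCc μ c.continuous_right ψ).eventually
    (gt_mem_nhds (show 0 < ε / (‖a‖ + 1) by positivity)))
  refine ⟨_, h (smulCc f a) ψ, ?_⟩
  have key : ‖c.coeffAdj μ a * laurentOp c.continuous_right μ ψ
      - c.lamOp μ (smulCc f a) * laurentOp c.continuous_right μ ψ‖ ≤ ‖a‖ * (ε / (‖a‖ + 1)) := by
    refine ContinuousLinearMap.opNorm_le_bound _ (by positivity) fun x => ?_
    change ‖c.coeffOp μ a (cB.intOp μ ψ x) - c.intOp μ (smulCc f a) (cB.intOp μ ψ x)‖ ≤ _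
    have fint : Integrable f μ := f.continuous.integrable_of_hasCompactSupport f.hasCompactSupport
    have e1 : c.coeffOp μ a (cB.intOp μ ψ x)
        = ∫ s, f s • c.coeffOp μ a (cB.intOp μ ψ x) ∂μ := by
      rw [integral_smul_const, f1, one_smul]
    have e2 : ∀ s, f s • c.coeffOp μ a (cB.intOp μ ψ x)
        - c.coeffOp μ (smulCc f a s) (transOp B μ s (cB.intOp μ ψ x))
        = f s • c.coeffOp μ a (cB.intOp μ (ψ - shiftCc c.continuous_right s ψ) x) := fun s => by
      have e3 : cB.intOp μ (ψ - shiftCc c.continuous_right s ψ)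
          = cB.intOp μ ψ - cB.intOp μ (shiftCc c.continuous_right s ψ) :=
        congrArg Subtype.val ((cB.lamL μ).map_sub ψ (shiftCc c.continuous_right s ψ))
      have e4 : c.coeffOp μ (smulCc f a s) = f s • c.coeffOp μ a := by
        rw [smulCc_apply, ← Complex.coe_smul, map_smul, Complex.coe_smul]
      rw [e3, e4, transOp_intOp, sub_apply, map_sub, smul_sub]
      rfl
    rw [e1, c.intOp_apply μ (smulCc f a), ← integral_sub (fint.smul_const _) (c.integrable_integrand μ _ _)]
    simp only [e2]
    refine (norm_integral_le_of_norm_le (g := fun s => f s * (‖a‖ * (ε / (‖a‖ + 1)) * ‖x‖))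
      (fint.mul_const _) (.of_forall fun s => ?_)).trans_eq ?_
    · rw [norm_smul, Real.norm_of_nonneg (f0 s)]
      by_cases hs : f s = 0
      · rw [hs, zero_mul, zero_mul]
      refine mul_le_mul_of_nonneg_left ?_ (f0 s)
      have hlt : ∫ t, ‖shiftCc c.continuous_right s ψ t - ψ t‖ ∂μ < ε / (‖a‖ + 1) := by
        by_contra hcon
        exact hs (fV s hcon)
      have h5 : ‖cB.intOp μ (ψ - shiftCc c.continuous_right s ψ)‖ ≤ ε / (‖a‖ + 1) := by
        refine (cB.norm_intOp_le μ _).trans (le_trans (le_of_eq ?_) hlt.le)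
        refine integral_congr_ae (.of_forall fun t => ?_)
        exact norm_sub_rev (ψ t) (shiftCc c.continuous_right s ψ t)
      calc _ ≤ ‖a‖ * ‖cB.intOp μ (ψ - shiftCc c.continuous_right s ψ) x‖ :=
            (c.coeffOp μ a).le_of_opNorm_le (c.norm_coeffOp_le μ a) _
        _ ≤ ‖a‖ * (ε / (‖a‖ + 1) * ‖x‖) := mul_le_mul_of_nonneg_left
            (ContinuousLinearMap.le_of_opNorm_le _ h5 x) (norm_nonneg a)
        _ = _ := by ring
    · rw [integral_mul_const, f1, one_mul]
  rw [dist_eq_norm]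
  refine key.trans_lt ?_
  rw [mul_div_assoc', div_lt_iff₀ (by positivity)]
  nlinarith

include c hΦ in
/-- A closed subspace which contains `Φ(a) λ_ψ` for all `a` and `ψ` contains all `λ_ψ`. -/
theorem laurentOp_mem_of_coeffAdj {N : Submodule ℂ (Adjointable B (L2 B μ))}
    (hN : IsClosed (N : Set (Adjointable B (L2 B μ))))
    (h : ∀ a ψ, c.coeffAdj μ a * laurentOp c.continuous_right μ ψ ∈ N) (ψ : C_c(G, B)) :
    laurentOp c.continuous_right μ ψ ∈ N := by
  refine laurentOp_mem_of_smulCc c.continuous_right μ hN hΦ (fun f b hb => ?_) ψ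
  obtain ⟨a, d, rfl⟩ := hb
  have e : c.coeffAdj μ a * laurentOp c.continuous_right μ (smulCc f d)
      = laurentOp c.continuous_right μ (mulCc Φ a (smulCc f d)) :=
    c.coeffAdj_mul_lamOp μ (IsCovariant.self c.continuous_right) a (smulCc f d)
  have e2 : mulCc Φ a (smulCc f d) = smulCc f ((Φ a).fst d) := by
    ext t
    simp only [mulCc_apply, smulCc_apply]
    rw [← Complex.coe_smul, ← Complex.coe_smul, map_smul]
  rw [e2] at e
  exact e ▸ h a (smulCc f d)

include c hΦ in
/-- A closed subspace which contains `Φ(φ) λ_ψ` for all `φ` and `ψ` contains all `λ_ψ`. -/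
theorem laurentOp_mem_of_lamOp {N : Submodule ℂ (Adjointable B (L2 B μ))}
    (hN : IsClosed (N : Set (Adjointable B (L2 B μ))))
    (h : ∀ φ ψ, c.lamOp μ φ * laurentOp c.continuous_right μ ψ ∈ N) (ψ : C_c(G, B)) :
    laurentOp c.continuous_right μ ψ ∈ N :=
  c.laurentOp_mem_of_coeffAdj μ hΦ hN (fun a ψ => c.coeffAdj_mul_laurentOp_mem μ hN h a ψ) ψ

end IsCovariant

end

/-! ### The homomorphism Φ ⋊ G -/

section

variable {G : Type*} [TopologicalSpace G] [Group G] [IsTopologicalGroup G]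
  [LocallyCompactSpace G] [T2Space G] [MeasurableSpace G] [BorelSpace G]
  {A : Type*} [NonUnitalCStarAlgebra A] {B : Type*} [NonUnitalCStarAlgebra B]
  {α : G →* (A ≃⋆ₐ[ℂ] A)} {β : G →* (B ≃⋆ₐ[ℂ] B)} {Φ : A →⋆ₙₐ[ℂ] 𝓜(ℂ, B)}

/-- An approximate unit e satisfies eb → b. This allows the results for nondegenerate Φ to be
applied to B acting on itself. -/
theorem isNondegenerate_toMult (B : Type*) [NonUnitalCStarAlgebra B] :
    IsNondegenerate (toMult B) := by
  let _ := CStarAlgebra.spectralOrder B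
  let _ := CStarAlgebra.spectralOrderedRing B
  intro b
  have h := (CStarAlgebra.increasingApproximateUnit B).toIsApproximateUnit
  have := h.neBot
  refine mem_closure_of_tendsto (h.tendsto_mul_right b) (.of_forall fun e => ?_)
  exact Submodule.subset_span ⟨e, b, (toMult_fst e b).symm⟩

variable (hβ : ∀ b, Continuous fun t => β t b) (μ : Measure G) [μ.IsHaarMeasure] [μ.Regular]

/-- the inclusion of the reduced crossed product into the adjointable operators -/
noncomputable def CrossedProduct.opHom (β : G →* (B ≃⋆ₐ[ℂ] B)) (μ : Measure G)
    [IsFiniteMeasureOnCompacts μ] : CrossedProduct β μ →⋆ₙₐ[ℂ] Adjointable B (L2 B μ) :=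
  NonUnitalStarSubalgebraClass.subtype (crossedProduct β μ)

variable (β) in
/-- the inclusion of the reduced crossed product into the adjointable operators, as a linear map -/
noncomputable def CrossedProduct.opL : CrossedProduct β μ →ₗ[ℂ] Adjointable B (L2 B μ) where
  toFun P := P.op
  map_add' _ _ := rfl
  map_smul' _ _ := rfl

theorem CrossedProduct.op_injective : Function.Injective (op : CrossedProduct β μ → _) :=
  Subtype.val_injective

/-- the element of the reduced crossed product given by `φ ∈ C_c(G, B)` -/
noncomputable def laurentCP (φ : C_c(G, B)) : CrossedProduct β μ :=
  ⟨laurentOp hβ μ φ, laurentOp_mem hβ μ φ⟩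

theorem op_laurentCP (φ : C_c(G, B)) : (laurentCP hβ μ φ).op = laurentOp hβ μ φ := rfl

theorem denseRange_laurentCP : DenseRange (laurentCP hβ μ) := fun P => by
  have h := (mem_crossedProduct_iff hβ μ).1 P.2
  refine Metric.mem_closure_iff.2 fun ε hε => ?_
  obtain ⟨_, ⟨φ, rfl⟩, hφ⟩ := Metric.mem_closure_iff.1 h ε hε
  exact ⟨_, ⟨φ, rfl⟩, hφ⟩

/-- A closed subspace of the reduced crossed product is closed as a space of operators. -/
theorem isClosed_map_op {N : Submodule ℂ (CrossedProduct β μ)}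
    (hN : IsClosed (N : Set (CrossedProduct β μ))) :
    IsClosed ((N.map (CrossedProduct.opL β μ) : Submodule ℂ (Adjointable B (L2 B μ))) : Set (Adjointable B (L2 B μ))) :=
  (isClosed_crossedProduct β μ).isClosedEmbedding_subtypeVal.isClosedMap _ hN

namespace IsCovariant

variable (c : IsCovariant α β Φ) (hΦ : IsNondegenerate Φ)

include c hΦ in
/-- A subspace of the reduced crossed product whose closure contains `Φ(φ) λ_ψ` for
all `φ` and `ψ` is dense. -/
theorem dense_of_lamOp_mul_mem {N : Submodule ℂ (CrossedProduct β μ)}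
    (h : ∀ φ ψ, ∃ P ∈ N.topologicalClosure,
      P.op = c.lamOp μ φ * laurentOp c.continuous_right μ ψ) :
    Dense (N : Set (CrossedProduct β μ)) := by
  have h1 : ∀ ψ, laurentCP c.continuous_right μ ψ ∈ N.topologicalClosure := fun ψ => by
    -- The criterion concerns closed spaces of operators, so the closure of N is regarded inside
    -- L(L²(G, B)), where it remains closed.
    obtain ⟨P, hP, e⟩ := c.laurentOp_mem_of_lamOp μ hΦ
      (isClosed_map_op μ N.isClosed_topologicalClosure)
      (fun φ ψ => (h φ ψ).imp fun P hP => hP) ψ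
    have : P = laurentCP c.continuous_right μ ψ := CrossedProduct.op_injective μ e
    exact this ▸ hP
  rw [← dense_closure]
  exact (denseRange_laurentCP c.continuous_right μ).mono (Set.range_subset_iff.2 h1)

/-- the *-homomorphism `Φ ⋊ G : A ⋊ G → M(B ⋊ G)` -/
noncomputable def crossedHom (c : IsCovariant α β Φ) (hΦ : IsNondegenerate Φ) :
    CrossedProduct α μ →⋆ₙₐ[ℂ] 𝓜(ℂ, CrossedProduct β μ) :=
  multiplierHom (crossedProduct β μ)
    ((inflate (Φ := Φ) μ hΦ).comp (CrossedProduct.opHom α μ))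
    fun P _ hQ => c.inflate_mul_mem μ hΦ P.2 hQ

theorem op_crossedHom (P : CrossedProduct α μ) (Q : CrossedProduct β μ) :
    ((c.crossedHom μ hΦ P).fst Q).op = inflate μ hΦ P.op * Q.op := rfl

theorem isAssociated_crossedHom : IsAssociated Φ (c.crossedHom μ hΦ) := by
  intro φ ψ P Q hP hQ
  rw [isLaurent_iff c.continuous_left] at hP
  rw [isLaurent_iff c.continuous_right] at hQ
  rw [op_crossedHom, hP, hQ, c.inflate_laurentOp]
  have := isLaurent_laurentOp c.continuous_right μ (c.convCc μ φ ψ)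
  rw [laurentOp, ← c.lamOp_mul_lamOp μ (IsCovariant.self c.continuous_right)] at this
  exact this

/-- Both products are jointly continuous in (P, Q), and on the dense set of pairs (λ_φ, λ_ψ) the
condition prescribes the symbol of the product, which determines the operator. -/
theorem isAssociated_iff (Ψ : CrossedProduct α μ →⋆ₙₐ[ℂ] 𝓜(ℂ, CrossedProduct β μ)) :
    IsAssociated Φ Ψ ↔ Ψ = c.crossedHom μ hΦ := by
  refine ⟨fun h => ?_, fun h => h ▸ c.isAssociated_crossedHom μ hΦ⟩
  refine DFunLike.ext _ _ fun P => multiplier_ext fun Q => ?_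
  have hP := isLaurent_laurentOp c.continuous_left μ
  have hQ := isLaurent_laurentOp c.continuous_right μ
  refine ((denseRange_laurentCP c.continuous_left μ).prodMap
    (denseRange_laurentCP c.continuous_right μ)).induction
    (P := fun p : CrossedProduct α μ × CrossedProduct β μ =>
      (Ψ p.1).fst p.2 = (c.crossedHom μ hΦ p.1).fst p.2) ?_
    (isClosed_eq (continuous_multiplier_apply Ψ continuous_fst continuous_snd)
      (continuous_multiplier_apply _ continuous_fst continuous_snd)) (P, Q)
  rintro _ ⟨⟨φ, ψ⟩, rfl⟩
  refine CrossedProduct.op_injective μ (isLaurent_unique μ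
    (h φ ψ (laurentCP c.continuous_left μ φ) (laurentCP c.continuous_right μ ψ) (hP φ) (hQ ψ))
    (c.isAssociated_crossedHom μ hΦ φ ψ (laurentCP c.continuous_left μ φ)
      (laurentCP c.continuous_right μ ψ) (hP φ) (hQ ψ)))

theorem isNondegenerate_crossedHom : IsNondegenerate (c.crossedHom μ hΦ) := by
  refine c.dense_of_lamOp_mul_mem μ hΦ fun φ ψ => ?_
  refine ⟨(c.crossedHom μ hΦ (laurentCP c.continuous_left μ φ)).fst
    (laurentCP c.continuous_right μ ψ), Submodule.le_topologicalClosure _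
      (Submodule.subset_span ⟨_, _, rfl⟩), ?_⟩
  rw [op_crossedHom, op_laurentCP, op_laurentCP, c.inflate_laurentOp]

end IsCovariant

end

section

variable {G : Type*} [TopologicalSpace G] [Group G] [IsTopologicalGroup G]
  [LocallyCompactSpace G] [T2Space G] [MeasurableSpace G] [BorelSpace G]
  {A : Type*} [NonUnitalCStarAlgebra A] {B : Type*} [NonUnitalCStarAlgebra B]
  {α : G →* (A ≃⋆ₐ[ℂ] A)} {β : G →* (B ≃⋆ₐ[ℂ] B)} {Φ : A →⋆ₙₐ[ℂ] 𝓜(ℂ, B)}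

/-! ### Laurent operators with continuous integrable symbol -/

section integrableSymbol

variable (μ : Measure G) [μ.IsHaarMeasure] [μ.Regular]

theorem IsCovariant.integrable_integrand_of_integrable (c : IsCovariant α β Φ) {φ : G → A}
    (hφ : Continuous φ) (hi : Integrable φ μ) (x : L2 B μ) :
    Integrable (fun s => c.coeffOp μ (φ s) (transOp B μ s x)) μ :=
  integrable_apply_family hφ hi (T := fun s a => c.coeffOp μ a (transOp B μ s x)) (C := ‖x‖)
    (c.continuous_integrand μ continuous_snd continuous_fst x) fun s a =>
      (c.norm_integrand_le μ a s x).trans_eq (mul_comm _ _)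

/-- the integrated form `x ↦ ∫ φ(s) U_s x ds` of a continuous integrable function -/
noncomputable def IsCovariant.intOpOfIntegrable (c : IsCovariant α β Φ) {φ : G → A}
    (hφ : Continuous φ) (hi : Integrable φ μ) : L2 B μ →L[ℂ] L2 B μ :=
  LinearMap.mkContinuous
    { toFun := fun x => ∫ s, c.coeffOp μ (φ s) (transOp B μ s x) ∂μ
      map_add' := fun x y => by
        rw [← integral_add (c.integrable_integrand_of_integrable μ hφ hi x)
          (c.integrable_integrand_of_integrable μ hφ hi y)]
        simp only [map_add]
      map_smul' := fun z x => by
        rw [RingHom.id_apply, ← integral_smul]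
        simp only [map_smul] } (∫ s, ‖φ s‖ ∂μ)
    fun x => by
      rw [← integral_mul_const]
      exact norm_integral_le_of_norm_le (hi.norm.mul_const _)
        (.of_forall fun s => c.norm_integrand_le μ _ s x)

theorem IsCovariant.norm_intOpOfIntegrable_sub_le (c : IsCovariant α β Φ) {φ : G → A}
    (hφ : Continuous φ) (hi : Integrable φ μ) (ψ : C_c(G, A)) :
    ‖c.intOpOfIntegrable μ hφ hi - c.intOp μ ψ‖ ≤ ∫ s, ‖ψ s - φ s‖ ∂μ := by
  have hψ : Integrable ψ μ := ψ.continuous.integrable_of_hasCompactSupport ψ.hasCompactSupport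
  refine ContinuousLinearMap.opNorm_le_bound _ (integral_nonneg fun s => norm_nonneg _) fun x => ?_
  have e : (c.intOpOfIntegrable μ hφ hi - c.intOp μ ψ) x
      = ∫ s, c.coeffOp μ (φ s - ψ s) (transOp B μ s x) ∂μ := by
    rw [sub_apply, c.intOp_apply μ ψ]
    refine (integral_sub (c.integrable_integrand_of_integrable μ hφ hi x)
      (c.integrable_integrand μ ψ x)).symm.trans (integral_congr_ae (.of_forall fun s => ?_))
    simp only [map_sub, sub_apply]
  rw [e, ← integral_mul_const]
  refine norm_integral_le_of_norm_le ((hψ.sub hi).norm.mul_const _) (.of_forall fun s => ?_)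
  rw [← norm_sub_rev (φ s)]
  exact c.norm_integrand_le μ _ s x

/-- Fubini applies although φ need not have compact support: h confines t, and then g confines s to
the compact set supp h · (supp g)⁻¹. -/
theorem innerProd_intOpOfIntegrable (hβ : ∀ b, Continuous fun t => β t b) {φ : G → B}
    (hφ : Continuous φ) (hi : Integrable φ μ) (g h : C_c(G, B)) :
    innerProd B (toL2 μ h) ((IsCovariant.self hβ).intOpOfIntegrable μ hφ hi (toL2 μ g))
      = ∫ t, star (h t) * ∫ s, β t⁻¹ (φ s) * g (s⁻¹ * t) ∂μ ∂μ := by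
  have c := IsCovariant.self hβ
  have hF : Continuous fun p : G × G => β p.2⁻¹ (φ p.1) * g (p.1⁻¹ * p.2) :=
    (continuous_action hβ (by fun_prop) (by fun_prop)).mul (g.continuous.comp (by fun_prop))
  refine (innerProd_integral _ (c.integrable_integrand_of_integrable μ hφ hi (toL2 μ g))).trans ?_
  have e : ∀ s, innerProd B (toL2 μ h) (c.coeffOp μ (φ s) (transOp B μ s (toL2 μ g)))
      = ∫ t, star (h t) * (β t⁻¹ (φ s) * g (s⁻¹ * t)) ∂μ := fun s => by
    rw [transOp_toL2, IsCovariant.coeffOp_toL2, innerProd_toL2]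
    rfl
  simp only [e]
  rw [integral_integral_swap_of_hasCompactSupport
    (f := fun s t => star (h t) * (β t⁻¹ (φ s) * g (s⁻¹ * t)))]
  · refine integral_congr_ae (.of_forall fun t => ?_)
    refine integral_const_mul_of_integrable (Continuous.integrable_of_hasCompactSupport
      (hF.comp (Continuous.prodMk_left t)) ?_)
    refine HasCompactSupport.mul_left (f := fun s => β t⁻¹ (φ s)) (f' := fun s => g (s⁻¹ * t)) ?_
    exact g.hasCompactSupport.comp_homeomorph ((Homeomorph.inv G).trans (Homeomorph.mulRight t))
  · exact (continuous_star.comp (h.continuous.comp continuous_snd)).mul hF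
  · refine HasCompactSupport.intro ((h.hasCompactSupport.isCompact.mul
      g.hasCompactSupport.isCompact.inv).prod h.hasCompactSupport.isCompact) fun p hp => ?_
    by_contra hne
    have h1 : p.2 ∈ tsupport h := subset_tsupport _ fun e => hne (by
      change star (h p.2) * _ = 0
      rw [e, star_zero, zero_mul])
    have h2 : p.1⁻¹ * p.2 ∈ tsupport g := subset_tsupport _ fun e => hne (by
      change _ * (_ * g (p.1⁻¹ * p.2)) = 0
      rw [e, mul_zero, mul_zero])
    exact hp ⟨⟨p.2, h1, (p.1⁻¹ * p.2)⁻¹, Set.inv_mem_inv.2 h2, by simp⟩, h1⟩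

/-- A continuous integrable function defines an element of the reduced crossed product. -/
theorem exists_isLaurent (hβ : ∀ b, Continuous fun t => β t b) {φ : G → B}
    (hφ : Continuous φ) (hi : Integrable φ μ) :
    ∃ P ∈ crossedProduct β μ, IsLaurent β μ φ P := by
  have c := IsCovariant.self hβ
  -- The integrated form is not yet known to be adjointable; the limit of the cut-offs is taken
  -- among bounded operators, where the crossed product is closed, being complete.
  have hcl : IsClosed (Set.range fun P : CrossedProduct β μ => P.op.1) := by
    have h : Isometry fun P : CrossedProduct β μ => P.op.1 :=
      (isometry_subtype_coe (s := (Adjointable B (L2 B μ) : Set (L2 B μ →L[ℂ] L2 B μ)))).comp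
        (isometry_subtype_coe (s := (crossedProduct β μ : Set (Adjointable B (L2 B μ)))))
    exact h.isClosedEmbedding.isClosed_range
  obtain ⟨P, hP⟩ : c.intOpOfIntegrable μ hφ hi
      ∈ Set.range fun P : CrossedProduct β μ => P.op.1 := by
    refine hcl.closure_subset (Metric.mem_closure_iff.2 fun ε hε => ?_)
    obtain ⟨χ, hχ, hlt⟩ := exists_cutoff hφ hi (ENNReal.ofReal_pos.2 hε).ne'
    let ψ : C_c(G, B) := ⟨⟨fun t => χ t • φ t, χ.continuous.smul hφ⟩, hχ.smul_right⟩
    refine ⟨_, ⟨laurentCP hβ μ ψ, rfl⟩, ?_⟩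
    rw [dist_eq_norm]
    refine (c.norm_intOpOfIntegrable_sub_le μ hφ hi ψ).trans_lt ?_
    have hψ : Integrable ψ μ := ψ.continuous.integrable_of_hasCompactSupport ψ.hasCompactSupport
    have hn := integral_norm_eq_lintegral_enorm (hψ.sub hi).1
    refine hn.trans_lt ?_
    rw [eLpNorm_one_eq_lintegral_enorm] at hlt
    exact ENNReal.toReal_lt_of_lt_ofReal hlt
  exact ⟨P.op, P.2, fun g h => by
    rw [show P.op.1 = _ from hP]
    exact innerProd_intOpOfIntegrable μ hβ hφ hi g h⟩

end integrableSymbol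

/-! ### The operators |x⟩⟩ -/

section kets

/-- `S : L²(G, B) → B` is the operator `f ↦ ∫ Δ(t)^(-1/2) Φ(α_{t⁻¹}(x)) f(t) dt`. -/
def IsKetAlong (α : G →* (A ≃⋆ₐ[ℂ] A)) (Φ : A →⋆ₙₐ[ℂ] 𝓜(ℂ, B)) (μ : Measure G)
    [IsFiniteMeasureOnCompacts μ] (x : A) (S : L2 B μ →L[ℂ] B) : Prop :=
  ∀ f : C_c(G, B), S (toL2 μ f) = ∫ t, rootModular t • (Φ (α t⁻¹ x)).fst (f t) ∂μ

theorem IsKet.unique {μ : Measure G} [IsFiniteMeasureOnCompacts μ] {x : B}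
    {S T : L2 B μ →L[ℂ] B} (hS : IsKet β μ x S) (hT : IsKet β μ x T) : S = T :=
  clm_ext_toL2 fun f => by rw [hS, hT]

theorem continuous_ketAlong_integrand (hα : ∀ a, Continuous fun t => α t a) (x : A)
    (f : C_c(G, B)) : Continuous fun t => rootModular t • (Φ (α t⁻¹ x)).fst (f t) :=
  continuous_rootModular.smul
    (continuous_multiplier_apply Φ ((hα x).comp continuous_inv) f.continuous)

theorem hasCompactSupport_ketAlong_integrand (x : A) (f : C_c(G, B)) :
    HasCompactSupport fun t => rootModular t • (Φ (α t⁻¹ x)).fst (f t) :=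
  f.hasCompactSupport.mono fun t ht h => ht (by simp [h])

theorem integrable_ketAlong_integrand (μ : Measure G) [IsFiniteMeasureOnCompacts μ]
    (hα : ∀ a, Continuous fun t => α t a) (x : A) (f : C_c(G, B)) :
    Integrable (fun t => rootModular t • (Φ (α t⁻¹ x)).fst (f t)) μ :=
  (continuous_ketAlong_integrand hα x f).integrable_of_hasCompactSupport
    (hasCompactSupport_ketAlong_integrand x f)

variable (hβ : ∀ b, Continuous fun t => β t b) (μ : Measure G) [μ.IsHaarMeasure] [μ.Regular]

theorem integral_modular_inv_mul {f : G → B} (hf : Continuous f) (hc : HasCompactSupport f)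
    (t : G) : ∫ s, (modular (t⁻¹ * s))⁻¹ • f (s⁻¹ * t) ∂μ = ∫ s, f s ∂μ := by
  rw [← integral_modular_inv μ hf hc,
    ← integral_mul_left_eq_self (fun s => (modular s)⁻¹ • f s⁻¹) t⁻¹]
  simp only [mul_inv_rev, inv_inv]

include hβ in
-- The integrand is Δ(s)^(-1/2) β_{t⁻¹}(x)* β_{t⁻¹s}(y) g(s⁻¹t), and the substitution r = s⁻¹t
-- separates t from r. The exponent -1/2 is what makes this work: Δ(t⁻¹s)⁻¹ Δ(t)^(-1/2)
-- Δ(s⁻¹t)^(-1/2) = Δ(s)^(-1/2).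
theorem integral_bracket_mul (x y : B) (g : C_c(G, B)) (t : G) :
    ∫ s, β t⁻¹ (bracket β x y s) * g (s⁻¹ * t) ∂μ
      = rootModular t • (star (β t⁻¹ x) * ∫ r, rootModular r • (β r⁻¹ y * g r) ∂μ) := by
  have hi := integrable_ketAlong_integrand (Φ := toMult B) μ hβ y g
  have hc := hasCompactSupport_ketAlong_integrand (Φ := toMult B) (α := β) y g
  have hf := continuous_ketAlong_integrand (Φ := toMult B) hβ y g
  simp only [toMult_fst] at hi hc hf
  rw [← integral_const_mul_of_integrable hi, ← integral_smul,
    ← integral_modular_inv_mul μ (f := fun r => rootModular t • (star (β t⁻¹ x) *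
      (rootModular r • (β r⁻¹ y * g r)))) ((continuous_const.mul hf).const_smul _) ?_ t]
  · refine integral_congr_ae (.of_forall fun s => ?_)
    have e1 : (modular (t⁻¹ * s))⁻¹ * (rootModular t * rootModular (s⁻¹ * t)) = rootModular s := by
      have : rootModular (s⁻¹ * t) = (rootModular (t⁻¹ * s))⁻¹ := by
        rw [← rootModular_inv, mul_inv_rev, inv_inv]
      have h0 := (rootModular_pos (t⁻¹ * s)).ne'
      rw [modular_inv_eq, this, ← mul_assoc, mul_right_comm, mul_inv_cancel_right₀ h0,
        rootModular_mul, rootModular_inv, mul_right_comm, inv_mul_cancel₀ (rootModular_pos t).ne',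
        one_mul]
    simp only [mul_smul_comm, smul_smul, mul_inv_rev, inv_inv]
    rw [e1, bracket, ← Complex.coe_smul, map_smul, Complex.coe_smul, smul_mul_assoc, map_mul,
      map_star, ← action_mul, mul_assoc]
    rfl
  · exact hc.mono fun r hr h => hr (by
      have h' : rootModular r • (β r⁻¹ y * g r) = 0 := h
      simp only [h', mul_zero, smul_zero])

include hβ in
theorem star_ket_mul (x y : B) (g h : C_c(G, B)) :
    star (∫ t, rootModular t • (β t⁻¹ x * h t) ∂μ) * ∫ r, rootModular r • (β r⁻¹ y * g r) ∂μ
      = ∫ t, star (h t) * ∫ s, β t⁻¹ (bracket β x y s) * g (s⁻¹ * t) ∂μ ∂μ := by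
  have hi := integrable_ketAlong_integrand (Φ := toMult B) μ hβ x h
  simp only [toMult_fst] at hi
  have h1 := (starL' ℝ : B ≃L[ℝ] B).integral_comp_comm (μ := μ)
    (fun t => rootModular t • (β t⁻¹ x * h t))
  have h2 : Integrable (fun t => star (rootModular t • (β t⁻¹ x * h t))) μ :=
    (starL' ℝ : B ≃L[ℝ] B).integrable_comp_iff.2 hi
  have h3 : star (∫ t, rootModular t • (β t⁻¹ x * h t) ∂μ)
      = ∫ t, star (rootModular t • (β t⁻¹ x * h t)) ∂μ := h1.symm
  rw [h3, ← integral_mul_const_of_integrable h2]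
  refine integral_congr_ae (.of_forall fun t => ?_)
  simp only [integral_bracket_mul hβ μ x y g t, star_smul, star_mul, star_trivial, smul_mul_assoc,
    mul_smul_comm, mul_assoc]

include hβ in
/-- `|x⟩⟩* |y⟩⟩` is the Laurent operator with symbol `⟨⟨x, y⟩⟩`. -/
theorem isStarComp_iff_isLaurent {x y : B} {S T : L2 B μ →L[ℂ] B} (hS : IsKet β μ x S)
    (hT : IsKet β μ y T) {P : Adjointable B (L2 B μ)} :
    IsStarComp S T P ↔ IsLaurent β μ (bracket β x y) P := by
  refine ⟨fun h g k => ?_, fun h => ?_⟩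
  · rw [h, hS, hT]
    exact star_ket_mul hβ μ x y g k
  · intro v w
    refine denseRange_toL2.induction_on₂ (p := fun v w =>
      innerProd B v (P.1 w) = star (S v) * T w) ?_ (fun k g => ?_) v w
    · have hc := continuous_innerProd B (L2 B μ)
      exact isClosed_eq (hc.comp (f := fun p : L2 B μ × L2 B μ => (p.1, P.1 p.2)) (by fun_prop))
        (by fun_prop)
    · rw [h, hS, hT]
      exact (star_ket_mul hβ μ x y g k).symm

include hβ in
-- Boundedness comes from the Laurent operator P of ⟨⟨x, x⟩⟩: the square of the norm of |x⟩⟩k equals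
-- ‖⟨k, Pk⟩‖ ≤ ‖P‖‖k‖².
theorem exists_isKet {x : B} {P : Adjointable B (L2 B μ)}
    (hP : IsLaurent β μ (bracket β x x) P) : ∃ T, IsKet β μ x T := by
  have hi := integrable_ketAlong_integrand (Φ := toMult B) μ hβ x
  simp only [toMult_fst] at hi
  let f : C_c(G, B) →ₗ[ℂ] B :=
    { toFun := fun k => ∫ t, rootModular t • (β t⁻¹ x * k t) ∂μ
      map_add' := fun k l => by
        rw [← integral_add (hi k) (hi l)]
        simp only [CompactlySupportedContinuousMap.add_apply, mul_add, smul_add]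
      map_smul' := fun z k => by
        rw [RingHom.id_apply, ← integral_smul]
        simp only [CompactlySupportedContinuousMap.smul_apply, mul_smul_comm, smul_comm z] }
  refine ⟨extendL2 μ f, fun k => extendL2_toL2 (f := f) (C := √‖P‖) (fun k => ?_) k⟩
  rw [← abs_of_nonneg (norm_nonneg (f k)), ← abs_of_nonneg (a := √‖P‖ * _) (by positivity),
    ← sq_le_sq, mul_pow, Real.sq_sqrt (norm_nonneg _), sq ‖f k‖, ← CStarRing.norm_star_mul_self,
    show star (f k) * f k = innerProd B (toL2 μ k) (P.1 (toL2 μ k)) from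
      (star_ket_mul hβ μ x x k k).trans (hP k k).symm]
  refine (norm_innerProd_le _ _).trans ?_
  rw [sq, mul_left_comm]
  exact mul_le_mul_of_nonneg_left (P.1.le_opNorm _) (norm_nonneg _)

end kets

end

section

variable {G : Type*} [TopologicalSpace G] [Group G] [IsTopologicalGroup G]
  [LocallyCompactSpace G] [T2Space G] [MeasurableSpace G] [BorelSpace G]
  {A : Type*} [NonUnitalCStarAlgebra A] {B : Type*} [NonUnitalCStarAlgebra B]
  {α : G →* (A ≃⋆ₐ[ℂ] A)} {β : G →* (B ≃⋆ₐ[ℂ] B)} {Φ : A →⋆ₙₐ[ℂ] 𝓜(ℂ, B)}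

/-! ### Composition of |x⟩⟩ with λ_g and with multiplication operators -/

section conv

variable (hβ : ∀ b, Continuous fun t => β t b) (μ : Measure G) [μ.IsHaarMeasure] [μ.Regular]

include hβ in
/-- The pairing of `f` and `k` by `⟨f, k⟩ = ∫∫ Δ(t)^(-1/2) β_{t⁻¹}(f(s)) k(s⁻¹ t) ds dt` is
`|y⟩⟩ k` for `y = ∫ Δ(r)^(-1/2) β_r(f(r⁻¹)) dr`. -/
theorem integral_rootModular_conv (f k : C_c(G, B)) :
    ∫ t, rootModular t • ∫ s, β t⁻¹ (f s) * k (s⁻¹ * t) ∂μ ∂μ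
      = ∫ t, rootModular t • (β t⁻¹ (∫ r, rootModular r • β r (f r⁻¹) ∂μ) * k t) ∂μ := by
  have hcf : HasCompactSupport fun r => f r⁻¹ :=
    f.hasCompactSupport.comp_homeomorph (Homeomorph.inv G)
  have hKc : Continuous fun p : G × G =>
      rootModular (p.2 * p.1) • (β (p.1⁻¹ * p.2⁻¹) (f p.2) * k p.1) :=
    (continuous_rootModular.comp (by fun_prop)).smul ((continuous_action hβ (by fun_prop)
      (f.continuous.comp continuous_snd)).mul (k.continuous.comp continuous_fst))
  have hKs : HasCompactSupport fun p : G × G =>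
      rootModular (p.2 * p.1) • (β (p.1⁻¹ * p.2⁻¹) (f p.2) * k p.1) := by
    refine HasCompactSupport.intro
      (k.hasCompactSupport.isCompact.prod f.hasCompactSupport.isCompact) fun p hp => ?_
    by_contra hne
    exact hp ⟨subset_tsupport _ fun e => hne (by rw [e, mul_zero, smul_zero]),
      subset_tsupport _ fun e => hne (by rw [e, map_zero, zero_mul, smul_zero])⟩
  let H : C_c(G, B) := integralCc μ
    (fun t s => rootModular (s * t) • (β (t⁻¹ * s⁻¹) (f s) * k t)) hKc hKs
  have e1 : ∫ t, rootModular t • ∫ s, β t⁻¹ (f s) * k (s⁻¹ * t) ∂μ ∂μ = ∫ s, H s ∂μ := by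
    simp only [← integral_smul]
    rw [integral_integral_swap_of_hasCompactSupport
      (f := fun t s => rootModular t • (β t⁻¹ (f s) * k (s⁻¹ * t)))]
    · refine integral_congr_ae (.of_forall fun s => ?_)
      change ∫ t, rootModular t • (β t⁻¹ (f s) * k (s⁻¹ * t)) ∂μ = ∫ t, _ ∂μ
      rw [← integral_mul_left_eq_self _ s]
      simp only [inv_mul_cancel_left, mul_inv_rev]
    · exact (continuous_rootModular.comp continuous_fst).smul ((continuous_action hβ (by fun_prop)
        (f.continuous.comp continuous_snd)).mul (k.continuous.comp (by fun_prop)))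
    · have h := IsCovariant.hasCompactSupport_conv (φ := f) (g := k)
        (F := fun s t => rootModular t • (β t⁻¹ (f s) * k (s⁻¹ * t)))
        (fun s t h => by simp [h]) (fun s t h => by simp [h])
      exact h.comp_homeomorph (Homeomorph.prodComm G G)
  -- Inverting s brings in Δ(s)⁻¹ = (Δ(s)^(-1/2))². One factor cancels against Δ(s⁻¹)^(-1/2), and
  -- the other becomes the weight in y.
  have e4 : ∫ s, H s ∂μ = ∫ s, (modular s)⁻¹ • H s⁻¹ ∂μ :=
    (integral_modular_inv μ H.continuous H.hasCompactSupport).symm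
  rw [e1, e4]
  have e2 : ∀ s, (modular s)⁻¹ • H s⁻¹
      = ∫ t, rootModular s • rootModular t • (β (t⁻¹ * s) (f s⁻¹) * k t) ∂μ := fun s => by
    change (modular s)⁻¹ • ∫ t, rootModular (s⁻¹ * t) • (β (t⁻¹ * s⁻¹⁻¹) (f s⁻¹) * k t) ∂μ = _
    rw [← integral_smul]
    refine integral_congr_ae (.of_forall fun t => ?_)
    simp only [smul_smul, inv_inv]
    rw [modular_inv_eq, rootModular_mul, rootModular_inv, ← mul_assoc,
      mul_inv_cancel_right₀ (rootModular_pos s).ne']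
  simp only [e2]
  rw [integral_integral_swap_of_hasCompactSupport
    (f := fun s t => rootModular s • rootModular t • (β (t⁻¹ * s) (f s⁻¹) * k t))]
  · refine integral_congr_ae (.of_forall fun t => ?_)
    let b : B →L[ℂ] B :=
      { toFun := fun b => β t⁻¹ b
        map_add' := map_add (β t⁻¹)
        map_smul' := fun z b => map_smul (β t⁻¹) z b
        cont := continuous_action hβ continuous_const continuous_id }
    let l : B →L[ℂ] B := ((ContinuousLinearMap.mul ℂ B).flip (k t)).comp b
    have hi : Integrable (fun r => rootModular r • β r (f r⁻¹)) μ := by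
      refine Continuous.integrable_of_hasCompactSupport (continuous_rootModular.smul
        (continuous_action hβ continuous_id (f.continuous.comp continuous_inv)))
        (hcf.mono fun r hr h => hr ?_)
      have h' : f r⁻¹ = 0 := h
      simp [h']
    have h := l.integral_comp_comm hi
    have e3 : ∀ b, l b = β t⁻¹ b * k t := fun b => rfl
    simp only [e3] at h
    change _ = rootModular t • _
    rw [← h, ← integral_smul]
    refine integral_congr_ae (.of_forall fun s => ?_)
    simp only [action_mul, ← Complex.coe_smul, map_smul, smul_mul_assoc]
    exact smul_comm _ _ _
  · exact (continuous_rootModular.comp continuous_fst).smul ((continuous_rootModular.comp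
      continuous_snd).smul ((continuous_action hβ (by fun_prop) (f.continuous.comp
        (by fun_prop))).mul (k.continuous.comp continuous_snd)))
  · refine HasCompactSupport.intro
      (hcf.isCompact.prod k.hasCompactSupport.isCompact) fun p hp => ?_
    by_contra hne
    exact hp ⟨subset_tsupport (fun r => f r⁻¹) fun e => hne (by
        have e' : f p.1⁻¹ = 0 := e
        rw [Function.uncurry, e', map_zero, zero_mul, smul_zero, smul_zero]),
      subset_tsupport _ fun e => hne (by
        rw [Function.uncurry, e, mul_zero, smul_zero, smul_zero])⟩

/-- `|x⟩⟩ λ_g = |x * g⟩⟩` -/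
theorem IsKetAlong.comp_laurentOp (c : IsCovariant α β Φ) {x : A} {S : L2 B μ →L[ℂ] B}
    (hS : IsKetAlong α Φ μ x S) (g : C_c(G, B)) :
    IsKet β μ (multiplierConv β μ (Φ x) g) (S.comp (laurentOp c.continuous_right μ g).1) := by
  intro k
  have h1 : (laurentOp c.continuous_right μ g).1 (toL2 μ k)
      = toL2 μ ((IsCovariant.self c.continuous_right).laurentCc μ g k) :=
    IsCovariant.intOp_toL2 _ μ g k
  rw [ContinuousLinearMap.comp_apply, h1, hS]
  -- Equivariance turns Φ(α_{t⁻¹}(x)) β_{t⁻¹}(g(s)) into β_{t⁻¹}(Φ(x)g(s)), so the previous identity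
  -- applies to f = Φ(x)g.
  refine Eq.trans (integral_congr_ae (.of_forall fun t => ?_))
    (integral_rootModular_conv c.continuous_right μ (IsCovariant.mulCc Φ x g) k)
  have hi : Integrable (fun s => β t⁻¹ (g s) * k (s⁻¹ * t)) μ := by
    refine Continuous.integrable_of_hasCompactSupport
      ((continuous_action c.continuous_right continuous_const g.continuous).mul
        (k.continuous.comp (by fun_prop))) (g.hasCompactSupport.mono fun s hs h => hs ?_)
    simp [h]
  have h2 := (Φ (α t⁻¹ x)).fst.integral_comp_comm hi
  change rootModular t • (Φ (α t⁻¹ x)).fst (∫ s, β t⁻¹ (g s) * k (s⁻¹ * t) ∂μ) = _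
  rw [← h2]
  refine congrArg (rootModular t • ·) (integral_congr_ae (.of_forall fun s => ?_))
  change (Φ (α t⁻¹ x)).fst (β t⁻¹ (g s) * k (s⁻¹ * t)) = β t⁻¹ ((Φ x).fst (g s)) * k (s⁻¹ * t)
  rw [multiplier_mul, c.map_apply]

theorem IsKet.comp_laurentOp {x : B} {S : L2 B μ →L[ℂ] B} (hS : IsKet β μ x S) (g : C_c(G, B)) :
    IsKet β μ (elementConv β μ x g) (S.comp (laurentOp hβ μ g).1) :=
  IsKetAlong.comp_laurentOp (Φ := toMult B) μ (IsCovariant.self hβ) hS g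

/-- `|Φ(x) b⟩⟩` is the composition of the operator given by `x` with that of multiplication
by `b`. -/
theorem IsKetAlong.comp_coeffOp (c : IsCovariant α β Φ) {x : A} {S : L2 B μ →L[ℂ] B}
    (hS : IsKetAlong α Φ μ x S) (b : B) :
    IsKet β μ ((Φ x).fst b)
      (S.comp ((IsCovariant.self c.continuous_right).coeffAdj μ b).1) := by
  intro k
  have h1 : ((IsCovariant.self c.continuous_right).coeffAdj μ b).1 (toL2 μ k)
      = toL2 μ ((IsCovariant.self c.continuous_right).coeffCc b k) :=
    IsCovariant.coeffOp_toL2 _ μ b k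
  rw [ContinuousLinearMap.comp_apply, h1, hS]
  refine integral_congr_ae (.of_forall fun t => ?_)
  change rootModular t • (Φ (α t⁻¹ x)).fst (β t⁻¹ b * k t)
    = rootModular t • (β t⁻¹ ((Φ x).fst b) * k t)
  rw [multiplier_mul, c.map_apply]

include hβ in
theorem IsKet.add {x y : B} {S T : L2 B μ →L[ℂ] B} (hS : IsKet β μ x S) (hT : IsKet β μ y T) :
    IsKet β μ (x + y) (S + T) := fun k => by
  have hi := fun x => integrable_ketAlong_integrand (Φ := toMult B) μ hβ x k
  rw [add_apply, hS, hT]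
  refine (integral_add (hi x) (hi y)).symm.trans (integral_congr_ae (.of_forall fun t => ?_))
  simp only [toMult_fst, map_add, add_mul, smul_add]
  rfl

theorem IsKet.smul {x : B} {S : L2 B μ →L[ℂ] B} (z : ℂ) (hS : IsKet β μ x S) :
    IsKet β μ (z • x) (z • S) := fun k => by
  rw [smul_apply, hS, ← integral_smul]
  refine integral_congr_ae (.of_forall fun t => ?_)
  simp only [map_smul, smul_mul_assoc]
  exact smul_comm _ _ _

theorem isKet_zero : IsKet β μ (0 : B) 0 := fun k => by
  simp

end conv

/-! ### The Hilbert module F(R) -/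

section fixModule

variable {R : Submodule ℂ B} {μ : Measure G} [μ.IsHaarMeasure] [μ.Regular]
  (hβ : ∀ b, Continuous fun t => β t b) (hR : IsRieffelProper β μ R)

include hβ in
theorem continuous_bracket (x y : B) : Continuous (bracket β x y) :=
  continuous_rootModular.smul (continuous_const.mul (hβ y))

theorem continuous_comp_adjointable (T : L2 B μ →L[ℂ] B) :
    Continuous fun P : Adjointable B (L2 B μ) => T.comp P.1 :=
  ((ContinuousLinearMap.compL ℂ (L2 B μ) (L2 B μ) B) T).continuous.comp continuous_subtype_val

theorem comp_mul_adjointable (T : L2 B μ →L[ℂ] B) (P Q : Adjointable B (L2 B μ)) :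
    T.comp (P * Q).1 = (T.comp P.1).comp Q.1 := rfl

include hβ hR

theorem IsRieffelProper.exists_isLaurent_bracket {x y : B} (hx : x ∈ R) (hy : y ∈ R) :
    ∃ P ∈ crossedProduct β μ, IsLaurent β μ (bracket β x y) P :=
  exists_isLaurent μ hβ (continuous_bracket hβ x y) (hR.integrable_bracket x hx y hy)

theorem IsRieffelProper.exists_isKet {x : B} (hx : x ∈ R) : ∃ T, IsKet β μ x T := by
  obtain ⟨P, -, hP⟩ := hR.exists_isLaurent_bracket hβ hx hx
  exact RieffelProper.exists_isKet hβ μ hP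

theorem IsRieffelProper.exists_isStarComp {x y : B} (hx : x ∈ R) (hy : y ∈ R)
    {S T : L2 B μ →L[ℂ] B} (hS : IsKet β μ x S) (hT : IsKet β μ y T) :
    ∃ P ∈ crossedProduct β μ, IsStarComp S T P := by
  obtain ⟨P, hP, h⟩ := hR.exists_isLaurent_bracket hβ hx hy
  exact ⟨P, hP, (isStarComp_iff_isLaurent hβ μ hS hT).2 h⟩

omit hR in
-- Since |x*g⟩⟩ = |x⟩⟩λ_g, questions about R̃ reduce to elements of R, whose brackets are
-- integrable.
theorem isKet_elementConv_iff {x : B} {S T : L2 B μ →L[ℂ] B} (hS : IsKet β μ x S)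
    {g : C_c(G, B)} : IsKet β μ (elementConv β μ x g) T ↔ T = S.comp (laurentOp hβ μ g).1 :=
  ⟨fun h => h.unique (hS.comp_laurentOp hβ μ g), fun h => h ▸ hS.comp_laurentOp hβ μ g⟩

/-- By continuity P = λ_ψ may be assumed, and |ξ⟩⟩λ_φ λ_ψ = |ξ⟩⟩λ_{φ*ψ} is again a generator. -/
theorem IsRieffelProper.ket_comp_mem {T : L2 B μ →L[ℂ] B} {ξ : B} (hξ : ξ ∈ R) {φ : C_c(G, B)}
    (hT : IsKet β μ (elementConv β μ ξ φ) T) {P : Adjointable B (L2 B μ)}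
    (hP : P ∈ crossedProduct β μ) : T.comp P.1 ∈ (Submodule.span ℂ
      {T | ∃ ξ ∈ R, ∃ φ : C_c(G, B), IsKet β μ (elementConv β μ ξ φ) T}).topologicalClosure := by
  obtain ⟨S, hS⟩ := hR.exists_isKet hβ hξ
  rw [isKet_elementConv_iff hβ hS] at hT
  refine crossedProduct_induction hβ μ (p := fun P => T.comp P.1 ∈ (Submodule.span ℂ
      {T | ∃ ξ ∈ R, ∃ φ : C_c(G, B), IsKet β μ (elementConv β μ ξ φ) T}).topologicalClosure)
    (IsClosed.preimage (continuous_comp_adjointable T) (Submodule.isClosed_topologicalClosure _))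
    (fun ψ => ?_) hP
  refine Submodule.le_topologicalClosure _ (Submodule.subset_span
    ⟨ξ, hξ, (IsCovariant.self hβ).convCc μ φ ψ, ?_⟩)
  rw [isKet_elementConv_iff hβ hS, ← laurentOp_mul, comp_mul_adjointable, hT]

/-- The product in question is λ_φ* λ_{⟨⟨x,y⟩⟩} λ_ψ, whose middle factor is in the crossed product
because ⟨⟨x, y⟩⟩ is integrable. -/
theorem IsRieffelProper.exists_isStarComp_elementConv {x y : B} (hx : x ∈ R) (hy : y ∈ R)
    {φ ψ : C_c(G, B)} {S T : L2 B μ →L[ℂ] B} (hS : IsKet β μ (elementConv β μ x φ) S)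
    (hT : IsKet β μ (elementConv β μ y ψ) T) : ∃ P ∈ crossedProduct β μ, IsStarComp S T P := by
  obtain ⟨S', hS'⟩ := hR.exists_isKet hβ hx
  obtain ⟨T', hT'⟩ := hR.exists_isKet hβ hy
  obtain ⟨P, hP, h⟩ := hR.exists_isStarComp hβ hx hy hS' hT'
  rw [isKet_elementConv_iff hβ hS'] at hS
  rw [isKet_elementConv_iff hβ hT'] at hT
  exact ⟨_, mul_mem (mul_mem (star_mem (laurentOp_mem hβ μ φ)) hP) (laurentOp_mem hβ μ ψ),
    hS ▸ hT ▸ h.comp _ _⟩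

/-- the Hilbert module `F(R)`, as a module of operators -/
noncomputable def IsRieffelProper.operatorModule : OperatorModule (crossedProduct β μ) :=
  OperatorModule.ofSpan (crossedProduct β μ) (isClosed_crossedProduct β μ)
    {T | ∃ ξ ∈ R, ∃ φ : C_c(G, B), IsKet β μ (elementConv β μ ξ φ) T}
    (fun _ ⟨_, hξ, _, hT⟩ _ hP => hR.ket_comp_mem hβ hξ hT hP)
    (fun _ ⟨_, hξ, _, hS⟩ _ ⟨_, hη, _, hT⟩ => hR.exists_isStarComp_elementConv hβ hξ hη hS hT)

/-- the Hilbert module `F(R)` -/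
noncomputable def IsRieffelProper.fixModule : FixModule β μ R where
  toOperatorModule := hR.operatorModule hβ
  carrier_eq := rfl
  exists_ket ξ hξ φ := by
    obtain ⟨S, hS⟩ := hR.exists_isKet hβ hξ
    exact ⟨_, Submodule.le_topologicalClosure _ (Submodule.subset_span
      ⟨ξ, hξ, φ, hS.comp_laurentOp hβ μ φ⟩), hS.comp_laurentOp hβ μ φ⟩
  isLaurent_ip x y S T hS hT :=
    (isStarComp_iff_isLaurent hβ μ hS hT).1 ((hR.operatorModule hβ).innerProd_ip S T)

end fixModule

/-! ### Rieffel properness of β -/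

section properness

variable {μ : Measure G} [μ.IsHaarMeasure] [μ.Regular] {R : Submodule ℂ A}

theorem dense_mulRange (hΦ : IsNondegenerate Φ) (hR : Dense (R : Set A)) :
    Dense (mulRange Φ R : Set B) := by
  rw [← dense_closure]
  refine hΦ.mono ?_
  have : Submodule.span ℂ {b : B | ∃ a d, b = (Φ a).fst d} ≤
      (mulRange Φ R).topologicalClosure := by
    rw [Submodule.span_le]
    rintro _ ⟨a, d, rfl⟩
    refine hR.induction (P := fun a => (Φ a).fst d ∈ (mulRange Φ R).topologicalClosure)
      (fun x hx => ?_) ?_ a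
    · exact Submodule.le_topologicalClosure _ (Submodule.subset_span ⟨x, hx, d, rfl⟩)
    · exact (Submodule.isClosed_topologicalClosure _).preimage
        (continuous_multiplier_apply Φ continuous_id continuous_const)
  exact this

theorem IsCovariant.star_mul_action (c : IsCovariant α β Φ) (x y : A) (b d : B) (t : G) :
    star ((Φ x).fst b) * β t ((Φ y).fst d) = star b * (Φ (star x * α t y)).fst (β t d) := by
  rw [star_mult_apply_mul, ← c.map_apply, map_mul, DoubleCentralizer.mul_fst]
  rfl

/-- The maps a ↦ b*Φ(a)β_t(d) form a continuous family bounded by ‖b‖‖d‖, as β_t is isometric. With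
f(t) = x*α_t(y) this is the integrability required of the generators of R_B. -/
theorem IsCovariant.integrable_star_mul_apply (c : IsCovariant α β Φ) {f : G → A}
    (hf : Continuous f) (hi : Integrable f μ) (b d : B) :
    Integrable (fun t => star b * (Φ (f t)).fst (β t d)) μ := by
  refine integrable_apply_family hf hi (T := fun t a => star b * (Φ a).fst (β t d))
    (C := ‖b‖ * ‖d‖) (continuous_const.mul (continuous_multiplier_apply Φ continuous_snd
      ((c.continuous_right d).comp continuous_fst))) fun t a => ?_
  refine (norm_mul_le _ _).trans ?_
  rw [norm_star, mul_assoc, mul_comm ‖d‖]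
  refine mul_le_mul_of_nonneg_left ((norm_multiplier_apply_le Φ a _).trans_eq ?_) (norm_nonneg b)
  rw [norm_starAlgEquiv]

theorem isRieffelProper_mulRange (c : IsCovariant α β Φ) (hΦ : IsNondegenerate Φ)
    (hR : IsRieffelProper α μ R) : IsRieffelProper β μ (mulRange Φ R) where
  dense := dense_mulRange hΦ hR.dense
  integrable_bracket ξ hξ η hη := by
    induction hξ, hη using Submodule.span_induction₂ with
    | mem_mem ξ η hξ hη =>
      obtain ⟨⟨x, hx, b, rfl⟩, y, hy, d, rfl⟩ := And.intro hξ hη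
      refine (c.integrable_star_mul_apply (continuous_bracket c.continuous_left x y)
        (hR.integrable_bracket x hx y hy) b d).congr (.of_forall fun t => ?_)
      simp only [bracket]
      rw [c.star_mul_action, ← Complex.coe_smul, map_smul, ← Complex.coe_smul, ← mul_smul_comm]
      rfl
    | zero_left η hη => exact (integrable_zero G B μ).congr (.of_forall fun t => by simp [bracket])
    | zero_right ξ hξ => exact (integrable_zero G B μ).congr (.of_forall fun t => by simp [bracket])
    | add_left x y z _ _ _ h h' =>
      refine (h.add h').congr (.of_forall fun t => ?_)
      simp [bracket, add_mul]
    | add_right x y z _ _ _ h h' =>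
      refine (h.add h').congr (.of_forall fun t => ?_)
      simp [bracket, mul_add]
    | smul_left r x y _ _ h =>
      refine (h.smul (star r)).congr (.of_forall fun t => ?_)
      simp only [bracket, Pi.smul_apply, star_smul, smul_mul_assoc]
      exact smul_comm _ _ _
    | smul_right r x y _ _ h =>
      refine (h.smul r).congr (.of_forall fun t => ?_)
      simp only [bracket, Pi.smul_apply, map_smul, mul_smul_comm]
      exact smul_comm _ _ _
  integrable ξ hξ η hη := by
    induction hξ, hη using Submodule.span_induction₂ with
    | mem_mem ξ η hξ hη =>
      obtain ⟨⟨x, hx, b, rfl⟩, y, hy, d, rfl⟩ := And.intro hξ hη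
      refine (c.integrable_star_mul_apply (continuous_const.mul (c.continuous_left y))
        (hR.integrable x hx y hy) b d).congr (.of_forall fun t => ?_)
      exact (c.star_mul_action x y b d t).symm
    | zero_left η hη => simp
    | zero_right ξ hξ => simp
    | add_left x y z _ _ _ h h' =>
      refine (h.add h').congr (.of_forall fun t => ?_)
      simp [add_mul]
    | add_right x y z _ _ _ h h' =>
      refine (h.add h').congr (.of_forall fun t => ?_)
      simp [mul_add]
    | smul_left r x y _ _ h =>
      refine (h.smul (star r)).congr (.of_forall fun t => ?_)
      simp only [Pi.smul_apply, star_smul, smul_mul_assoc]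
    | smul_right r x y _ _ h =>
      refine (h.smul r).congr (.of_forall fun t => ?_)
      simp only [Pi.smul_apply, map_smul, mul_smul_comm]

end properness

end

/-! ### The map T ↦ T ⊗ 1 on concrete Hilbert modules -/

section operatorModules

variable {A : Type*} {B : Type*} {E : Type*} {F : Type*} [NonUnitalCStarAlgebra A]
  [NonUnitalCStarAlgebra B]
  [NormedAddCommGroup E] [NormedSpace ℂ E] [HilbertModule A E]
  [NormedAddCommGroup F] [NormedSpace ℂ F] [HilbertModule B F]
  {Φ : A →⋆ₙₐ[ℂ] 𝓜(ℂ, B)}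

theorem IsStarComp.norm_apply_le {T : E →L[ℂ] A} {P : Adjointable A E} (h : IsStarComp T T P)
    (x : E) : ‖T x‖ ≤ √‖P‖ * ‖x‖ := by
  rw [← abs_of_nonneg (norm_nonneg (T x)), ← abs_of_nonneg (a := √‖P‖ * _) (by positivity),
    ← sq_le_sq, mul_pow, Real.sq_sqrt (norm_nonneg _), sq ‖T x‖, ← CStarRing.norm_star_mul_self,
    ← h]
  refine (norm_innerProd_le _ _).trans ?_
  rw [sq, mul_left_comm]
  exact mul_le_mul_of_nonneg_left (P.1.le_opNorm _) (norm_nonneg _)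

/-- A closed subspace of the closed span `X` of `s` is all of `X` if it contains `s`. -/
theorem mem_of_mem_topologicalClosure_span {V : Type*} [NormedAddCommGroup V] [NormedSpace ℂ V]
    {X : Submodule ℂ V} {s : Set V} (hX : X = (Submodule.span ℂ s).topologicalClosure)
    {W : Submodule ℂ X} (hW : IsClosed (W : Set X)) (h : ∀ x (hx : x ∈ X), x ∈ s → ⟨x, hx⟩ ∈ W)
    (x : X) : x ∈ W := by
  have hXc : IsClosed (X : Set V) := hX ▸ Submodule.isClosed_topologicalClosure _
  have hs : s ⊆ X := fun x hx => by
    rw [hX]; exact Submodule.le_topologicalClosure _ (Submodule.subset_span hx)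
  have hcl : IsClosed (W.map X.subtype : Set V) :=
    hXc.isClosedEmbedding_subtypeVal.isClosedMap _ hW
  have hle : (Submodule.span ℂ s).topologicalClosure ≤ W.map X.subtype :=
    Submodule.topologicalClosure_minimal _ (Submodule.span_le.2 fun y hy =>
      ⟨⟨y, hs hy⟩, h y (hs hy) hy, rfl⟩) hcl
  have hx : x.1 ∈ (Submodule.span ℂ s).topologicalClosure := hX ▸ x.2
  obtain ⟨y, hy, e⟩ := hle hx
  have : y = x := Subtype.ext e
  exact this ▸ hy

namespace IsInduced

variable {j : E →ₗ[ℂ] B →ₗ[ℂ] F} (h : IsInduced Φ j)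
include h

theorem ket_comp {T : E →L[ℂ] A} {P : Adjointable A E} (hP : IsStarComp T T P)
    (Q : Adjointable A E) : ket Φ j (T.comp Q.1) = (ket Φ j T).comp (h.map Q).1 :=
  h.ext fun x b => by
    rw [h.ket_apply (hP.comp Q Q), ContinuousLinearMap.comp_apply, ContinuousLinearMap.comp_apply,
      h.map_apply, h.ket_apply hP]

variable {C : NonUnitalStarSubalgebra ℂ (Adjointable A E)} (X : OperatorModule C)

/-- the bounded linear map `T ↦ T ⊗ 1` on a concrete Hilbert module -/
noncomputable def ketL : X.carrier →L[ℂ] F →L[ℂ] B :=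
  have hX : ∀ T : X.carrier, IsStarComp T.1 T.1 (X.ip T T).1 := fun T => X.innerProd_ip T T
  LinearMap.mkContinuous
    { toFun := fun T => ket Φ j T.1
      map_add' := fun S T => h.ext fun x b => by
        rw [add_apply, h.ket_apply (hX S), h.ket_apply (hX T), h.ket_apply (hX (S + T))]
        change (Φ (S.1 x + T.1 x)).fst b = _
        rw [map_add]
        rfl
      map_smul' := fun z T => h.ext fun x b => by
        rw [RingHom.id_apply, smul_apply, h.ket_apply (hX T), h.ket_apply (hX (z • T))]
        change (Φ (z • T.1 x)).fst b = _
        rw [map_smul]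
        rfl } 1
    fun T => by
      refine ContinuousLinearMap.opNorm_le_bound _ (by positivity) fun x => ?_
      refine ((h.isStarComp_ket (hX T) (hX T) (hX T)).norm_apply_le x).trans ?_
      refine mul_le_mul_of_nonneg_right ?_ (norm_nonneg x)
      rw [one_mul]
      refine Real.sqrt_le_iff.2 ⟨norm_nonneg T, ?_⟩
      refine (NonUnitalStarAlgHom.norm_apply_le h.map (X.ip T T).1).trans ?_
      rw [sq]
      exact (hX T).norm_le

theorem ketL_apply (T : X.carrier) : h.ketL X T = ket Φ j T.1 := rfl

theorem isStarComp_ketL (S T : X.carrier) :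
    IsStarComp (h.ketL X S) (h.ketL X T) (h.map (X.ip S T).1) :=
  h.isStarComp_ket (X.innerProd_ip S T) (X.innerProd_ip S S) (X.innerProd_ip T T)

end IsInduced

/-- `P ↦ T ∘ P` -/
noncomputable def compAdjointable (T : E →L[ℂ] A) : Adjointable A E →L[ℂ] E →L[ℂ] A :=
  (ContinuousLinearMap.compL ℂ E E A T).comp (Adjointable A E).toSubmodule.subtypeL

theorem compAdjointable_apply (T : E →L[ℂ] A) (P : Adjointable A E) :
    compAdjointable T P = T.comp P.1 := rfl

end operatorModules

/-! ### From F(R_A) to F(R_B) -/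

section

variable {G : Type*} [TopologicalSpace G] [Group G] [IsTopologicalGroup G]
  [LocallyCompactSpace G] [T2Space G] [MeasurableSpace G] [BorelSpace G]
  {A : Type*} [NonUnitalCStarAlgebra A] {B : Type*} [NonUnitalCStarAlgebra B]
  {α : G →* (A ≃⋆ₐ[ℂ] A)} {β : G →* (B ≃⋆ₐ[ℂ] B)} {Φ : A →⋆ₙₐ[ℂ] 𝓜(ℂ, B)}
  (c : IsCovariant α β Φ) {μ : Measure G} [μ.IsHaarMeasure] [μ.Regular]

/-- the linear functional `f ↦ ∫ Δ(t)^(-1/2) Φ(α_{t⁻¹}(x)) f(t) dt` -/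
noncomputable def IsCovariant.ketAlong (μ : Measure G) [IsFiniteMeasureOnCompacts μ]
    (c : IsCovariant α β Φ) (x : A) : C_c(G, B) →ₗ[ℂ] B :=
  have hi := integrable_ketAlong_integrand (Φ := Φ) μ c.continuous_left x
  { toFun := fun k => ∫ t, rootModular t • (Φ (α t⁻¹ x)).fst (k t) ∂μ
    map_add' := fun k l => by
      rw [← integral_add (hi k) (hi l)]
      simp only [CompactlySupportedContinuousMap.add_apply, map_add, smul_add]
    map_smul' := fun z k => by
      rw [RingHom.id_apply, ← integral_smul]
      simp only [CompactlySupportedContinuousMap.smul_apply, map_smul, smul_comm z] }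

theorem IsCovariant.ketAlong_apply (x : A) (k : C_c(G, B)) :
    c.ketAlong μ x k = ∫ t, rootModular t • (Φ (α t⁻¹ x)).fst (k t) ∂μ := rfl

include c in
-- The integral is not known to be bounded for the L² norm, so density in L²(G, B) does not suffice.
-- Both sides are, however, continuous for uniform convergence with supports in a fixed compact set,
-- on which Δ^(-1/2) is bounded, and in this sense the functions Φ(f(·))b are total.
theorem isKetAlong_of_tensorCc (hΦ : IsNondegenerate Φ) {x : A} {S : L2 B μ →L[ℂ] B}
    (h : ∀ f b, S (toL2 μ (tensorCc Φ b f)) = c.ketAlong μ x (tensorCc Φ b f)) :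
    IsKetAlong α Φ μ x S := by
  let D : C_c(G, B) →ₗ[ℂ] B := S.toLinearMap.comp (toL2 μ) - c.ketAlong μ x
  suffices hD : ∀ f, D f = 0 from fun f => sub_eq_zero.1 (hD f)
  intro f
  obtain ⟨K, hK, hf, happ⟩ := exists_approx_smulCc hΦ f
  obtain ⟨C, hC⟩ := hK.exists_bound_of_continuousOn
    (continuous_rootModular (G := G)).continuousOn
  have hspan : ∀ g ∈ Submodule.span ℂ {g : C_c(G, B) | ∃ h : C_c(G, ℝ),
      ∃ b ∈ {b : B | ∃ a c, b = (Φ a).fst c}, g = smulCc h b}, D g = 0 := by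
    have : Submodule.span ℂ {g : C_c(G, B) | ∃ h : C_c(G, ℝ),
      ∃ b ∈ {b : B | ∃ a c, b = (Φ a).fst c}, g = smulCc h b} ≤ LinearMap.ker D := by
      rw [Submodule.span_le]
      rintro _ ⟨k, _, ⟨a, d, rfl⟩, rfl⟩
      have e : smulCc k ((Φ a).fst d) = tensorCc Φ d (smulCc k a) := by
        ext t
        simp only [smulCc_apply, tensorCc_apply]
        rw [← Complex.coe_smul, ← Complex.coe_smul, map_smul]
        rfl
      rw [e]
      exact sub_eq_zero.2 (h (smulCc k a) d)
    exact fun g hg => this hg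
  have hbound : ∀ ε > 0, ‖D f‖ ≤ (‖S‖ * √(μ.real K) + μ.real K * (|C| * ‖x‖)) * ε := fun ε hε => by
    obtain ⟨g, hg, hgK, hfg⟩ := happ ε hε
    have hk : ∀ t ∉ K, (f - g) t = 0 := fun t ht => by
      change f t - g t = 0
      rw [hf t ht, hgK t ht, sub_zero]
    have e : D f = D (f - g) := by rw [map_sub, hspan g hg, sub_zero]
    rw [e]
    have h1 : ‖S (toL2 μ (f - g))‖ ≤ ‖S‖ * (√(μ.real K) * ε) :=
      (S.le_opNorm _).trans (mul_le_mul_of_nonneg_left (norm_toL2_le hK hk hε.le hfg)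
        (norm_nonneg S))
    have h2 : ‖c.ketAlong μ x (f - g)‖ ≤ μ.real K * (|C| * ‖x‖ * ε) := by
      rw [c.ketAlong_apply, ← setIntegral_eq_integral_of_forall_compl_eq_zero (s := K)
        fun t ht => by rw [hk t ht, map_zero, smul_zero]]
      refine (norm_setIntegral_le_of_norm_le_const hK.measure_lt_top (C := |C| * ‖x‖ * ε)
        fun t ht => ?_).trans_eq (mul_comm _ _)
      rw [norm_smul, mul_assoc]
      refine mul_le_mul ((hC t ht).trans (le_abs_self C)) ?_ (norm_nonneg _) (abs_nonneg C)
      refine (norm_multiplier_apply_le Φ _ _).trans ?_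
      rw [norm_starAlgEquiv]
      exact mul_le_mul_of_nonneg_left (hfg t) (norm_nonneg x)
    refine (norm_sub_le _ _).trans ((add_le_add h1 h2).trans_eq ?_)
    ring
  by_contra hne
  have hpos : 0 < ‖D f‖ := norm_pos_iff.2 hne
  set M := ‖S‖ * √(μ.real K) + μ.real K * (|C| * ‖x‖)
  have hM : 0 ≤ M := by positivity
  have h1 := hbound (‖D f‖ / (2 * (M + 1))) (by positivity)
  rw [mul_div_assoc', le_div_iff₀ (by positivity)] at h1
  nlinarith

include c in
-- On f ⊗ b the operator T ⊗ 1 takes the value Φ(Tf)b; applying the bounded map a ↦ Φ(a)b under the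
-- integral for Tf gives the formula on tensors.
theorem isKetAlong_ket (hΦ : IsNondegenerate Φ) {x : A} {T : L2 A μ →L[ℂ] A}
    {P : Adjointable A (L2 A μ)} (hP : IsStarComp T T P) (hT : IsKet α μ x T) :
    IsKetAlong α Φ μ x (IsInduced.ket Φ (tensorL2 Φ μ) T) := by
  refine isKetAlong_of_tensorCc c hΦ fun f b => ?_
  rw [← tensorOp_toL2, ← tensorL2_apply, (isInduced_tensorL2 Φ μ hΦ).ket_apply hP, hT,
    c.ketAlong_apply]
  have hi := integrable_ketAlong_integrand (Φ := toMult A) μ c.continuous_left x f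
  have h := ((multL Φ).flip b).integral_comp_comm hi
  refine h.symm.trans (integral_congr_ae (.of_forall fun t => ?_))
  change (Φ (rootModular t • (α t⁻¹ x * f t))).fst b
    = rootModular t • (Φ (α t⁻¹ x)).fst ((Φ (f t)).fst b)
  rw [← Complex.coe_smul, ← Complex.coe_smul, map_smul, map_mul]
  rfl

variable {R : Submodule ℂ A} (hΦ : IsNondegenerate Φ) (hR : IsRieffelProper α μ R)

include c in
/-- the operator `|ξ⟩⟩ ⊗ 1` on `L²(G, B)` for `ξ ∈ R` -/
theorem IsRieffelProper.exists_isKetAlong {ξ : A} (hξ : ξ ∈ R) :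
    ∃ S : L2 B μ →L[ℂ] B, IsKetAlong α Φ μ ξ S ∧ ∀ (φ : C_c(G, A))
      (T : (hR.operatorModule c.continuous_left).carrier), IsKet α μ (elementConv α μ ξ φ) T.1 →
      (isInduced_tensorL2 Φ μ hΦ).ketL _ T = S.comp (c.lamOp μ φ).1 := by
  obtain ⟨T₀, hT₀⟩ := hR.exists_isKet c.continuous_left hξ
  obtain ⟨P, -, hP⟩ := hR.exists_isStarComp c.continuous_left hξ hξ hT₀ hT₀
  refine ⟨_, isKetAlong_ket c hΦ hP hT₀, fun φ T hT => ?_⟩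
  -- Here T = |ξ⟩⟩λ_φ, so T ⊗ 1 = (|ξ⟩⟩ ⊗ 1)(λ_φ ⊗ 1) and λ_φ ⊗ 1 = Λ_φ.
  rw [isKet_elementConv_iff c.continuous_left hT₀] at hT
  rw [IsInduced.ketL_apply, hT, (isInduced_tensorL2 Φ μ hΦ).ket_comp hP, ← c.inflate_laurentOp μ hΦ]
  rfl

/-- the Hilbert module `F(span Φ(R) B)` as a module of operators -/
noncomputable abbrev IsRieffelProper.inducedModule : OperatorModule (crossedProduct β μ) :=
  (isRieffelProper_mulRange c hΦ hR).operatorModule c.continuous_right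

include c in
-- Because S M_b = |Φ(ξ)b⟩⟩, every S M_b λ_ψ = |(Φ(ξ)b)*ψ⟩⟩ is a generator of F(R_B), and the
-- operators M_b λ_ψ with b ∈ B are total in B ⋊ G.
theorem IsRieffelProper.comp_laurentOp_mem {ξ : A} (hξ : ξ ∈ R) {S : L2 B μ →L[ℂ] B}
    (hS : IsKetAlong α Φ μ ξ S) (ψ : C_c(G, B)) :
    S.comp (laurentOp c.continuous_right μ ψ).1 ∈ (hR.inducedModule c hΦ).carrier := by
  have cB := IsCovariant.self c.continuous_right
  refine cB.laurentOp_mem_of_coeffAdj μ (isNondegenerate_toMult B)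
    (N := (hR.inducedModule c hΦ).carrier.comap (compAdjointable S).toLinearMap)
    ((hR.inducedModule c hΦ).isClosed.preimage (compAdjointable S).continuous) (fun b ψ => ?_) ψ
  refine Submodule.le_topologicalClosure _ (Submodule.subset_span
    ⟨(Φ ξ).fst b, Submodule.subset_span ⟨ξ, hξ, b, rfl⟩, ψ, ?_⟩)
  exact (hS.comp_coeffOp μ c b).comp_laurentOp c.continuous_right μ ψ

/-- For T = |ξ*φ⟩⟩ and Q = λ_ψ the operator is S Λ_φ λ_ψ = S λ_{φ*ψ} with S = |ξ⟩⟩ ⊗ 1; linearity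
and continuity in T and Q do the rest. -/
theorem IsRieffelProper.ketL_comp_mem (T : (hR.operatorModule c.continuous_left).carrier)
    {Q : Adjointable B (L2 B μ)} (hQ : Q ∈ crossedProduct β μ) :
    ((isInduced_tensorL2 Φ μ hΦ).ketL _ T).comp Q.1 ∈ (hR.inducedModule c hΦ).carrier := by
  let l : (hR.operatorModule c.continuous_left).carrier →L[ℂ] L2 B μ →L[ℂ] B :=
    ((ContinuousLinearMap.compL ℂ (L2 B μ) (L2 B μ) B).flip Q.1).comp
      ((isInduced_tensorL2 Φ μ hΦ).ketL _)
  refine mem_of_mem_topologicalClosure_span (X := (hR.operatorModule c.continuous_left).carrier)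
    (W := (hR.inducedModule c hΦ).carrier.comap l.toLinearMap) rfl
    ((hR.inducedModule c hΦ).isClosed.preimage l.continuous) ?_ T
  rintro T hTm ⟨ξ, hξ, φ, hT⟩
  obtain ⟨S, hS, h⟩ := hR.exists_isKetAlong c hΦ hξ
  change ((isInduced_tensorL2 Φ μ hΦ).ketL _ ⟨T, hTm⟩).comp Q.1 ∈ (hR.inducedModule c hΦ).carrier
  rw [h φ ⟨T, hTm⟩ hT]
  refine crossedProduct_induction c.continuous_right μ
    (p := fun Q => (S.comp (c.lamOp μ φ).1).comp Q.1 ∈ (hR.inducedModule c hΦ).carrier)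
    ((hR.inducedModule c hΦ).isClosed.preimage (continuous_comp_adjointable _)) (fun ψ => ?_) hQ
  rw [← comp_mul_adjointable, laurentOp, c.lamOp_mul_lamOp]
  exact hR.comp_laurentOp_mem c hΦ hξ hS _

/-- This is the density of the range. With S = |ξ⟩⟩ ⊗ 1, the operators S Λ_φ λ_ψ = (|ξ*φ⟩⟩ ⊗ 1)λ_ψ
lie in the span on the right, hence S λ_ψ lies in its closure since the Λ_φ λ_ψ are total. For η =
Φ(ξ)b one has |η*ψ⟩⟩ = S M_b λ_ψ = S λ_{bψ}. -/
theorem IsRieffelProper.inducedModule_le :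
    (hR.inducedModule c hΦ).carrier ≤ (Submodule.span ℂ {S : L2 B μ →L[ℂ] B |
      ∃ (T : (hR.operatorModule c.continuous_left).carrier) (Q : CrossedProduct β μ),
        S = ((isInduced_tensorL2 Φ μ hΦ).ketL _ T).comp Q.op.1}).topologicalClosure := by
  set M := (Submodule.span ℂ {S : L2 B μ →L[ℂ] B |
      ∃ (T : (hR.operatorModule c.continuous_left).carrier) (Q : CrossedProduct β μ),
        S = ((isInduced_tensorL2 Φ μ hΦ).ketL _ T).comp Q.op.1}).topologicalClosure with hM
  have hMc : IsClosed (M : Set (L2 B μ →L[ℂ] B)) := Submodule.isClosed_topologicalClosure _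
  have key : ∀ ξ ∈ R, ∃ S : L2 B μ →L[ℂ] B, IsKetAlong α Φ μ ξ S ∧
      ∀ ψ, S.comp (laurentOp c.continuous_right μ ψ).1 ∈ M := fun ξ hξ => by
    obtain ⟨S, hS, h⟩ := hR.exists_isKetAlong c hΦ hξ
    refine ⟨S, hS, c.laurentOp_mem_of_lamOp μ hΦ (N := M.comap (compAdjointable S).toLinearMap)
      (hMc.preimage (compAdjointable S).continuous) fun φ ψ => ?_⟩
    obtain ⟨T, hTm, hT⟩ := (hR.fixModule c.continuous_left).exists_ket ξ hξ φ
    refine Submodule.le_topologicalClosure _ (Submodule.subset_span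
      ⟨⟨T, hTm⟩, laurentCP c.continuous_right μ ψ, ?_⟩)
    rw [h φ ⟨T, hTm⟩ hT, op_laurentCP, ← comp_mul_adjointable]
    exact compAdjointable_apply S _
  have key2 : ∀ η ∈ mulRange Φ R, ∃ S : L2 B μ →L[ℂ] B, IsKet β μ η S ∧
      ∀ ψ, S.comp (laurentOp c.continuous_right μ ψ).1 ∈ M := fun η hη => by
    induction hη using Submodule.span_induction with
    | mem η hη =>
      obtain ⟨ξ, hξ, b, rfl⟩ := hη
      obtain ⟨S, hS, h⟩ := key ξ hξ
      refine ⟨_, hS.comp_coeffOp μ c b, fun ψ => ?_⟩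
      rw [← comp_mul_adjointable, laurentOp, IsCovariant.coeffAdj_mul_lamOp]
      exact h _
    | zero => exact ⟨0, isKet_zero μ, fun ψ => by
        rw [ContinuousLinearMap.zero_comp]; exact zero_mem _⟩
    | add x y _ _ h h' =>
      obtain ⟨⟨S, hS, h⟩, S', hS', h'⟩ := And.intro h h'
      exact ⟨S + S', hS.add c.continuous_right μ hS', fun ψ => by
        rw [ContinuousLinearMap.add_comp]; exact add_mem (h ψ) (h' ψ)⟩
    | smul z x _ h =>
      obtain ⟨S, hS, h⟩ := h
      exact ⟨z • S, hS.smul μ z, fun ψ => by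
        rw [ContinuousLinearMap.smul_comp]; exact Submodule.smul_mem _ z (h ψ)⟩
  refine Submodule.topologicalClosure_minimal _ (Submodule.span_le.2 ?_) hMc
  rintro T ⟨η, hη, ψ, hT⟩
  obtain ⟨S, hS, h⟩ := key2 η hη
  rw [isKet_elementConv_iff c.continuous_right hS] at hT
  exact hT ▸ h ψ

end

/-- A Hilbert module which is an interior tensor product is isomorphic to the interior tensor
product. -/
theorem IsInduced.exists_iso {C : Type*} {D : Type*} {X : Type*} {F : Type*}
    [NonUnitalCStarAlgebra C] [NonUnitalCStarAlgebra D] [NormedAddCommGroup X] [NormedSpace ℂ X]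
    [HilbertModule C X] [NormedAddCommGroup F] [NormedSpace ℂ F] [HilbertModule D F]
    {Ψ : C →⋆ₙₐ[ℂ] 𝓜(ℂ, D)} {k : X →ₗ[ℂ] D →ₗ[ℂ] F} (h : IsInduced Ψ k) :
    ∃ U : HilbertModuleIso D (InteriorTensor X Ψ) F,
      ∀ x d, U.toFun (interiorTmul Ψ x d) = k x d := by
  obtain ⟨U, hU⟩ := exists_hilbertModuleIso (tensorPre X Ψ) (TensorProduct.lift k)
    h.innerProd_lift h.denseRange_lift
  exact ⟨U, fun x d => (hU (x ⊗ₜ d)).trans (TensorProduct.lift.tmul x d)⟩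

/-! ### The canonical isomorphism -/

section

variable {G : Type*} [TopologicalSpace G] [Group G] [IsTopologicalGroup G]
  [LocallyCompactSpace G] [T2Space G] [MeasurableSpace G] [BorelSpace G]
  {A : Type*} [NonUnitalCStarAlgebra A] {B : Type*} [NonUnitalCStarAlgebra B]
  {α : G →* (A ≃⋆ₐ[ℂ] A)} {β : G →* (B ≃⋆ₐ[ℂ] B)} {Φ : A →⋆ₙₐ[ℂ] 𝓜(ℂ, B)}
  (c : IsCovariant α β Φ) {μ : Measure G} [μ.IsHaarMeasure] [μ.Regular]
  {R : Submodule ℂ A} (hΦ : IsNondegenerate Φ) (hR : IsRieffelProper α μ R)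

namespace IsRieffelProper

/-- the Hilbert module `F(span Φ(R) B)` -/
noncomputable abbrev inducedFixModule : FixModule β μ (mulRange Φ R) :=
  (isRieffelProper_mulRange c hΦ hR).fixModule c.continuous_right

/-- `(T ⊗ 1) ∘ Q` as an element of `F(span Φ(R) B)` -/
noncomputable def tensorKet (T : (hR.fixModule c.continuous_left).Carrier)
    (Q : CrossedProduct β μ) : (hR.inducedFixModule c hΦ).Carrier :=
  ⟨((isInduced_tensorL2 Φ μ hΦ).ketL (hR.operatorModule c.continuous_left) T).comp Q.op.1,
    hR.ketL_comp_mem c hΦ T Q.2⟩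

theorem tensorKet_val (T : (hR.fixModule c.continuous_left).Carrier) (Q : CrossedProduct β μ) :
    (hR.tensorKet c hΦ T Q).1 = ((isInduced_tensorL2 Φ μ hΦ).ketL
      (hR.operatorModule c.continuous_left) T).comp Q.op.1 := rfl

/-- The product ((S ⊗ 1)P)*((T ⊗ 1)Q) is P*(S*T ⊗ 1)Q, and S*T ⊗ 1 acts on B ⋊ G as the multiplier
Ψ(⟨S, T⟩). -/
theorem isStarComp_tensorKet (S T : (hR.fixModule c.continuous_left).Carrier)
    (P Q : CrossedProduct β μ) :
    IsStarComp (hR.tensorKet c hΦ S P).1 (hR.tensorKet c hΦ T Q).1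
      (star P * (c.crossedHom μ hΦ (innerProd (CrossedProduct α μ) S T)).fst Q).op := by
  have h := ((isInduced_tensorL2 Φ μ hΦ).isStarComp_ketL
    (hR.operatorModule c.continuous_left) S T).comp P.op Q.op
  rw [mul_assoc] at h
  exact h

theorem innerProd_tensorKet (S T : (hR.fixModule c.continuous_left).Carrier)
    (P Q : CrossedProduct β μ) :
    innerProd (CrossedProduct β μ) (hR.tensorKet c hΦ S P) (hR.tensorKet c hΦ T Q)
      = star P * (c.crossedHom μ hΦ (innerProd (CrossedProduct α μ) S T)).fst Q :=
  (hR.inducedFixModule c hΦ).toOperatorModule.ip_eq (hR.isStarComp_tensorKet c hΦ S T P Q)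

/-- the bilinear map `(T, Q) ↦ (T ⊗ 1) ∘ Q` -/
noncomputable def tensorMap : (hR.fixModule c.continuous_left).Carrier →ₗ[ℂ]
    CrossedProduct β μ →ₗ[ℂ] (hR.inducedFixModule c hΦ).Carrier :=
  LinearMap.mk₂ ℂ (hR.tensorKet c hΦ)
    (fun S T Q => Subtype.ext ((congrArg (fun V : L2 B μ →L[ℂ] B => V.comp Q.op.1)
      (map_add ((isInduced_tensorL2 Φ μ hΦ).ketL (hR.operatorModule c.continuous_left)) S T)).trans
        (ContinuousLinearMap.add_comp _ _ _)))
    (fun z T Q => Subtype.ext ((congrArg (fun V : L2 B μ →L[ℂ] B => V.comp Q.op.1)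
      (map_smul ((isInduced_tensorL2 Φ μ hΦ).ketL (hR.operatorModule c.continuous_left)) z T)).trans
        (ContinuousLinearMap.smul_comp _ _ _)))
    (fun T P Q => Subtype.ext (by
      rw [Submodule.coe_add, tensorKet_val, tensorKet_val, tensorKet_val]
      exact ContinuousLinearMap.comp_add _ _ _))
    (fun z T Q => Subtype.ext (by
      rw [Submodule.coe_smul, tensorKet_val, tensorKet_val]
      exact ContinuousLinearMap.comp_smul _ _ _))

theorem isInduced_tensorMap : IsInduced (E := (hR.fixModule c.continuous_left).Carrier)
    (F := (hR.inducedFixModule c hΦ).Carrier) (c.crossedHom μ hΦ) (hR.tensorMap c hΦ) where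
  innerProd_apply S T P Q := hR.innerProd_tensorKet c hΦ S T P Q
  dense := fun y => by
    have hy := hR.inducedModule_le c hΦ y.2
    refine Metric.mem_closure_iff.2 fun ε hε => ?_
    obtain ⟨z, hz, hlt⟩ := Metric.mem_closure_iff.1 hy ε hε
    have hle : Submodule.span ℂ {S : L2 B μ →L[ℂ] B |
        ∃ (T : (hR.operatorModule c.continuous_left).carrier) (Q : CrossedProduct β μ),
          S = ((isInduced_tensorL2 Φ μ hΦ).ketL _ T).comp Q.op.1} ≤
        (Submodule.span ℂ {z | ∃ T Q, z = hR.tensorMap c hΦ T Q}).map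
          (hR.inducedFixModule c hΦ).carrier.subtype := by
      rw [Submodule.span_le]
      rintro _ ⟨T, Q, rfl⟩
      exact ⟨hR.tensorKet c hΦ T Q, Submodule.subset_span ⟨T, Q, rfl⟩, rfl⟩
    obtain ⟨v, hv, rfl⟩ := hle hz
    exact ⟨v, hv, hlt⟩

/-- Only the operator |x⟩⟩ enters in (|x⟩⟩ ⊗ 1)λ_g = |Φ(x)*g⟩⟩, so x need not belong to R̃; it
suffices that |x⟩⟩ lies in F(R_A). -/
theorem isKet_tensorKet {x : A} {T : (hR.fixModule c.continuous_left).Carrier} {g : C_c(G, B)}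
    {Q : CrossedProduct β μ} (hT : IsKet α μ x T.1) (hQ : IsLaurent β μ g Q.op) :
    IsKet β μ (multiplierConv β μ (Φ x) g) (hR.tensorKet c hΦ T Q).1 := by
  rw [isLaurent_iff c.continuous_right] at hQ
  rw [tensorKet_val, hQ]
  exact (isKetAlong_ket c hΦ ((hR.operatorModule c.continuous_left).innerProd_ip T T)
    hT).comp_laurentOp μ c g

/-! ### Saturation -/

section saturation

/-- the elements `⟨⟨ξ * φ, η * ψ⟩⟩` of the reduced crossed product with `ξ, η ∈ R` -/
def brackets (β : G →* (B ≃⋆ₐ[ℂ] B)) (μ : Measure G) [IsFiniteMeasureOnCompacts μ]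
    (R : Submodule ℂ B) : Set (CrossedProduct β μ) :=
  {P | ∃ ξ ∈ R, ∃ η ∈ R, ∃ φ ψ : C_c(G, B),
    IsLaurent β μ (bracket β (elementConv β μ ξ φ) (elementConv β μ η ψ)) P.op}

variable {R' : Submodule ℂ B} (hβ : ∀ b, Continuous fun t => β t b)
  (hR' : IsRieffelProper β μ R')

include hβ hR' in
theorem star_brackets {P : CrossedProduct β μ} (hP : P ∈ brackets β μ R') :
    star P ∈ brackets β μ R' := by
  obtain ⟨ξ, hξ, η, hη, φ, ψ, h⟩ := hP
  obtain ⟨S, -, hS⟩ := (hR'.fixModule hβ).exists_ket ξ hξ φ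
  obtain ⟨T, -, hT⟩ := (hR'.fixModule hβ).exists_ket η hη ψ
  rw [← isStarComp_iff_isLaurent hβ μ hS hT] at h
  exact ⟨η, hη, ξ, hξ, ψ, φ, (isStarComp_iff_isLaurent hβ μ hT hS).1 h.adjoint⟩

include hβ hR' in
theorem star_mem_span_brackets {P : CrossedProduct β μ}
    (hP : P ∈ (Submodule.span ℂ (brackets β μ R')).topologicalClosure) :
    star P ∈ (Submodule.span ℂ (brackets β μ R')).topologicalClosure := by
  have hcl : IsClosed {P : CrossedProduct β μ |
      star P ∈ (Submodule.span ℂ (brackets β μ R')).topologicalClosure} :=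
    (Submodule.isClosed_topologicalClosure _).preimage continuous_star
  refine closure_minimal (fun P hP => ?_) hcl hP
  refine Submodule.le_topologicalClosure _ ?_
  induction hP using Submodule.span_induction with
  | mem P hP => exact Submodule.subset_span (star_brackets hβ hR' hP)
  | zero => rw [star_zero]; exact zero_mem _
  | add P Q _ _ h h' => rw [star_add]; exact add_mem h h'
  | smul z P _ h => rw [star_smul]; exact Submodule.smul_mem _ _ h

/-- The inner products of `F(R)` belong to the closed span of the elements `⟨⟨ξ * φ, η * ψ⟩⟩`. -/
theorem innerProd_mem_brackets (S T : (hR'.fixModule hβ).Carrier) :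
    innerProd (CrossedProduct β μ) S T
      ∈ (Submodule.span ℂ (brackets β μ R')).topologicalClosure := by
  set N := (Submodule.span ℂ (brackets β μ R')).topologicalClosure
  have hN : IsClosed (N : Set (CrossedProduct β μ)) := Submodule.isClosed_topologicalClosure _
  -- The inner product is linear and continuous in the second variable; the first variable is
  -- reached by taking adjoints, under which the closed span is stable.
  have step : ∀ S : (hR'.fixModule hβ).Carrier, (∀ T (hT : T ∈ (hR'.fixModule hβ).carrier),
      T ∈ {T | ∃ ξ ∈ R', ∃ φ : C_c(G, B), IsKet β μ (elementConv β μ ξ φ) T} →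
      innerProd (CrossedProduct β μ) S (⟨T, hT⟩ : (hR'.fixModule hβ).Carrier) ∈ N) →
      ∀ T, innerProd (CrossedProduct β μ) S T ∈ N := fun S h T =>
    mem_of_mem_topologicalClosure_span (X := (hR'.fixModule hβ).carrier)
      (W := N.comap (innerProdL (CrossedProduct β μ) S).toLinearMap)
      (hR'.fixModule hβ).carrier_eq
      (hN.preimage (innerProdL (CrossedProduct β μ) S).continuous) h T
  refine step S (fun T hT hTs => ?_) T
  rw [← star_innerProd]
  refine star_mem_span_brackets hβ hR' (step ⟨T, hT⟩ (fun S hS hSs => ?_) S)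
  obtain ⟨⟨ξ, hξ, φ, h1⟩, η, hη, ψ, h2⟩ := And.intro hTs hSs
  exact Submodule.le_topologicalClosure _ (Submodule.subset_span ⟨ξ, hξ, η, hη, φ, ψ,
    (hR'.fixModule hβ).isLaurent_ip _ _ ⟨T, hT⟩ ⟨S, hS⟩ h1 h2⟩)

include c hΦ hR in
-- The closed span N of the brackets contains all PΨ(C)Q, first for brackets C and then for all C by
-- saturation of A; nondegeneracy of Ψ yields all PQ, and products are total in a C*-algebra.
theorem isSaturated_mulRange (hs : IsSaturated α μ R) : IsSaturated β μ (mulRange Φ R) := by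
  have hRB := isRieffelProper_mulRange c hΦ hR
  set N := (Submodule.span ℂ (brackets β μ (mulRange Φ R))).topologicalClosure with hNdef
  have hN : IsClosed (N : Set (CrossedProduct β μ)) := Submodule.isClosed_topologicalClosure _
  have hmul : ∀ (P Q : CrossedProduct β μ) (C : CrossedProduct α μ),
      P * (c.crossedHom μ hΦ C).fst Q ∈ N := fun P Q C => by
    refine hs.induction (P := fun C => P * (c.crossedHom μ hΦ C).fst Q ∈ N) (fun C hC => ?_)
      (hN.preimage (continuous_const.mul
        (continuous_multiplier_apply (c.crossedHom μ hΦ) continuous_id continuous_const))) C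
    induction hC using Submodule.span_induction with
    | mem C hC =>
      obtain ⟨ξ, hξ, η, hη, φ, ψ, h⟩ := hC
      obtain ⟨S, hSm, hS⟩ := (hR.fixModule c.continuous_left).exists_ket ξ hξ φ
      obtain ⟨T, hTm, hT⟩ := (hR.fixModule c.continuous_left).exists_ket η hη ψ
      -- A symbol determines its operator, so the bracket C is the inner product of the kets S and
      -- T.
      have e : innerProd (CrossedProduct α μ)
          (⟨S, hSm⟩ : (hR.fixModule c.continuous_left).Carrier) ⟨T, hTm⟩ = C :=
        CrossedProduct.op_injective μ (isLaurent_unique μ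
          ((hR.fixModule c.continuous_left).isLaurent_ip _ _ ⟨S, hSm⟩ ⟨T, hTm⟩ hS hT) h)
      -- The left factor P enters through its adjoint: PΨ(⟨S, T⟩)Q = ⟨(S ⊗ 1)P*, (T ⊗ 1)Q⟩.
      have h2 := innerProd_mem_brackets c.continuous_right hRB
        (hR.tensorKet c hΦ ⟨S, hSm⟩ (star P)) (hR.tensorKet c hΦ ⟨T, hTm⟩ Q)
      rwa [innerProd_tensorKet, e, star_star] at h2
    | zero => simp
    | add C C' _ _ h h' =>
      rw [map_add, DoubleCentralizer.add_fst, add_apply, mul_add]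
      exact add_mem h h'
    | smul z C _ h =>
      rw [map_smul, DoubleCentralizer.smul_fst, smul_apply, mul_smul_comm]
      exact Submodule.smul_mem _ z h
  have hmul2 : ∀ P Q : CrossedProduct β μ, P * Q ∈ N := fun P Q => by
    refine (c.isNondegenerate_crossedHom μ hΦ).induction (P := fun Q => P * Q ∈ N)
      (fun Q hQ => ?_) (hN.preimage (continuous_const.mul continuous_id)) Q
    induction hQ using Submodule.span_induction with
    | mem Q hQ =>
      obtain ⟨C, Q, rfl⟩ := hQ
      exact hmul P Q C
    | zero => rw [mul_zero]; exact zero_mem _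
    | add Q Q' _ _ h h' => rw [mul_add]; exact add_mem h h'
    | smul z Q _ h => rw [mul_smul_comm]; exact Submodule.smul_mem _ z h
  change Dense (Submodule.span ℂ (brackets β μ (mulRange Φ R)) : Set (CrossedProduct β μ))
  rw [← dense_closure]
  refine (isNondegenerate_toMult (CrossedProduct β μ)).mono ?_
  have : Submodule.span ℂ {b : CrossedProduct β μ |
      ∃ a d, b = (toMult (CrossedProduct β μ) a).fst d} ≤ N := by
    rw [Submodule.span_le]
    rintro _ ⟨P, Q, rfl⟩
    exact hmul2 P Q
  exact this

end saturation

end IsRieffelProper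

end

end RieffelProper

/-! ### The corollary -/

open RieffelProper
theorem corollary2p6 {G A B : Type*} [TopologicalSpace G] [Group G] [IsTopologicalGroup G]
    [LocallyCompactSpace G] [T2Space G] [MeasurableSpace G] [BorelSpace G]
    (μ : Measure G) [μ.IsHaarMeasure] [μ.Regular]
    [NonUnitalCStarAlgebra A] [NonUnitalCStarAlgebra B]
    (α : G →* (A ≃⋆ₐ[ℂ] A)) (hα : ∀ a, Continuous fun t => α t a)
    (β : G →* (B ≃⋆ₐ[ℂ] B)) (hβ : ∀ b, Continuous fun t => β t b)
    (Φ : A →⋆ₙₐ[ℂ] 𝓜(ℂ, B)) (hΦ : IsNondegenerate Φ)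
    (hΦG : ∀ t a b, (Φ (α t a)).fst (β t b) = β t ((Φ a).fst b))
    (R : Submodule ℂ A) (hR : IsRieffelProper α μ R) :
    IsRieffelProper β μ (mulRange Φ R) ∧
    (∃ Ψ : CrossedProduct α μ →⋆ₙₐ[ℂ] 𝓜(ℂ, CrossedProduct β μ),
      (∀ Ψ', IsAssociated Φ Ψ' ↔ Ψ' = Ψ) ∧ IsNondegenerate Ψ ∧
      ∃ (FA : FixModule α μ R) (FB : FixModule β μ (mulRange Φ R))
        (U : HilbertModuleIso (CrossedProduct β μ) (InteriorTensor FA.Carrier Ψ) FB.Carrier),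
        ∀ (x : A) (T : FA.Carrier) (g : C_c(G, B)) (Q : CrossedProduct β μ),
          IsKet α μ x T.1 → IsLaurent β μ g Q.op →
          IsKet β μ (multiplierConv β μ (Φ x) g) (U.toFun (interiorTmul Ψ T Q)).1) ∧
    (IsSaturated α μ R → IsSaturated β μ (mulRange Φ R)) := by
  have c : IsCovariant α β Φ := ⟨hα, hβ, hΦG⟩
  refine ⟨isRieffelProper_mulRange c hΦ hR, ⟨c.crossedHom μ hΦ, c.isAssociated_iff μ hΦ,
    c.isNondegenerate_crossedHom μ hΦ, hR.fixModule c.continuous_left,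
    hR.inducedFixModule c hΦ, ?_⟩, hR.isSaturated_mulRange c hΦ⟩
  obtain ⟨U, hU⟩ := (hR.isInduced_tensorMap c hΦ).exists_iso
  refine ⟨U, fun x T g Q hT hQ => ?_⟩
  rw [hU]
  exact hR.isKet_tensorKet c hΦ hT hQ
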